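/- Let $G=(V,E)$ be a finite or countable graph in which every vertex has finite degree; write $x\sim y$ for adjacency. Let $\Omega_\infty$ be the set of right-continuous, non-exploding nearest-neighbour jump paths $\omega:[0,\infty)\to V$ (finitely many jumps in every compact interval), with the Skorokhod topology and the natural filtration $(\mathscr F_t)$ of the coordinate process. Let $\Omega$ be the set of right-continuous minimal nearest-neighbour jump paths in $V$ with a finite or infinite lifetime, sent to a cemetery point after the lifetime, with the $\sigma$-field $\mathscr B$ generated by the coordinates. If a path is alive at time $t$, a function of $\omega_{[0,t]}$ is evaluated at the path that follows $\omega$ on $[0,t]$ and stays at $\omega_t$ afterwards. A stopping time $T:\Omega_\infty\to[0,\infty]$ of $(\mathscr F_t)$ is called LSC if it is lower semi-continuous. It is called regular if for all $\omega,t$ with $t<T(\omega)$ there is $l>0$ such that for all $0<s\le l$ and $y\sim\omega_t$ the path that follows $\omega$ on $[0,t]$, stays at $\omega_t$ until time $t+s$, jumps then to $y$ and stays there forever has $T\ge t+l$. Let $\mathscr D_T=\{(t,x,y,\omega): 0\le t<T(\omega),\ x\sim y,\ \omega_t=x\}$. A function $r=r_t(x,y,\omega)\ge 0$ on $\mathscr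 D_T$ is a family of $T$-terminated jump rates if it is continuous for the product topology and, for all $x\sim y$, the process $r_t(x,y)1_{\{t<T,\ \omega_t=x\}}$ is adapted to $(\mathscr F_t)$. A process $Z$ has jump rates $r$ and starts from $x_0$ if it is obtained as follows from a right-continuous nearest-neighbour jump process $W$ with $W_0=x_0$ that leaves $V$ only by explosion: $Z$ is $W$ sent to the cemetery at time $\sup\{t:\ t<T(W_{[0,t]})\}$, and for every $t\ge 0$ and a.e. path $W_{[0,t]}$ with $W$ alive at $t$ and $t<T(W_{[0,t]})$ the following holds. Let $x=W_t$ and let $\eta$ be the path $W_{[0,t]}$ continued by staying at $x$. Then for every $y\sim x$, conditionally on $W_{[0,t]}$ and on $W$ staying at $x$ during $[t,u]$, the probability that the first jump of $W$ after time $u$ occurs in $(u,u+h]$ and is to $y$ equals $r_u(x,y,\eta)\,h+o(h)$ as $h\downarrow 0$, where $o(h)$ may depend on the path $W_{[0,t]}$ and is uniform for $u$ in each compact interval $[t,b]\subset[t,T(\eta))$. **Theorem.** Let $T$ be an LSC stopping time, $r$ a family of $T$-terminated jump rates and $x_0\in V$. 1. There exists a process with jump rates $r$ starting from $x_0$. 2.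 If $T$ is regular, all such processes $Z$ have the same law on $(\Omega,\mathscr B)$. It is given by the following formula: for $l\ge 0$, $x_0\sim x_1\sim\cdots\sim x_l$, Borel sets $D_1,\dots,D_l\subset[0,\infty)$ and $0<t<\infty$, the probability that $Z$ is alive at time $t$ and that $Z_{[0,t]}$ visits exactly the states $x_0,x_1,\dots,x_l$ in this order, with jump times $0<s_1<\cdots<s_l\le t$ such that $s_i\in D_i$ for all $i$, equals $$\int_{D_1\times\cdots\times D_l}1_{\{0<s_1<\cdots<s_l<t<T(\sigma)\}}\ \prod_{j=1}^l r_{s_j}(x_{j-1},x_j,\sigma^{(j-1)})\ \exp\Big(-\int_0^t\sum_{y\sim\sigma_v}r_v(\sigma_v,y,\sigma)\,dv\Big)\,ds_1\cdots ds_l ,$$ where $\sigma^{(k)}$ is the path started at $x_0$ that jumps to $x_1,\dots,x_k$ at the times $s_1<\dots<s_k$ and then stays at $x_k$ forever, and $\sigma=\sigma^{(l)}$. -/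

import Mathlib

open MeasureTheory Filter Topology Set
open scoped NNReal ENNReal

noncomputable section

namespace JumpRates

variable {V : Type*}

/-! ### Sample paths -/

/-- `Ω_∞`: right-continuous nearest-neighbour jump paths `[0,∞) → V` that do not explode. Since `V`
is discrete, having left limits at all finite times amounts to having finitely many jumps in every
compact time interval. -/
structure InfPath (G : SimpleGraph V) where
  toFun : ℝ≥0 → V
  right_cont : ∀ t, ∀ᶠ s in 𝓝[>] t, toFun s = toFun t
  left_lim : ∀ t, ∃ x, (x = toFun t ∨ G.Adj x (toFun t)) ∧ ∀ᶠ s in 𝓝[<] t, toFun s = x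

/-- `Ω`: right-continuous minimal nearest-neighbour jump paths with a finite or infinite lifetime.
The value `none` is the cemetery, where the path stays from its lifetime on. On every compact
interval strictly before the lifetime there are finitely many jumps; at a finite lifetime the path
has either exploded or been killed. -/
structure Path (G : SimpleGraph V) where
  toFun : ℝ≥0 → Option V
  absorb : ∀ s t, s ≤ t → toFun s = none → toFun t = none
  right_cont : ∀ t, ∀ᶠ s in 𝓝[>] t, toFun s = toFun t
  left_lim : ∀ t y, toFun t = some y →
    ∃ x, (x = y ∨ G.Adj x y) ∧ ∀ᶠ s in 𝓝[<] t, toFun s = some x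

variable {G : SimpleGraph V}

instance : CoeFun (InfPath G) (fun _ => ℝ≥0 → V) := ⟨InfPath.toFun⟩

instance : CoeFun (Path G) (fun _ => ℝ≥0 → Option V) := ⟨Path.toFun⟩

/-- The natural filtration of the coordinate process on `Ω_∞` (all subsets of the countable
discrete set `V` are measurable). -/
@[reducible]
def InfPath.filt (G : SimpleGraph V) (t : ℝ≥0) : MeasurableSpace (InfPath G) :=
  ⨆ s : {s : ℝ≥0 // s ≤ t}, MeasurableSpace.comap (fun ω : InfPath G => ω s.1) ⊤

/-- The natural filtration of the coordinate process on `Ω`. -/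
@[reducible]
def Path.filt (G : SimpleGraph V) (t : ℝ≥0) : MeasurableSpace (Path G) :=
  ⨆ s : {s : ℝ≥0 // s ≤ t}, MeasurableSpace.comap (fun ω : Path G => ω s.1) ⊤

/-- The `σ`-field `𝓑` on `Ω` generated by the coordinate maps. -/
instance : MeasurableSpace (Path G) :=
  ⨆ s : ℝ≥0, MeasurableSpace.comap (fun ω : Path G => ω s) ⊤

/-- Basic Skorokhod neighbourhoods: the paths that agree with `ω` on `[0,N]` after a time change
moving the points of `[0,N]` by less than `ε`. As `V` is discrete, uniform closeness of the values
is equality of the values. -/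
def skorokhodNhd (ω : InfPath G) (N : ℝ≥0) (ε : ℝ) : Set (InfPath G) :=
  {η | ∃ l : ℝ≥0 ≃o ℝ≥0, ∀ s ≤ N, dist (l s) s < ε ∧ η (l s) = ω s}

theorem skorokhodNhd_mono (ω : InfPath G) {N N' : ℝ≥0} {ε ε' : ℝ} (hN : N ≤ N') (hε : ε' ≤ ε) :
    skorokhodNhd ω N' ε' ⊆ skorokhodNhd ω N ε := by
  rintro η ⟨l, hl⟩
  exact ⟨l, fun s hs => ⟨(hl s (hs.trans hN)).1.trans_le hε, (hl s (hs.trans hN)).2⟩⟩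

/-- The Skorokhod (J1) topology on `Ω_∞`. -/
instance : TopologicalSpace (InfPath G) where
  IsOpen U := ∀ ω ∈ U, ∃ N : ℝ≥0, ∃ ε : ℝ, 0 < ε ∧ skorokhodNhd ω N ε ⊆ U
  isOpen_univ := fun _ _ => ⟨0, 1, one_pos, subset_univ _⟩
  isOpen_inter := by
    rintro U U' hU hU' ω ⟨h, h'⟩
    obtain ⟨N, ε, hε, hs⟩ := hU ω h
    obtain ⟨N', ε', hε', hs'⟩ := hU' ω h'
    exact ⟨max N N', min ε ε', lt_min hε hε', subset_inter
      ((skorokhodNhd_mono ω (le_max_left _ _) (min_le_left _ _)).trans hs)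
      ((skorokhodNhd_mono ω (le_max_right _ _) (min_le_right _ _)).trans hs')⟩
  isOpen_sUnion := by
    rintro S hS ω ⟨U, hU, hω⟩
    obtain ⟨N, ε, hε, hs⟩ := hS U hU ω hω
    exact ⟨N, ε, hε, hs.trans (subset_sUnion_of_mem hU)⟩

/-! ### Stopping times and jump rates -/

/-- Lower semi-continuous stopping times. -/
structure IsLSCStoppingTime (T : InfPath G → ℝ≥0∞) : Prop where
  stopping : ∀ t : ℝ≥0, MeasurableSet[InfPath.filt G t] {ω | T ω ≤ t}
  lsc : LowerSemicontinuous T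

/-- Regularity of `T`: here `η` is the path that follows `ω` on `[0,t]`, stays at `ω_t` until its
jump at time `t + s` to `y`, and then stays at `y` forever. -/
def IsRegular (T : InfPath G → ℝ≥0∞) : Prop :=
  ∀ (ω : InfPath G) (t : ℝ≥0), (t : ℝ≥0∞) < T ω → ∃ l : ℝ≥0, 0 < l ∧
    ∀ s : ℝ≥0, 0 < s → s ≤ l → ∀ y, G.Adj (ω t) y → ∀ η : InfPath G,
      (∀ v, v < t + s → η v = ω (min v t)) → (∀ v, t + s ≤ v → η v = y) →
        ((t + l : ℝ≥0) : ℝ≥0∞) ≤ T η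

open Classical in
/-- `T`-terminated jump rates. Only the values of `r` at the points `(t, x, y, ω)` of the domain
`t < T ω`, `x ∼ y`, `ω_t = x` matter. Since `V` is discrete, continuity on that domain for the
product topology is continuity in `(t, ω)` for each fixed `x ∼ y`. -/
structure IsTerminatedRates (T : InfPath G → ℝ≥0∞)
    (r : ℝ≥0 → V → V → InfPath G → ℝ≥0) : Prop where
  cont : ∀ x y, G.Adj x y → ContinuousOn (fun p : ℝ≥0 × InfPath G => r p.1 x y p.2)
    {p | (p.1 : ℝ≥0∞) < T p.2 ∧ p.2 p.1 = x}
  adapted : ∀ x y, G.Adj x y → ∀ t : ℝ≥0, Measurable[InfPath.filt G t]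
    (fun ω : InfPath G => if (t : ℝ≥0∞) < T ω ∧ ω t = x then r t x y ω else 0)

/-! ### Killing and lifetimes -/

/-- `η` is the path `ω_{[0,t]}` continued by staying at `ω_t` forever (so `ω` is alive at `t`). -/
def IsFrozen (ω : Path G) (t : ℝ≥0) (η : InfPath G) : Prop := ∀ s, ω (min s t) = some (η s)

/-- `sup {t : t < T(ω_{[0,t]})}`. -/
def deathTime (T : InfPath G → ℝ≥0∞) (ω : Path G) : ℝ≥0∞ :=
  ⨆ t ∈ {t : ℝ≥0 | ∃ η : InfPath G, IsFrozen ω t η ∧ (t : ℝ≥0∞) < T η}, (t : ℝ≥0∞)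

open Classical in
/-- The path `ω` sent to the cemetery at time `τ` (if it is not already there). -/
def Path.kill (ω : Path G) (τ : ℝ≥0∞) : Path G where
  toFun t := if (t : ℝ≥0∞) < τ then ω t else none
  absorb := by
    intro s t hst h
    split_ifs at h ⊢ with h1 h2
    · exact ω.absorb s t hst h
    · exact absurd (lt_of_le_of_lt (by exact_mod_cast hst) ‹(t : ℝ≥0∞) < τ›) ‹¬ (s : ℝ≥0∞) < τ›
    · rfl
    · rfl
  right_cont := by
    intro t
    by_cases h : (t : ℝ≥0∞) < τ
    · have h1 : ∀ᶠ s : ℝ≥0 in 𝓝[>] t, (s : ℝ≥0∞) < τ :=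
        (ENNReal.continuous_coe.tendsto t |>.mono_left nhdsWithin_le_nhds).eventually_lt_const h
      filter_upwards [h1, ω.right_cont t] with s hs hs'
      simp [h, hs, hs']
    · filter_upwards [self_mem_nhdsWithin] with s hs
      have h2 : ¬ (s : ℝ≥0∞) < τ := fun h3 =>
        h (lt_trans (by exact_mod_cast hs) h3)
      simp [h, h2]
  left_lim := by
    intro t y h
    split_ifs at h with h1
    obtain ⟨x, hx, hl⟩ := ω.left_lim t y h
    refine ⟨x, hx, ?_⟩
    filter_upwards [hl, self_mem_nhdsWithin] with s hs hs'
    have h2 : (s : ℝ≥0∞) < τ := lt_trans (by exact_mod_cast hs') h1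
    simp [h2, hs]

/-- `ω` can reach the cemetery only by explosion: it never dies while having a left limit in `V`,
and it is not dead at time `0`. -/
def DiesOnlyByExplosion (ω : Path G) : Prop :=
  ∀ t, ω t = none → ∀ x, ¬ ∀ᶠ s in 𝓝[<] t, ω s = some x

/-! ### Processes with jump rates -/

/-- `κ` is a regular version of the conditional law, under `Q`, given the path up to time `t`. -/
structure IsCondLaw (t : ℝ≥0) (Q : Measure (Path G)) (κ : Path G → Measure (Path G)) : Prop where
  prob : ∀ ω, IsProbabilityMeasure (κ ω)
  meas : ∀ A : Set (Path G), MeasurableSet A → Measurable[Path.filt G t] (fun ω => κ ω A)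
  disint : ∀ A B : Set (Path G), MeasurableSet A → MeasurableSet[Path.filt G t] B →
    Q (B ∩ A) = ∫⁻ ω in B, κ ω A ∂Q

/-- The path is at `x` during all of `[t,u]`. -/
def stays (G : SimpleGraph V) (x : V) (t u : ℝ≥0) : Set (Path G) :=
  {ω | ∀ v, t ≤ v → v ≤ u → ω v = some x}

/-- The path is at `x` from time `t` until its first jump after `t`, which happens in `(u, u + h]`
and is a jump to `y`. -/
def firstJump (G : SimpleGraph V) (x y : V) (t u h : ℝ≥0) : Set (Path G) :=
  {ω | ∃ τ, u < τ ∧ τ ≤ u + h ∧ (∀ v, t ≤ v → v < τ → ω v = some x) ∧ ω τ = some y}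

/-- Evolution with jump rates `r` as long as `T` has not occurred: for every `t`, conditionally on
the path up to time `t` and on being alive at `t`, say at `x`, and on there being no jump in
`(t,u]`, the first jump after `u` occurs before `u + h` and leads to `y` with probability
`r_u(x,y) h + o(h)`. Here `η` is the conditioning path frozen at `x` from time `t` on, and `o(h)`,
which may depend on this path, is uniform for `u` in compact subintervals `[t,b]` of `[t, T(η))`. -/
def EvolvesWithRates (T : InfPath G → ℝ≥0∞) (r : ℝ≥0 → V → V → InfPath G → ℝ≥0)
    (Q : Measure (Path G)) : Prop :=
  ∀ t : ℝ≥0, ∃ κ : Path G → Measure (Path G), IsCondLaw t Q κ ∧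
    ∀ᵐ ω ∂Q, ∀ η : InfPath G, IsFrozen ω t η → (t : ℝ≥0∞) < T η →
      ∀ y, G.Adj (η t) y → ∀ b : ℝ≥0, t ≤ b → (b : ℝ≥0∞) < T η →
        ∀ ε : ℝ, 0 < ε → ∃ δ : ℝ≥0, 0 < δ ∧ ∀ u h : ℝ≥0, t ≤ u → u ≤ b → 0 < h → h < δ →
          |(κ ω).real (firstJump G (η t) y t u h)
              - (κ ω).real (stays G (η t) t u) * (r u (η t) y η * h)|
            ≤ (κ ω).real (stays G (η t) t u) * (ε * h)

/-- `P` is the law on `Ω` of a process with jump rates `r` started from `x₀`: a process that starts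
at `x₀`, evolves with rates `r`, dies by itself only by explosion, and is finally stopped (sent to
the cemetery) at `sup {t : t < T(Z_{[0,t]})}`. -/
def HasJumpRates (T : InfPath G → ℝ≥0∞) (r : ℝ≥0 → V → V → InfPath G → ℝ≥0) (x₀ : V)
    (P : Measure (Path G)) : Prop :=
  ∃ Q : Measure (Path G), IsProbabilityMeasure Q ∧ (∀ᵐ ω ∂Q, ω 0 = some x₀) ∧
    (∀ᵐ ω ∂Q, DiesOnlyByExplosion ω) ∧ EvolvesWithRates T r Q ∧
    AEMeasurable (fun ω : Path G => ω.kill (deathTime T ω)) Q ∧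
    P = Q.map (fun ω : Path G => ω.kill (deathTime T ω))

/-! ### Path probabilities -/

theorem stepCount_lt {l : ℕ} (s : Fin l → ℝ≥0) (k : ℕ) (v : ℝ≥0) :
    (Finset.univ.filter (fun i : Fin l => i.1 < k ∧ s i ≤ v)).card < l + 1 :=
  Nat.lt_succ_of_le ((Finset.card_le_univ _).trans_eq (Fintype.card_fin l))

/-- The step function with jump times `s_1 < ⋯ < s_l` and successive states `x_0, …, x_l`, of which
only the first `k` jumps are carried out. -/
def stepFun {l : ℕ} (x : Fin (l + 1) → V) (s : Fin l → ℝ≥0) (k : ℕ) (v : ℝ≥0) : V :=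
  x ⟨(Finset.univ.filter (fun i : Fin l => i.1 < k ∧ s i ≤ v)).card, stepCount_lt s k v⟩

/-- `σ(x_0 → x_1 → ⋯ → x_k → ∞)` with jump times `s_1 < ⋯ < s_k`; all `l` jumps if `k = l`. -/
def stepPath {l : ℕ} (x : Fin (l + 1) → V) (hx : ∀ i : Fin l, G.Adj (x i.castSucc) (x i.succ))
    (s : Fin l → ℝ≥0) (hs : StrictMono s) (k : ℕ) : InfPath G where
  toFun := stepFun x s k
  right_cont := by
    intro t
    have h : ∀ i : Fin l, ∀ᶠ v in 𝓝[>] t, (s i ≤ v ↔ s i ≤ t) := by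
      intro i
      by_cases hi : s i ≤ t
      · filter_upwards [self_mem_nhdsWithin] with v hv
        exact ⟨fun _ => hi, fun _ => hi.trans (le_of_lt hv)⟩
      · filter_upwards [nhdsWithin_le_nhds (Iio_mem_nhds (not_le.mp hi))] with v hv
        exact ⟨fun h' => absurd hv (not_lt.mpr h'), fun h' => absurd h' hi⟩
    filter_upwards [eventually_all.mpr h] with v hv
    simp only [stepFun, hv]
  left_lim := by
    intro t
    have h : ∀ i : Fin l, ∀ᶠ v in 𝓝[<] t, (s i ≤ v ↔ s i < t) := by
      intro i
      by_cases hi : s i < t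
      · filter_upwards [nhdsWithin_le_nhds (Ioi_mem_nhds hi)] with v hv
        exact ⟨fun _ => hi, fun _ => le_of_lt hv⟩
      · filter_upwards [self_mem_nhdsWithin] with v hv
        exact ⟨fun h' => lt_of_le_of_lt h' hv, fun h' => absurd h' hi⟩
    have hlt : (Finset.univ.filter (fun i : Fin l => i.1 < k ∧ s i < t)).card < l + 1 :=
      Nat.lt_succ_of_le ((Finset.card_le_univ _).trans_eq (Fintype.card_fin l))
    refine ⟨x ⟨_, hlt⟩, ?_, ?_⟩
    · by_cases hex : ∃ j : Fin l, j.1 < k ∧ s j = t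
      · right
        obtain ⟨j, hjk, hj⟩ := hex
        have e1 : (Finset.univ.filter (fun i : Fin l => i.1 < k ∧ s i < t)) = Finset.Iio j := by
          ext i
          simp only [Finset.mem_filter, Finset.mem_univ, true_and, Finset.mem_Iio, ← hj,
            hs.lt_iff_lt]
          exact ⟨fun h => h.2, fun h => ⟨lt_trans h hjk, h⟩⟩
        have e2 : (Finset.univ.filter (fun i : Fin l => i.1 < k ∧ s i ≤ t)) = Finset.Iic j := by
          ext i
          simp only [Finset.mem_filter, Finset.mem_univ, true_and, Finset.mem_Iic, ← hj,
            hs.le_iff_le]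
          exact ⟨fun h => h.2, fun h => ⟨lt_of_le_of_lt h hjk, h⟩⟩
        have := hx j
        simp only [stepFun, e1, e2, Fin.card_Iio, Fin.card_Iic]
        exact this
      · left
        have e : (Finset.univ.filter (fun i : Fin l => i.1 < k ∧ s i < t))
            = (Finset.univ.filter (fun i : Fin l => i.1 < k ∧ s i ≤ t)) := by
          ext i
          simp only [Finset.mem_filter, Finset.mem_univ, true_and]
          exact ⟨fun h => ⟨h.1, h.2.le⟩, fun h =>
            ⟨h.1, lt_of_le_of_ne h.2 fun h' => hex ⟨i, h.1, h'⟩⟩⟩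
        simp only [stepFun, e]
    · filter_upwards [eventually_all.mpr h] with v hv
      simp only [stepFun, hv]

/-- The paths that on `[0,t]` visit exactly the states `x_0, …, x_l`, jumping at times
`0 < s_1 < ⋯ < s_l ≤ t` with `s_i ∈ D_i` (and are alive at `t`). -/
def pathEvent {l : ℕ} (x : Fin (l + 1) → V) (hx : ∀ i : Fin l, G.Adj (x i.castSucc) (x i.succ))
    (D : Fin l → Set ℝ≥0) (t : ℝ≥0) : Set (Path G) :=
  {ω | ∃ (s : Fin l → ℝ≥0) (hs : StrictMono s), (∀ i, 0 < s i ∧ s i ≤ t ∧ s i ∈ D i) ∧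
    ∀ v ≤ t, ω v = some (stepPath x hx s hs l v)}

open Classical in
/-- The density of the jump times. With `σ` the full step path, it is
`1_{s_1 < ⋯ < s_l < t < T(σ)} ∏_j r_{s_j}(x_{j-1}, x_j) exp(-∫_0^t ∑_{y ∼ σ_v} r_v(σ_v, y, σ) dv)`,
where the rate of the `j`-th jump is evaluated at the path that has made only the first `j - 1`
jumps. -/
def pathDensity [G.LocallyFinite] (T : InfPath G → ℝ≥0∞) (r : ℝ≥0 → V → V → InfPath G → ℝ≥0)
    {l : ℕ} (x : Fin (l + 1) → V) (hx : ∀ i : Fin l, G.Adj (x i.castSucc) (x i.succ))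
    (t : ℝ≥0) (s : Fin l → ℝ≥0) : ℝ :=
  if hs : StrictMono s then
    if (∀ i, 0 < s i ∧ s i < t) ∧ (t : ℝ≥0∞) < T (stepPath x hx s hs l) then
      (∏ j : Fin l, (r (s j) (x j.castSucc) (x j.succ) (stepPath x hx s hs j.1) : ℝ)) *
        Real.exp (-∫ v in (0 : ℝ)..t,
          ∑ y ∈ G.neighborFinset (stepPath x hx s hs l v.toNNReal),
            (r v.toNNReal (stepPath x hx s hs l v.toNNReal) y (stepPath x hx s hs l) : ℝ))
    else 0
  else 0

end JumpRates

end

/-! A process with jump rates is a chain of holding times and jumps, and everything rests on the law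
of one such step. Fix a deterministic time `g` and condition on the path up to `g`, frozen from then
on as `η`. Let `S u` be the conditional probability of no jump in `(g,u]` and `J y u` that of a
first jump to `y` by time `u`. The uniform `o(h)` says that `J y` has right derivative `S` times the
rate to `y`. Since the path cannot be killed by itself, `S = 1 - ∑ J y`, so `S` solves a linear
equation. Hence `S` is the exponential of minus the accumulated rate, and `J y` is the integral of
`S` times the rate (`survival_of_increments`). Conversely this law returns the uniform expansion, by
uniform continuity of the rates on compact intervals before `T η` (`increments_of_law`). The
defining property is thus exchanged for the integrated one, `HasOneStepLaw`.

For the path formula the one-step law has to hold at the random jump times. Between two jumps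
neither the frozen path nor the next jump changes, so a jump time can be replaced by a slightly
later grid time with countably many values; continuity of the law in its initial time then removes
the grid (`measure_inter_eq_of_grid`). This yields the joint law of the history at one jump and the
time of the next (`HasOneStepLaw.lintegral_next`), and by induction the law of the history at the
`l`-th jump as an iterated integral. Lower semicontinuity of `T` enters here: delaying a jump
slightly gives a Skorokhod-close path that has not yet jumped at the original time, so a path
terminated before a jump cannot be revived by it (`IsLSCStoppingTime.lt_of_lt_append`). Jumps after
the terminal time of the old path may therefore be discarded. Adding the probability of no further
jump up to `t` and flattening the iterated integral by Fubini gives the formula. The events in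
question are stable under intersection and generate the σ-field, so the formula determines the law.

For existence, the time and target of each jump are sampled from the previous history by a kernel
with density `jumpDensity`, driven by independent uniform variables. The exponential is
multiplicative in time, so restarting at a deterministic `g` between two jumps gives the same law as
starting at the last jump (`hasOneStepLaw_randomPath`). -/

noncomputable section

namespace JumpRates

section


/-! ### Grid approximation of times from above -/

/-- The smallest multiple of `1/(n+1)` strictly above `t`. -/
def gridAbove (n : ℕ) (t : ℝ≥0) : ℝ≥0 := ((⌊t * (n + 1)⌋₊ : ℝ≥0) + 1) / (n + 1)

theorem lt_gridAbove (n : ℕ) (t : ℝ≥0) : t < gridAbove n t := by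
  rw [gridAbove, lt_div_iff₀ (by positivity)]
  exact Nat.lt_floor_add_one _

theorem gridAbove_le (n : ℕ) (t : ℝ≥0) : gridAbove n t ≤ t + 1 / (n + 1) := by
  have h : (0 : ℝ≥0) < n + 1 := by positivity
  rw [gridAbove, add_div]
  gcongr
  rw [div_le_iff₀ h]
  exact Nat.floor_le (by positivity)

theorem tendsto_gridAbove (t : ℝ≥0) : Tendsto (fun n => gridAbove n t) atTop (𝓝[>] t) := by
  refine tendsto_nhdsWithin_iff.mpr ⟨?_, Eventually.of_forall fun n => lt_gridAbove n t⟩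
  refine tendsto_of_tendsto_of_tendsto_of_le_of_le tendsto_const_nhds (h := fun n : ℕ => t + 1 / (n + 1))
    ?_ (fun n => (lt_gridAbove n t).le) (fun n => gridAbove_le n t)
  have := (tendsto_one_div_add_atTop_nhds_zero_nat (𝕜 := ℝ≥0)).const_add t
  simpa using this

theorem measurable_gridAbove (n : ℕ) : Measurable (gridAbove n) := by
  unfold gridAbove
  have h : Measurable fun t : ℝ≥0 => (⌊t * (n + 1)⌋₊ : ℝ≥0) :=
    (measurable_from_nat (f := fun k : ℕ => (k : ℝ≥0))).comp
      (Nat.measurable_floor.comp (measurable_id.mul_const _))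
  exact (h.add_const _).div_const _

theorem countable_range_gridAbove (n : ℕ) : (range (gridAbove n)).Countable := by
  refine (countable_range fun k : ℕ => ((k : ℝ≥0) + 1) / (n + 1)).mono ?_
  rintro _ ⟨t, rfl⟩
  exact ⟨_, rfl⟩

/-- The grid time is a function of a natural number, so the map factors through `ℕ × Ω`, where
measurability of each section suffices. -/
theorem measurable_comp_gridAbove {Ω E : Type*} [MeasurableSpace Ω] [MeasurableSpace E]
    {f : ℝ≥0 → Ω → E} (hf : ∀ t, Measurable (f t)) (n : ℕ) :
    Measurable fun p : ℝ≥0 × Ω => f (gridAbove n p.1) p.2 := by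
  have h1 : Measurable fun p : ℕ × Ω => f (((p.1 : ℝ≥0) + 1) / (n + 1)) p.2 :=
    measurable_from_prod_countable_right fun k => by
      simpa using hf _
  have h2 : Measurable fun p : ℝ≥0 × Ω => (⌊p.1 * (n + 1)⌋₊, p.2) :=
    (Nat.measurable_floor.comp (measurable_fst.mul_const _)).prodMk measurable_snd
  simpa only [gridAbove, Function.comp_def] using h1.comp h2

/-- No topology on `E` is needed: along the grid the values are eventually equal to the limit value,
so preimages are lower limits of sets. -/
theorem measurable_of_eventually_right_eq {Ω E : Type*} [MeasurableSpace Ω] [MeasurableSpace E]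
    {f : ℝ≥0 → Ω → E} (hf : ∀ t, Measurable (f t))
    (hr : ∀ t ω, ∀ᶠ s in 𝓝[>] t, f s ω = f t ω) :
    Measurable fun p : ℝ≥0 × Ω => f p.1 p.2 := by
  intro B hB
  have key : (fun p : ℝ≥0 × Ω => f p.1 p.2) ⁻¹' B =
      ⋃ N : ℕ, ⋂ n : ℕ, ⋂ _ : N ≤ n, (fun p : ℝ≥0 × Ω => f (gridAbove n p.1) p.2) ⁻¹' B := by
    ext ⟨t, ω⟩
    obtain ⟨N, hN⟩ := eventually_atTop.mp ((tendsto_gridAbove t).eventually (hr t ω))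
    simp only [mem_preimage, mem_iUnion, mem_iInter]
    constructor
    · intro h
      exact ⟨N, fun n hn => by rwa [hN n hn]⟩
    · rintro ⟨M, hM⟩
      rw [← hN (max N M) (le_max_left _ _)]
      exact hM _ (le_max_right _ _)
  rw [key]
  exact .iUnion fun N => .iInter fun n => .iInter fun _ => measurable_comp_gridAbove hf n hB

theorem measurable_of_right_continuous {Ω E : Type*} [MeasurableSpace Ω] [MeasurableSpace E]
    [TopologicalSpace E] [TopologicalSpace.PseudoMetrizableSpace E] [BorelSpace E]
    {f : ℝ≥0 → Ω → E} (hf : ∀ t, Measurable (f t))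
    (hr : ∀ t ω, Tendsto (fun s => f s ω) (𝓝[>] t) (𝓝 (f t ω))) :
    Measurable fun p : ℝ≥0 × Ω => f p.1 p.2 :=
  measurable_of_tendsto_metrizable (fun n => measurable_comp_gridAbove hf n)
    (tendsto_pi_nhds.mpr fun p => (hr p.1 p.2).comp (tendsto_gridAbove p.1))

/-! ### Measurable structure of the path spaces -/

variable {V : Type*} {G : SimpleGraph V}

/-- Turns conditions on a path at all times into countably many conditions, at the cost of treating
a right end point separately. -/
theorem exists_rat_eq_of_right {E : Type*} {f : ℝ≥0 → E} {u c : ℝ≥0}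
    (hr : ∀ᶠ s in 𝓝[>] u, f s = f u) (hu : u < c) :
    ∃ q : ℚ, u < Real.toNNReal q ∧ Real.toNNReal q < c ∧ f (Real.toNNReal q) = f u := by
  obtain ⟨w, hw, hw'⟩ := (mem_nhdsGT_iff_exists_Ioo_subset' hu).mp hr
  obtain ⟨q, -, hq1, hq2⟩ := (NNReal.lt_iff_exists_rat_btwn u (min w c)).mp (lt_min hw hu)
  exact ⟨q, hq1, hq2.trans_le (min_le_right _ _), hw' ⟨hq1, hq2.trans_le (min_le_left _ _)⟩⟩

@[ext]
theorem InfPath.ext {η η' : InfPath G} (h : ∀ t, η t = η' t) : η = η' := by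
  cases η; cases η'; congr; exact funext h

instance : MeasurableSpace (InfPath G) :=
  ⨆ s : ℝ≥0, MeasurableSpace.comap (fun ω : InfPath G => ω s) ⊤

theorem InfPath.filt_le (t : ℝ≥0) : InfPath.filt G t ≤ (inferInstance : MeasurableSpace (InfPath G)) :=
  iSup_le fun s => le_iSup (fun s : ℝ≥0 => MeasurableSpace.comap (fun ω : InfPath G => ω s) ⊤) s.1

theorem Path.filt_le (t : ℝ≥0) : Path.filt G t ≤ (inferInstance : MeasurableSpace (Path G)) :=
  iSup_le fun s => le_iSup (fun s : ℝ≥0 => MeasurableSpace.comap (fun ω : Path G => ω s) ⊤) s.1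

theorem measurable_to_infPath {Ω : Type*} {m : MeasurableSpace Ω} {f : Ω → InfPath G}
    (hf : ∀ s, ∀ A : Set V, MeasurableSet {w | f w s ∈ A}) : Measurable f := by
  refine Measurable.of_le_map (iSup_le fun s => ?_)
  rintro _ ⟨A, -, rfl⟩
  exact hf s A

theorem measurable_to_path {Ω : Type*} {m : MeasurableSpace Ω} {f : Ω → Path G}
    (hf : ∀ s, ∀ A : Set (Option V), MeasurableSet {w | f w s ∈ A}) : Measurable f := by
  refine Measurable.of_le_map (iSup_le fun s => ?_)
  rintro _ ⟨A, -, rfl⟩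
  exact hf s A

theorem InfPath.measurableSet_filt_eval {s t : ℝ≥0} (h : s ≤ t) (A : Set V) :
    MeasurableSet[InfPath.filt G t] {ω : InfPath G | ω s ∈ A} :=
  le_iSup (fun s : {s : ℝ≥0 // s ≤ t} => MeasurableSpace.comap (fun ω : InfPath G => ω s.1) ⊤)
    ⟨s, h⟩ _ ⟨A, trivial, rfl⟩

theorem Path.measurableSet_filt_eval {s t : ℝ≥0} (h : s ≤ t) (A : Set (Option V)) :
    MeasurableSet[Path.filt G t] {ω : Path G | ω s ∈ A} :=
  le_iSup (fun s : {s : ℝ≥0 // s ≤ t} => MeasurableSpace.comap (fun ω : Path G => ω s.1) ⊤)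
    ⟨s, h⟩ _ ⟨A, trivial, rfl⟩

theorem InfPath.measurable_eval [MeasurableSpace V] (s : ℝ≥0) :
    Measurable fun ω : InfPath G => ω s := fun A _ =>
  InfPath.filt_le s _ (InfPath.measurableSet_filt_eval le_rfl A)

instance {α : Type*} : MeasurableSpace (Option α) := ⊤

instance {α : Type*} : DiscreteMeasurableSpace (Option α) := ⟨fun _ => trivial⟩

theorem Path.measurable_eval (s : ℝ≥0) : Measurable fun ω : Path G => ω s := fun A _ =>
  Path.filt_le s _ (Path.measurableSet_filt_eval le_rfl A)

theorem InfPath.measurable_eval_prod [MeasurableSpace V] :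
    Measurable fun p : ℝ≥0 × InfPath G => p.2 p.1 :=
  measurable_of_eventually_right_eq (f := fun t (ω : InfPath G) => ω t)
    InfPath.measurable_eval fun t ω => ω.right_cont t

theorem Path.measurable_eval_prod : Measurable fun p : ℝ≥0 × Path G => p.2 p.1 :=
  measurable_of_eventually_right_eq (f := fun t (ω : Path G) => ω t)
    Path.measurable_eval fun t ω => ω.right_cont t

/-- The full power set on the right is much too large, but it is enough to see that every event of
`ℱ_t` is a preimage under restriction of the path to `[0,t]`. -/
theorem InfPath.filt_le_comap (t : ℝ≥0) : InfPath.filt G t ≤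
    MeasurableSpace.comap (fun (ω : InfPath G) (s : {s : ℝ≥0 // s ≤ t}) => ω s.1) ⊤ := by
  refine iSup_le fun s => ?_
  rintro _ ⟨A, -, rfl⟩
  exact ⟨{f | f s ∈ A}, trivial, rfl⟩

theorem Path.filt_le_comap (t : ℝ≥0) : Path.filt G t ≤
    MeasurableSpace.comap (fun (ω : Path G) (s : {s : ℝ≥0 // s ≤ t}) => ω s.1) ⊤ := by
  refine iSup_le fun s => ?_
  rintro _ ⟨A, -, rfl⟩
  exact ⟨{f | f s ∈ A}, trivial, rfl⟩

/-- Membership in an event of `ℱ_t` depends only on the path up to time `t`. -/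
theorem InfPath.mem_iff_of_filt {t : ℝ≥0} {A : Set (InfPath G)}
    (hA : MeasurableSet[InfPath.filt G t] A) {η η' : InfPath G} (h : ∀ s ≤ t, η s = η' s) :
    η ∈ A ↔ η' ∈ A := by
  obtain ⟨B, -, rfl⟩ := InfPath.filt_le_comap t _ hA
  have : (fun s : {s : ℝ≥0 // s ≤ t} => η s.1) = fun s : {s : ℝ≥0 // s ≤ t} => η' s.1 :=
    funext fun s => h s.1 s.2
  simp only [mem_preimage, this]

theorem Path.mem_iff_of_filt {t : ℝ≥0} {A : Set (Path G)}
    (hA : MeasurableSet[Path.filt G t] A) {η η' : Path G} (h : ∀ s ≤ t, η s = η' s) :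
    η ∈ A ↔ η' ∈ A := by
  obtain ⟨B, -, rfl⟩ := Path.filt_le_comap t _ hA
  have : (fun s : {s : ℝ≥0 // s ≤ t} => η s.1) = fun s : {s : ℝ≥0 // s ≤ t} => η' s.1 :=
    funext fun s => h s.1 s.2
  simp only [mem_preimage, this]

/-! ### Freezing, embedding and appending a jump -/

theorem Path.alive_of_le {ω : Path G} {s t : ℝ≥0} (h : s ≤ t) (ht : ω t ≠ none) : ω s ≠ none :=
  fun hs => ht (ω.absorb s t h hs)

/-- The constant path. -/
def InfPath.const (G : SimpleGraph V) (x : V) : InfPath G where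
  toFun _ := x
  right_cont _ := Eventually.of_forall fun _ => rfl
  left_lim _ := ⟨x, Or.inl rfl, Eventually.of_forall fun _ => rfl⟩

/-- A non-exploding path as a path with infinite lifetime. -/
def InfPath.toPath (η : InfPath G) : Path G where
  toFun t := some (η t)
  absorb := by simp
  right_cont t := (η.right_cont t).mono fun s hs => by rw [hs]
  left_lim t y h := by
    obtain ⟨x, hx, hl⟩ := η.left_lim t
    obtain rfl : η t = y := Option.some_injective _ h
    exact ⟨x, hx, hl.mono fun s hs => by rw [hs]⟩

open Classical in
/-- The path that follows `ω` up to time `t` and stays at `ω_t` afterwards; a constant path if `ω`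
is dead at time `t`. -/
def Path.freeze (x₀ : V) (t : ℝ≥0) (ω : Path G) : InfPath G where
  toFun v := if ω t = none then x₀ else (ω (min v t)).getD x₀
  right_cont v := by
    by_cases h : ω t = none
    · simp [h]
    · simp only [h, if_false]
      rcases lt_or_ge v t with hv | hv
      · filter_upwards [ω.right_cont v, nhdsWithin_le_nhds (Iio_mem_nhds hv)] with s hs hs'
        rw [min_eq_left (le_of_lt hs'), min_eq_left hv.le, hs]
      · filter_upwards [self_mem_nhdsWithin] with s hs
        rw [min_eq_right hv, min_eq_right (hv.trans (le_of_lt hs))]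
  left_lim v := by
    by_cases h : ω t = none
    · exact ⟨x₀, by simp [h]⟩
    · simp only [h, if_false]
      rcases le_or_gt v t with hv | hv
      · obtain ⟨y, hy⟩ := Option.ne_none_iff_exists'.mp (Path.alive_of_le hv h)
        obtain ⟨x, hx, hl⟩ := ω.left_lim v y hy
        refine ⟨x, by simpa [hv, hy] using hx, ?_⟩
        filter_upwards [hl, self_mem_nhdsWithin] with s hs hs'
        rw [min_eq_left ((le_of_lt hs').trans hv), hs]
        rfl
      · refine ⟨(ω t).getD x₀, Or.inl (by rw [min_eq_right hv.le]), ?_⟩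
        filter_upwards [nhdsWithin_le_nhds (Ioi_mem_nhds hv)] with s hs
        rw [min_eq_right (le_of_lt hs)]

theorem Path.freeze_apply {x₀ : V} {t : ℝ≥0} {ω : Path G} (h : ω t ≠ none) (v : ℝ≥0) :
    some (ω.freeze x₀ t v) = ω (min v t) := by
  obtain ⟨y, hy⟩ := Option.ne_none_iff_exists'.mp (Path.alive_of_le (min_le_right v t) h)
  simp [Path.freeze, h, hy]

theorem Path.freeze_of_le {x₀ : V} {t : ℝ≥0} {ω : Path G} (h : ω t ≠ none) {v : ℝ≥0} (hv : v ≤ t) :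
    some (ω.freeze x₀ t v) = ω v := by
  rw [Path.freeze_apply h, min_eq_left hv]

theorem Path.freeze_of_ge {x₀ : V} {t : ℝ≥0} {ω : Path G} (h : ω t ≠ none) {v : ℝ≥0} (hv : t ≤ v) :
    some (ω.freeze x₀ t v) = ω t := by
  rw [Path.freeze_apply h, min_eq_right hv]

theorem Path.freeze_const (x₀ : V) (t : ℝ≥0) (ω : Path G) {v : ℝ≥0} (hv : t ≤ v) :
    ω.freeze x₀ t v = ω.freeze x₀ t t := by
  simp [Path.freeze, hv]

theorem Path.isFrozen_freeze {x₀ : V} {t : ℝ≥0} {ω : Path G} (h : ω t ≠ none) :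
    IsFrozen ω t (ω.freeze x₀ t) := fun s => (Path.freeze_apply h s).symm

theorem IsFrozen.alive {t : ℝ≥0} {ω : Path G} {η : InfPath G} (h : IsFrozen ω t η) :
    ω t ≠ none := by
  have := h t
  rw [min_self] at this
  simp [this]

/-- The quantifiers over frozen paths in `EvolvesWithRates` and `deathTime` thus range over a single
path. -/
theorem IsFrozen.eq_freeze {t : ℝ≥0} {ω : Path G} {η : InfPath G} (h : IsFrozen ω t η) (x₀ : V) :
    η = ω.freeze x₀ t := by
  ext s
  apply Option.some_injective
  rw [Path.freeze_apply h.alive, h s]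

theorem Path.measurableSet_filt_alive (t : ℝ≥0) :
    MeasurableSet[Path.filt G t] {ω : Path G | ω t ≠ none} :=
  Path.measurableSet_filt_eval le_rfl {none}ᶜ

theorem Path.measurable_freeze_filt (x₀ : V) (t : ℝ≥0) :
    Measurable[Path.filt G t] (fun ω : Path G => ω.freeze x₀ t) := by
  refine @measurable_to_infPath V G (Path G) (Path.filt G t) _ fun s A => ?_
  have : {ω : Path G | ω.freeze x₀ t s ∈ A} =
      ({ω | ω t ∈ ({none} : Set (Option V))} ∩ {ω | x₀ ∈ A}) ∪
      ({ω | ω t ∈ ({none}ᶜ : Set (Option V))} ∩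
        {ω | ω (min s t) ∈ {z : Option V | z.getD x₀ ∈ A}}) := by
    ext ω
    by_cases h : ω t = none <;> simp [Path.freeze, h]
  rw [this]
  refine MeasurableSet.union ?_ ?_
  · exact (Path.measurableSet_filt_eval le_rfl _).inter (MeasurableSet.const _)
  · exact (Path.measurableSet_filt_eval le_rfl _).inter
      (Path.measurableSet_filt_eval (min_le_right _ _) _)

theorem Path.measurable_freeze (x₀ : V) (t : ℝ≥0) :
    Measurable (fun ω : Path G => ω.freeze x₀ t) :=
  (Path.measurable_freeze_filt x₀ t).mono (Path.filt_le t) le_rfl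

theorem Path.measurable_freeze_prod (x₀ : V) :
    Measurable (fun p : ℝ≥0 × Path G => p.2.freeze x₀ p.1) := by
  refine measurable_to_infPath fun s A => ?_
  have h1 : Measurable fun p : ℝ≥0 × Path G => p.2 (min s p.1) :=
    Path.measurable_eval_prod.comp ((measurable_const.min measurable_fst).prodMk measurable_snd)
  have : {p : ℝ≥0 × Path G | p.2.freeze x₀ p.1 s ∈ A} =
      ((fun p : ℝ≥0 × Path G => p.2 p.1) ⁻¹' {none} ∩ {p | x₀ ∈ A}) ∪
      ((fun p : ℝ≥0 × Path G => p.2 p.1) ⁻¹' {none}ᶜ ∩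
        (fun p : ℝ≥0 × Path G => p.2 (min s p.1)) ⁻¹' {z : Option V | z.getD x₀ ∈ A}) := by
    ext ⟨t, ω⟩
    by_cases h : ω t = none <;> simp [Path.freeze, h]
  rw [this]
  exact ((Path.measurable_eval_prod (.of_discrete)).inter (MeasurableSet.const _)).union
    ((Path.measurable_eval_prod (.of_discrete)).inter (h1 .of_discrete))

theorem InfPath.measurable_toPath : Measurable (InfPath.toPath (G := G)) := by
  refine measurable_to_path fun s A => ?_
  exact InfPath.filt_le s _ (InfPath.measurableSet_filt_eval le_rfl (some ⁻¹' A))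

/-- A jump to `y` at time `v` can be appended to `η`, which stays put from time `a` on. -/
def CanAppend (η : InfPath G) (a v : ℝ≥0) (y : V) : Prop :=
  a < v ∧ (∀ u, a ≤ u → η u = η a) ∧ G.Adj (η a) y

open Classical in
/-- The path `η`, which stays put from time `a` on, with a jump to `y` at time `v > a` appended. -/
def InfPath.append (η : InfPath G) (a v : ℝ≥0) (y : V) : InfPath G where
  -- An illegal jump is ignored, which makes the operation total without hypotheses on the
  -- arguments.
  toFun u := if CanAppend η a v y ∧ v ≤ u then y else η u
  right_cont u := by
    by_cases h : CanAppend η a v y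
    · rcases lt_or_ge u v with hu | hu
      · filter_upwards [η.right_cont u, nhdsWithin_le_nhds (Iio_mem_nhds hu)] with s hs hs'
        rw [if_neg (fun h => absurd h.2 (not_le.mpr hs')), if_neg (fun h => absurd h.2 (not_le.mpr hu)), hs]
      · filter_upwards [self_mem_nhdsWithin] with s hs
        rw [if_pos ⟨h, hu.trans (le_of_lt hs)⟩, if_pos ⟨h, hu⟩]
    · simpa [h] using η.right_cont u
  left_lim u := by
    by_cases h : CanAppend η a v y
    · rcases lt_trichotomy u v with hu | rfl | hu
      · obtain ⟨x, hx, hl⟩ := η.left_lim u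
        refine ⟨x, by rwa [if_neg (fun h => absurd h.2 (not_le.mpr hu))], ?_⟩
        filter_upwards [hl, self_mem_nhdsWithin] with s hs hs'
        rw [if_neg (fun h => absurd h.2 (not_le.mpr (lt_trans hs' hu))), hs]
      · refine ⟨η a, Or.inr (by rw [if_pos ⟨h, le_rfl⟩]; exact h.2.2), ?_⟩
        filter_upwards [nhdsWithin_le_nhds (Ioi_mem_nhds h.1), self_mem_nhdsWithin] with s hs hs'
        rw [if_neg (fun h => absurd h.2 (not_le.mpr hs')), h.2.1 s (le_of_lt hs)]
      · refine ⟨y, Or.inl (by rw [if_pos ⟨h, hu.le⟩]), ?_⟩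
        filter_upwards [nhdsWithin_le_nhds (Ioi_mem_nhds hu)] with s hs
        rw [if_pos ⟨h, le_of_lt hs⟩]
    · simpa [h] using η.left_lim u

theorem InfPath.append_of_lt {η : InfPath G} {a v u : ℝ≥0} {y : V} (hu : u < v) :
    η.append a v y u = η u :=
  if_neg fun h => absurd h.2 (not_le.mpr hu)

theorem InfPath.append_of_ge {η : InfPath G} {a v u : ℝ≥0} {y : V} (h : CanAppend η a v y)
    (hu : v ≤ u) : η.append a v y u = y :=
  if_pos ⟨h, hu⟩

theorem measurableSet_canAppend [Countable V] (y : V) :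
    MeasurableSet {p : (ℝ≥0 × InfPath G) × ℝ≥0 | CanAppend p.1.2 p.1.1 p.2 y} := by
  let _ : MeasurableSpace V := ⊤
  have he : Measurable fun p : (ℝ≥0 × InfPath G) × ℝ≥0 => p.1.2 p.1.1 :=
    InfPath.measurable_eval_prod.comp measurable_fst
  have h1 : MeasurableSet {p : (ℝ≥0 × InfPath G) × ℝ≥0 | p.1.1 < p.2} :=
    measurableSet_lt (measurable_fst.comp measurable_fst) measurable_snd
  have h3 : MeasurableSet {p : (ℝ≥0 × InfPath G) × ℝ≥0 | G.Adj (p.1.2 p.1.1) y} :=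
    he (t := {x | G.Adj x y}) trivial
  -- By right continuity it is enough to test constancy at rational times.
  have h2 : {p : (ℝ≥0 × InfPath G) × ℝ≥0 | ∀ u, p.1.1 ≤ u → p.1.2 u = p.1.2 p.1.1} =
      ⋂ q : ℚ, {p | p.1.1 ≤ Real.toNNReal q → p.1.2 (Real.toNNReal q) = p.1.2 p.1.1} := by
    ext ⟨⟨a, η⟩, v⟩
    simp only [mem_ofPred_eq, mem_iInter]
    refine ⟨fun h q => h _, fun h u hu => ?_⟩
    obtain ⟨q, hq1, -, hq⟩ := exists_rat_eq_of_right (η.right_cont u) (lt_add_one u)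
    rw [← hq]
    exact h q (hu.trans hq1.le)
  have h2' : MeasurableSet {p : (ℝ≥0 × InfPath G) × ℝ≥0 | ∀ u, p.1.1 ≤ u → p.1.2 u = p.1.2 p.1.1} := by
    rw [h2]
    refine .iInter fun q => MeasurableSet.imp ?_ ?_
    · exact measurableSet_le (measurable_fst.comp measurable_fst) measurable_const
    · exact measurableSet_eq_fun
        ((InfPath.measurable_eval _).comp (measurable_snd.comp measurable_fst)) he
  exact h1.inter (h2'.inter h3)

end

section


variable {V : Type*} {G : SimpleGraph V}

/-! ### Jump times of a path -/

/-- The first time after `a` at which `ω` leaves `ω_a`. -/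
def Path.nextJump (ω : Path G) (a : ℝ≥0) : ℝ≥0∞ :=
  ⨅ (v : ℝ≥0) (_ : a < v ∧ ω v ≠ ω a), (v : ℝ≥0∞)

/-- The inequality is strict because a path that has not moved by time `c` stays put a little
longer, by right continuity. -/
theorem Path.lt_nextJump_iff {ω : Path G} {a c : ℝ≥0} :
    (c : ℝ≥0∞) < ω.nextJump a ↔ ∀ v, a ≤ v → v ≤ c → ω v = ω a := by
  constructor
  · intro h v hav hvc
    by_contra hne
    have hlt : a < v := lt_of_le_of_ne hav fun h => hne (by rw [h])
    have : ω.nextJump a ≤ v := iInf₂_le v ⟨hlt, hne⟩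
    exact absurd (this.trans (by exact_mod_cast hvc)) (not_le.mpr h)
  · intro h
    -- If `c < a` the hypothesis is void and the room to the right is taken at `a` instead.
    have hmax : ω (max a c) = ω a := by
      rcases le_total a c with hac | hac
      · rw [max_eq_right hac]; exact h c hac le_rfl
      · rw [max_eq_left hac]
    obtain ⟨w, hw, hw'⟩ := (mem_nhdsGT_iff_exists_Ioo_subset' (lt_add_one (max a c))).mp
      (ω.right_cont (max a c))
    refine lt_of_lt_of_le (b := (w : ℝ≥0∞)) (by exact_mod_cast (le_max_right a c).trans_lt hw) ?_
    refine le_iInf₂ fun v hv => ?_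
    by_contra hlt
    have hvw : v < w := by exact_mod_cast not_le.mp hlt
    apply hv.2
    rcases le_or_gt v (max a c) with hv' | hv'
    · rcases le_max_iff.mp hv' with h' | h'
      · exact absurd hv.1 (not_lt.mpr h')
      · exact h v hv.1.le h'
    · rw [← hmax]; exact hw' ⟨hv', hvw⟩

theorem Path.lt_nextJump (ω : Path G) (a : ℝ≥0) : (a : ℝ≥0∞) < ω.nextJump a :=
  Path.lt_nextJump_iff.mpr fun v h1 h2 => by rw [le_antisymm h2 h1]

theorem Path.eq_of_lt_nextJump {ω : Path G} {a v : ℝ≥0} (h : a ≤ v)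
    (hv : (v : ℝ≥0∞) < ω.nextJump a) : ω v = ω a :=
  Path.lt_nextJump_iff.mp hv v h le_rfl

/-- The infimum is attained: otherwise right continuity would prolong the constancy beyond `v`. The
new value may be the cemetery. -/
theorem Path.nextJump_eq_coe_iff {ω : Path G} {a v : ℝ≥0} :
    ω.nextJump a = v ↔ a < v ∧ (∀ u, a ≤ u → u < v → ω u = ω a) ∧ ω v ≠ ω a := by
  constructor
  · intro h
    have h1 : a < v := by
      have := ω.lt_nextJump a
      rw [h] at this
      exact_mod_cast this
    have h2 : ∀ u, a ≤ u → u < v → ω u = ω a := fun u hu huv =>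
      Path.eq_of_lt_nextJump hu (by rw [h]; exact_mod_cast huv)
    refine ⟨h1, h2, fun h3 => ?_⟩
    have : (v : ℝ≥0∞) < ω.nextJump a := Path.lt_nextJump_iff.mpr fun u hu huv => by
      rcases huv.lt_or_eq with h' | rfl
      · exact h2 u hu h'
      · exact h3
    exact absurd h this.ne'
  · rintro ⟨h1, h2, h3⟩
    refine le_antisymm (iInf₂_le v ⟨h1, h3⟩) (le_iInf₂ fun u hu => ?_)
    by_contra hlt
    exact hu.2 (h2 u hu.1.le (by exact_mod_cast not_le.mp hlt))

/-- Every time before the next jump sees the same next jump. This is what allows a jump time to be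
replaced by a later grid time. -/
theorem Path.nextJump_eq_of_lt {ω : Path G} {a g : ℝ≥0} (h : a ≤ g)
    (hg : (g : ℝ≥0∞) < ω.nextJump a) : ω.nextJump g = ω.nextJump a := by
  have he := Path.eq_of_lt_nextJump h hg
  refine le_antisymm (ENNReal.le_of_forall_nnreal_lt fun c hc => ?_)
    (ENNReal.le_of_forall_nnreal_lt fun c hc => ?_) <;>
    refine le_of_lt (Path.lt_nextJump_iff.mpr fun v hv hvc => ?_)
  · rcases le_total v g with hvg | hvg
    · exact Path.lt_nextJump_iff.mp hg v hv hvg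
    · rw [Path.lt_nextJump_iff.mp hc v hvg hvc, he]
  · rw [Path.lt_nextJump_iff.mp hc v (h.trans hv) hvc, he]

/-- A jump that has happened by time `g` is visible in the path up to `g`: the stopping time
property in pathwise form. -/
theorem Path.nextJump_congr {ω ω' : Path G} {g a : ℝ≥0} (h : ∀ v ≤ g, ω v = ω' v)
    (hg : ω.nextJump a ≤ g) : ω'.nextJump a = ω.nextJump a := by
  lift ω.nextJump a to ℝ≥0 using ne_top_of_le_ne_top ENNReal.coe_ne_top hg with v hv
  have hvg : v ≤ g := by exact_mod_cast hg
  obtain ⟨h1, h2, h3⟩ := Path.nextJump_eq_coe_iff.mp hv.symm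
  have ha := h a (h1.le.trans hvg)
  refine Path.nextJump_eq_coe_iff.mpr ⟨h1, fun u hu huv => ?_, ?_⟩
  · rw [← h u (huv.le.trans hvg), ← ha, h2 u hu huv]
  · rwa [← h v hvg, ← ha]

/-- The state after a jump is a neighbour of the state before it. -/
theorem Path.adj_of_nextJump {ω : Path G} {a v : ℝ≥0} (h : ω.nextJump a = v) {x y : V}
    (hx : ω a = some x) (hy : ω v = some y) : G.Adj x y := by
  obtain ⟨h1, h2, h3⟩ := Path.nextJump_eq_coe_iff.mp h
  obtain ⟨z, hz, hl⟩ := ω.left_lim v y hy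
  have : (𝓝[<] v).NeBot := nhdsLT_neBot_of_exists_lt ⟨a, h1⟩
  have : ∀ᶠ s in 𝓝[<] v, ω s = some x := by
    filter_upwards [self_mem_nhdsWithin, nhdsWithin_le_nhds (Ioi_mem_nhds h1)] with s hs hs'
    rw [h2 s (le_of_lt hs') hs, hx]
  obtain ⟨s, hs1, hs2⟩ := (hl.and this).exists
  obtain rfl : z = x := by
    rw [hs1] at hs2
    exact Option.some_injective _ hs2
  rcases hz with rfl | hz
  · exact absurd (hy.trans hx.symm) h3
  · exact hz

/-- The successive jump times of a path; `⊤` if there are fewer jumps. -/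
def Path.jumpTime (ω : Path G) : ℕ → ℝ≥0∞
  | 0 => 0
  | k + 1 => if ω.jumpTime k = ⊤ then ⊤ else ω.nextJump (ω.jumpTime k).toNNReal

@[simp] theorem Path.jumpTime_zero (ω : Path G) : ω.jumpTime 0 = 0 := rfl

theorem Path.jumpTime_succ {ω : Path G} {k : ℕ} {a : ℝ≥0} (h : ω.jumpTime k = a) :
    ω.jumpTime (k + 1) = ω.nextJump a := by
  simp [Path.jumpTime, h]

theorem Path.jumpTime_succ_top {ω : Path G} {k : ℕ} (h : ω.jumpTime k = ⊤) :
    ω.jumpTime (k + 1) = ⊤ := by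
  simp [Path.jumpTime, h]

theorem Path.jumpTime_lt_succ {ω : Path G} {k : ℕ} (h : ω.jumpTime k ≠ ⊤) :
    ω.jumpTime k < ω.jumpTime (k + 1) := by
  lift ω.jumpTime k to ℝ≥0 using h with a ha
  rw [Path.jumpTime_succ ha.symm]
  exact ω.lt_nextJump a

theorem Path.jumpTime_mono (ω : Path G) : Monotone ω.jumpTime := by
  refine monotone_nat_of_le_succ fun k => ?_
  by_cases h : ω.jumpTime k = ⊤
  · rw [Path.jumpTime_succ_top h]; exact le_top
  · exact (Path.jumpTime_lt_succ h).le

theorem Path.jumpTime_congr {ω ω' : Path G} {g : ℝ≥0} (h : ∀ v ≤ g, ω v = ω' v) {k : ℕ}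
    (hk : ω.jumpTime k ≤ g) : ω'.jumpTime k = ω.jumpTime k := by
  induction k with
  | zero => rfl
  | succ k ih =>
    have h1 : ω.jumpTime k ≤ g := (ω.jumpTime_mono k.le_succ).trans hk
    have h2 := ih h1
    lift ω.jumpTime k to ℝ≥0 using ne_top_of_le_ne_top ENNReal.coe_ne_top h1 with a ha
    rw [Path.jumpTime_succ ha.symm] at hk ⊢
    rw [Path.jumpTime_succ h2]
    exact Path.nextJump_congr h hk

theorem Path.lt_jumpTime_succ_congr {ω ω' : Path G} {g : ℝ≥0} (h : ∀ v ≤ g, ω v = ω' v) {k : ℕ}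
    (hg : (g : ℝ≥0∞) < ω.jumpTime k) : (g : ℝ≥0∞) < ω'.jumpTime k := by
  by_contra hlt
  rw [Path.jumpTime_congr (fun v hv => (h v hv).symm) (not_lt.mp hlt)] at hg
  exact hlt hg

theorem Path.eq_of_mem_Ico_jumpTime {ω : Path G} {k : ℕ} {a v : ℝ≥0} (ha : ω.jumpTime k = a)
    (hv : a ≤ v) (hv' : (v : ℝ≥0∞) < ω.jumpTime (k + 1)) : ω v = ω a :=
  Path.eq_of_lt_nextJump hv (by rwa [← Path.jumpTime_succ ha])

/-- A path that is alive at `t` has made finitely many jumps by then. -/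
theorem Path.exists_jumpTime_le_lt {ω : Path G} {t : ℝ≥0} (h : ω t ≠ none) :
    ∃ k, ω.jumpTime k ≤ t ∧ (t : ℝ≥0∞) < ω.jumpTime (k + 1) := by
  have hex : ∃ k, (t : ℝ≥0∞) < ω.jumpTime k := by
    -- Otherwise the jumps accumulate at some `s ≤ t`. The path is alive at `s`, hence constant on
    -- an interval to the left of `s`, and this interval contains two successive jump times.
    by_contra hcon
    push Not at hcon
    have hle : ⨆ k, ω.jumpTime k ≤ t := iSup_le hcon
    lift (⨆ k, ω.jumpTime k) to ℝ≥0 using ne_top_of_le_ne_top ENNReal.coe_ne_top hle with s hs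
    have hst : s ≤ t := by exact_mod_cast hle
    obtain ⟨y, hy⟩ := Option.ne_none_iff_exists'.mp (Path.alive_of_le hst h)
    obtain ⟨x, -, hl⟩ := ω.left_lim s y hy
    have hlt : ∀ k, ω.jumpTime k < s := fun k => by
      refine (Path.jumpTime_lt_succ (ne_top_of_le_ne_top ENNReal.coe_ne_top (hcon k))).trans_le ?_
      rw [hs]
      exact le_iSup ω.jumpTime (k + 1)
    have hpos : 0 < s := by
      have := hlt 0
      simpa using this
    obtain ⟨u, hu, hu'⟩ := (mem_nhdsLT_iff_exists_Ioo_subset' hpos).mp hl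
    have : (u : ℝ≥0∞) < ⨆ k, ω.jumpTime k := by rw [← hs]; exact_mod_cast hu
    obtain ⟨k, hk⟩ := lt_iSup_iff.mp this
    have h1 := hlt k
    have h2 := hlt (k + 1)
    lift ω.jumpTime k to ℝ≥0 using ne_top_of_lt h1 with a ha
    rw [Path.jumpTime_succ ha.symm] at h2
    lift ω.nextJump a to ℝ≥0 using ne_top_of_lt h2 with b hb
    obtain ⟨hab, -, hne⟩ := Path.nextJump_eq_coe_iff.mp hb.symm
    have hua : u < a := by exact_mod_cast hk
    have e1 : ω a = some x := hu' ⟨hua, by exact_mod_cast h1⟩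
    have e2 : ω b = some x := hu' ⟨hua.trans hab, by exact_mod_cast h2⟩
    exact hne (e2.trans e1.symm)
  classical
  have h0 : Nat.find hex ≠ 0 := fun h0 => by
    have := Nat.find_spec hex
    rw [h0] at this
    simp at this
  obtain ⟨k, hk⟩ := Nat.exists_eq_succ_of_ne_zero h0
  refine ⟨k, not_lt.mp (Nat.find_min hex (by omega)), ?_⟩
  have := Nat.find_spec hex
  rwa [hk] at this

/-- The jump time number `k` and the path frozen at that time. -/
def Path.history (x₀ : V) (ω : Path G) (k : ℕ) : ℝ≥0 × InfPath G :=
  ((ω.jumpTime k).toNNReal, ω.freeze x₀ (ω.jumpTime k).toNNReal)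

theorem Path.freeze_congr {ω ω' : Path G} {g a : ℝ≥0} (h : ∀ v ≤ g, ω v = ω' v) (ha : a ≤ g)
    (x₀ : V) : ω'.freeze x₀ a = ω.freeze x₀ a := by
  ext v
  simp only [Path.freeze]
  rw [h a ha, h (min v a) ((min_le_right _ _).trans ha)]

theorem Path.history_congr {ω ω' : Path G} {g : ℝ≥0} (h : ∀ v ≤ g, ω v = ω' v) {k : ℕ}
    (hk : ω.jumpTime k ≤ g) (x₀ : V) : ω'.history x₀ k = ω.history x₀ k := by
  rw [Path.history, Path.jumpTime_congr h hk, Path.history]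
  congr 1
  refine Path.freeze_congr h ?_ x₀
  simpa using ENNReal.toNNReal_mono ENNReal.coe_ne_top hk

/-- Between two jumps, freezing gives the history of the last jump. -/
theorem Path.freeze_eq_of_lt_nextJump {ω : Path G} {a g : ℝ≥0} (h : a ≤ g)
    (hg : (g : ℝ≥0∞) < ω.nextJump a) (x₀ : V) : ω.freeze x₀ g = ω.freeze x₀ a := by
  have he := Path.eq_of_lt_nextJump h hg
  ext v
  simp only [Path.freeze]
  rw [he]
  rcases le_total v a with hv | hv
  · rw [min_eq_left hv, min_eq_left (hv.trans h)]
  · rw [min_eq_right hv, Path.lt_nextJump_iff.mp hg _ (le_min hv h) (min_le_right _ _)]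

/-- After a jump, the frozen path is the previous one with the jump appended. -/
theorem Path.freeze_nextJump {ω : Path G} {a v : ℝ≥0} (hv : ω.nextJump a = v) {y : V}
    (hy : ω v = some y) (x₀ : V) :
    CanAppend (ω.freeze x₀ a) a v y ∧
      ω.freeze x₀ v = (ω.freeze x₀ a).append a v y := by
  obtain ⟨h1, h2, h3⟩ := Path.nextJump_eq_coe_iff.mp hv
  have hva : ω v ≠ none := by simp [hy]
  have haa : ω a ≠ none := Path.alive_of_le h1.le hva
  obtain ⟨x, hx⟩ := Option.ne_none_iff_exists'.mp haa
  have hfa : ω.freeze x₀ a a = x := Option.some_injective _ (by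
    rw [Path.freeze_of_le haa le_rfl, hx])
  have hc : CanAppend (ω.freeze x₀ a) a v y :=
    ⟨h1, fun u hu => Path.freeze_const x₀ a ω hu, by
      rw [hfa]; exact Path.adj_of_nextJump hv hx hy⟩
  refine ⟨hc, ?_⟩
  ext u
  apply Option.some_injective
  rcases lt_or_ge u v with hu | hu
  · rw [InfPath.append_of_lt hu, Path.freeze_of_le hva hu.le]
    rcases le_total u a with hua | hua
    · rw [Path.freeze_of_le haa hua]
    · rw [Path.freeze_of_ge haa hua, h2 u hua hu]
  · rw [InfPath.append_of_ge hc hu, Path.freeze_of_ge hva hu, hy]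

/-! ### Measurability of the jump times -/

theorem Path.measurable_nextJump_prod [Countable V] :
    Measurable fun p : ℝ≥0 × Path G => p.2.nextJump p.1 := by
  refine measurable_of_Ioi fun c => ?_
  induction c using ENNReal.recTopCoe with
  | top => simp
  | coe c =>
    -- The end point `c` is listed apart because the rational times that approximate it from the
    -- right lie outside the interval.
    have : (fun p : ℝ≥0 × Path G => p.2.nextJump p.1) ⁻¹' Ioi (c : ℝ≥0∞) =
        {p | p.1 ≤ c → p.2 c = p.2 p.1} ∩ ⋂ q : ℚ, {p | p.1 ≤ Real.toNNReal q →
          Real.toNNReal q ≤ c → p.2 (Real.toNNReal q) = p.2 p.1} := by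
      ext ⟨a, ω⟩
      simp only [mem_preimage, mem_Ioi, mem_inter_iff, mem_iInter, mem_ofPred_eq,
        Path.lt_nextJump_iff]
      refine ⟨fun h => ⟨fun hc => h c hc le_rfl, fun q hq hq' => h _ hq hq'⟩, fun h v hv hvc => ?_⟩
      rcases hvc.lt_or_eq with hlt | rfl
      · obtain ⟨q, hq1, hq2, hq⟩ := exists_rat_eq_of_right (ω.right_cont v) hlt
        rw [← hq]
        exact h.2 q (hv.trans hq1.le) hq2.le
      · exact h.1 hv
    rw [this]
    have he := Path.measurable_eval_prod (G := G)
    refine MeasurableSet.inter (MeasurableSet.imp ?_ ?_) (.iInter fun q =>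
      MeasurableSet.imp ?_ (MeasurableSet.imp (MeasurableSet.const _) ?_))
    · exact measurableSet_le measurable_fst measurable_const
    · exact measurableSet_eq_fun ((Path.measurable_eval _).comp measurable_snd) he
    · exact measurableSet_le measurable_fst measurable_const
    · exact measurableSet_eq_fun ((Path.measurable_eval _).comp measurable_snd) he

theorem Path.measurable_nextJump [Countable V] (a : ℝ≥0) :
    Measurable fun ω : Path G => ω.nextJump a :=
  Path.measurable_nextJump_prod.comp (measurable_const.prodMk measurable_id)

theorem Path.measurable_jumpTime [Countable V] (k : ℕ) :
    Measurable fun ω : Path G => ω.jumpTime k := by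
  induction k with
  | zero => exact measurable_const
  | succ k ih =>
    have h1 : Measurable fun ω : Path G => (ω.jumpTime k).toNNReal := ih.ennreal_toNNReal
    have h2 : Measurable fun ω : Path G => ((ω.jumpTime k).toNNReal, ω) := h1.prodMk measurable_id
    have h := (Path.measurable_nextJump_prod (G := G)).comp h2
    exact Measurable.ite (ih (measurableSet_singleton ⊤)) measurable_const h

theorem Path.measurable_jumpState [Countable V] (k : ℕ) :
    Measurable fun ω : Path G => ω (ω.jumpTime k).toNNReal :=
  Path.measurable_eval_prod.comp
    ((Path.measurable_jumpTime k).ennreal_toNNReal.prodMk measurable_id)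

theorem Path.measurable_history [Countable V] (x₀ : V) (k : ℕ) :
    Measurable fun ω : Path G => ω.history x₀ k := by
  have h1 : Measurable fun ω : Path G => (ω.jumpTime k).toNNReal :=
    (Path.measurable_jumpTime k).ennreal_toNNReal
  have h2 : Measurable fun ω : Path G => ((ω.jumpTime k).toNNReal, ω) := h1.prodMk measurable_id
  have h3 := (Path.measurable_freeze_prod (G := G) x₀).comp h2
  exact h1.prodMk h3

/-- A measurable event that is determined by the path up to time `g` is in `ℱ_g`. -/
theorem Path.measurableSet_filt_of_determined {g : ℝ≥0} {A : Set (Path G)} (hA : MeasurableSet A)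
    (halive : ∀ ω ∈ A, ω g ≠ none)
    (hdet : ∀ ω ω' : Path G, (∀ v ≤ g, ω v = ω' v) → ω ∈ A → ω' ∈ A) :
    MeasurableSet[Path.filt G g] A := by
  rcases isEmpty_or_nonempty V with hV | ⟨⟨x₀⟩⟩
  · have : A = ∅ := by
      ext ω
      simp only [mem_empty_iff_false, iff_false]
      intro h
      obtain ⟨y, -⟩ := Option.ne_none_iff_exists'.mp (halive ω h)
      exact hV.false y
    rw [this]
    exact @MeasurableSet.empty _ (Path.filt G g)
  -- An event determined up to `g` does not notice freezing at `g`, and freezing is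
  -- `ℱ_g`-measurable.
  · have : A = {ω | ω g ≠ none} ∩ (fun ω : Path G => (ω.freeze x₀ g).toPath) ⁻¹' A := by
      ext ω
      constructor
      · intro h
        exact ⟨halive ω h, hdet ω _ (fun v hv => (Path.freeze_of_le (halive ω h) hv).symm) h⟩
      · rintro ⟨h, h'⟩
        exact hdet _ ω (fun v hv => Path.freeze_of_le h hv) h'
    rw [this]
    exact @MeasurableSet.inter _ (Path.filt G g) _ _ (Path.measurableSet_filt_alive g)
      ((InfPath.measurable_toPath.comp (Path.measurable_freeze_filt x₀ g)) hA)

/-! ### Events that prescribe the jumps -/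

/-- The path visits `x_0, …, x_l` in its first `l` jumps, which happen at times in the given
sets. -/
def jumpEvent (G : SimpleGraph V) (x : ℕ → V) (D : ℕ → Set ℝ≥0) (l : ℕ) : Set (Path G) :=
  {ω | ∀ i ≤ l, ω.jumpTime i ≠ ⊤ ∧ ω (ω.jumpTime i).toNNReal = some (x i) ∧
    -- The sets are numbered from zero, so that jump `i` is constrained by `D (i - 1)`; the initial
    -- time is not constrained.
    (i ≠ 0 → (ω.jumpTime i).toNNReal ∈ D (i - 1))}

theorem jumpEvent_zero (x : ℕ → V) (D : ℕ → Set ℝ≥0) :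
    jumpEvent G x D 0 = {ω | ω 0 = some (x 0)} := by
  ext ω
  simp [jumpEvent]

theorem jumpEvent_succ (x : ℕ → V) (D : ℕ → Set ℝ≥0) (l : ℕ) :
    jumpEvent G x D (l + 1) = jumpEvent G x D l ∩ {ω | ω.jumpTime (l + 1) ≠ ⊤ ∧
      ω (ω.jumpTime (l + 1)).toNNReal = some (x (l + 1)) ∧
        (ω.jumpTime (l + 1)).toNNReal ∈ D l} := by
  ext ω
  simp only [jumpEvent, mem_ofPred_eq, mem_inter_iff]
  constructor
  · intro h
    obtain ⟨h1, h2, h3⟩ := h (l + 1) le_rfl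
    exact ⟨fun i hi => h i (hi.trans l.le_succ), h1, h2, h3 l.succ_ne_zero⟩
  · rintro ⟨h, h1, h2, h3⟩ i hi
    rcases Nat.lt_or_ge l i with hli | hli
    · obtain rfl : i = l + 1 := by omega
      exact ⟨h1, h2, fun _ => h3⟩
    · exact h i hli

theorem measurableSet_jumpEvent [Countable V] (x : ℕ → V) {D : ℕ → Set ℝ≥0}
    (hD : ∀ i, MeasurableSet (D i)) (l : ℕ) : MeasurableSet (jumpEvent G x D l) := by
  have : jumpEvent G x D l = ⋂ i : ℕ, ⋂ _ : i ≤ l,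
      ({ω | ω.jumpTime i ≠ ⊤} ∩ ({ω | ω (ω.jumpTime i).toNNReal = some (x i)} ∩
        {ω | i ≠ 0 → (ω.jumpTime i).toNNReal ∈ D (i - 1)})) := by
    ext ω
    simp [jumpEvent]
  rw [this]
  refine .iInter fun i => .iInter fun _ => ?_
  refine (Path.measurable_jumpTime i (measurableSet_singleton ⊤).compl).inter
    ((Path.measurable_jumpState i (MeasurableSet.of_discrete (s := {some (x i)}))).inter ?_)
  exact MeasurableSet.imp (MeasurableSet.const _)
    ((Path.measurable_jumpTime i).ennreal_toNNReal (hD _))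

theorem jumpEvent_congr {x : ℕ → V} {D : ℕ → Set ℝ≥0} {l : ℕ} {g : ℝ≥0} {ω ω' : Path G}
    (h : ∀ v ≤ g, ω v = ω' v) (hl : ω.jumpTime l ≤ g) (hω : ω ∈ jumpEvent G x D l) :
    ω' ∈ jumpEvent G x D l := by
  intro i hi
  have hi' : ω.jumpTime i ≤ g := (ω.jumpTime_mono hi).trans hl
  rw [Path.jumpTime_congr h hi', ← h]
  · exact hω i hi
  · simpa using ENNReal.toNNReal_mono ENNReal.coe_ne_top hi'

end

section


variable {V : Type*} {G : SimpleGraph V} {T : InfPath G → ℝ≥0∞}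
  {r : ℝ≥0 → V → V → InfPath G → ℝ≥0}

/-! ### Stopping times -/

/-- As `{T ≤ t}` belongs to `ℱ_t`, the path up to and including `t` decides whether `T` has
occurred. -/
theorem IsLSCStoppingTime.lt_congr (hT : IsLSCStoppingTime T) {t : ℝ≥0} {η η' : InfPath G}
    (h : ∀ s ≤ t, η s = η' s) : (t : ℝ≥0∞) < T η ↔ (t : ℝ≥0∞) < T η' := by
  rw [← not_le, ← not_le, not_iff_not]
  exact InfPath.mem_iff_of_filt (hT.stopping t) h

theorem IsLSCStoppingTime.measurable (hT : IsLSCStoppingTime T) : Measurable T := by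
  refine measurable_of_Iic fun c => ?_
  induction c using ENNReal.recTopCoe with
  | top => simp
  | coe c => exact InfPath.filt_le c _ (hT.stopping c)

/-- A piecewise linear time change that exhibits a jump at `v` and the same jump at `v + δ` as
Skorokhod-close. -/
theorem exists_orderIso_shift {a v δ : ℝ≥0} (hav : a < v) :
    ∃ l : ℝ≥0 ≃o ℝ≥0, (∀ s ≤ a, l s = s) ∧ (∀ s, s ≤ l s ∧ l s ≤ s + δ) ∧ l v = v + δ := by
  have hc : (0 : ℝ≥0) < v - a := tsub_pos_of_lt hav
  -- Truncated subtraction makes the delay zero up to `a`; it then grows linearly and is capped at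
  -- `δ` from `v` on.
  let f : ℝ≥0 → ℝ≥0 := fun s => s + δ * min 1 ((s - a) / (v - a))
  have hmono : StrictMono f := by
    intro s t hst
    refine add_lt_add_of_lt_of_le hst ?_
    gcongr
  have hcont : Continuous f := by fun_prop
  have hle : ∀ s, s ≤ f s := fun s => le_self_add
  have hsurj : Function.Surjective f := by
    intro t
    have h0 : f 0 = 0 := by simp [f]
    obtain ⟨s, -, hs⟩ := intermediate_value_Icc (zero_le (a := t)) hcont.continuousOn
      (show t ∈ Icc (f 0) (f t) by rw [h0]; exact ⟨zero_le, hle t⟩)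
    exact ⟨s, hs⟩
  refine ⟨hmono.orderIsoOfSurjective f hsurj, fun s hs => ?_, fun s => ⟨hle s, ?_⟩, ?_⟩
  · simp [f, tsub_eq_zero_of_le hs]
  · change s + δ * min 1 ((s - a) / (v - a)) ≤ s + δ
    gcongr
    exact mul_le_of_le_one_right' (min_le_left _ _)
  · simp [f, div_self hc.ne']

/-- By lower semicontinuity a jump at a time `v` cannot revive a path that is terminated at `v`. -/
theorem IsLSCStoppingTime.lt_of_lt_append (hT : IsLSCStoppingTime T) {η : InfPath G} {a v : ℝ≥0}
    {y : V} (h : CanAppend η a v y) (hv : (v : ℝ≥0∞) < T (η.append a v y)) :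
    (v : ℝ≥0∞) < T η := by
  obtain ⟨N, ε, hε, hs⟩ := hT.lsc.isOpen_preimage (v : ℝ≥0∞) (η.append a v y) hv
  -- Half of `ε`, because Skorokhod neighbourhoods require a strict bound on the time change.
  set δ : ℝ≥0 := Real.toNNReal (ε / 2) with hδ
  have hδε : (δ : ℝ) < ε := by
    rw [hδ, Real.coe_toNNReal _ (by linarith)]; linarith
  have hδ0 : 0 < δ := Real.toNNReal_pos.mpr (by linarith)
  obtain ⟨l, hl1, hl2, hl3⟩ := exists_orderIso_shift (δ := δ) h.1
  have h' : CanAppend η a (v + δ) y := ⟨h.1.trans_le le_self_add, h.2⟩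
  have hmem : η.append a (v + δ) y ∈ skorokhodNhd (η.append a v y) N ε := by
    refine ⟨l, fun s _ => ⟨?_, ?_⟩⟩
    · obtain ⟨h1, h2⟩ := hl2 s
      rw [NNReal.dist_eq, abs_lt]
      have h1' : (s : ℝ) ≤ l s := by exact_mod_cast h1
      have h2' : (l s : ℝ) ≤ s + δ := by exact_mod_cast h2
      constructor <;> linarith
    · rcases lt_or_ge s v with hsv | hsv
      · have : l s < v + δ := by rw [← hl3]; exact l.strictMono hsv
        rw [InfPath.append_of_lt this, InfPath.append_of_lt hsv]
        rcases le_total s a with hsa | hsa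
        · rw [hl1 s hsa]
        · rw [h.2.1 s hsa, h.2.1 (l s) (hsa.trans (hl2 s).1)]
      · have : v + δ ≤ l s := by rw [← hl3]; exact l.monotone hsv
        rw [InfPath.append_of_ge h' this, InfPath.append_of_ge h hsv]
  -- The path with the delayed jump lies in the open set `{v < T}` and agrees with `η` up to and
  -- including `v`.
  refine (hT.lt_congr fun s hs => ?_).mp (hs hmem)
  exact InfPath.append_of_lt (hs.trans_lt (lt_add_of_pos_right v hδ0))

/-! ### Rates along a path -/

open Classical in
/-- The rate at which the path `η` jumps to `y` at time `v`; zero after the terminal time. -/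
def rate (T : InfPath G → ℝ≥0∞) (r : ℝ≥0 → V → V → InfPath G → ℝ≥0) (y : V) (v : ℝ≥0)
    (η : InfPath G) : ℝ≥0 :=
  if (v : ℝ≥0∞) < T η ∧ G.Adj (η v) y then r v (η v) y η else 0

theorem rate_of_lt {y : V} {v : ℝ≥0} {η : InfPath G} (hv : (v : ℝ≥0∞) < T η)
    (hy : G.Adj (η v) y) : rate T r y v η = r v (η v) y η :=
  if_pos ⟨hv, hy⟩

theorem rate_of_not_lt {y : V} {v : ℝ≥0} {η : InfPath G} (hv : ¬ (v : ℝ≥0∞) < T η) :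
    rate T r y v η = 0 :=
  if_neg fun h => hv h.1

theorem rate_of_not_adj {y : V} {v : ℝ≥0} {η : InfPath G} (hy : ¬ G.Adj (η v) y) :
    rate T r y v η = 0 :=
  if_neg fun h => hy h.2

/-- Adaptedness in pathwise form: the set of paths sharing the given value of the rate is an event
of `ℱ_v`, hence blind to the path after `v`. -/
theorem IsTerminatedRates.rate_congr (hr : IsTerminatedRates T r)
    {y : V} {v : ℝ≥0} {η η' : InfPath G} (h : ∀ s ≤ v, η s = η' s) :
    rate T r y v η = rate T r y v η' := by
  classical
  by_cases hy : G.Adj (η v) y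
  · have hA := hr.adapted (η v) y hy v
      (measurableSet_singleton (rate T r y v η))
    have hmem : η ∈ (fun ω : InfPath G => if (v : ℝ≥0∞) < T ω ∧ ω v = η v then r v (η v) y ω else 0)
        ⁻¹' {rate T r y v η} := by
      simp [rate, hy]
    have := (InfPath.mem_iff_of_filt hA h).mp hmem
    simp only [mem_preimage, mem_singleton_iff] at this
    rw [← this]
    simp [rate, ← h v le_rfl, hy]
  · rw [rate_of_not_adj hy, rate_of_not_adj (by rwa [← h v le_rfl])]

theorem IsTerminatedRates.measurable_rate [Countable V] (hr : IsTerminatedRates T r) (y : V) (v : ℝ≥0) : Measurable (rate T r y v) := by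
  classical
  let _ : MeasurableSpace V := ⊤
  intro B hB
  have : rate T r y v ⁻¹' B = ⋃ x : V, {η | η v = x} ∩
      {η | (if G.Adj x y then (if (v : ℝ≥0∞) < T η ∧ η v = x then r v x y η else 0) else 0) ∈ B} := by
    ext η
    simp only [mem_preimage, mem_iUnion, mem_inter_iff, mem_ofPred_eq, exists_eq_left']
    by_cases hy : G.Adj (η v) y <;> simp [rate, hy]
  rw [this]
  refine .iUnion fun x => (InfPath.measurable_eval v (MeasurableSet.of_discrete (s := {x}))).inter ?_
  by_cases hy : G.Adj x y
  · simp only [hy, if_true]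
    exact ((hr.adapted x y hy v).mono (InfPath.filt_le v) le_rfl) hB
  · simp [hy]

theorem IsTerminatedRates.continuousOn_slice (hr : IsTerminatedRates T r) {x y : V}
    (hxy : G.Adj x y) (η : InfPath G) :
    ContinuousOn (fun v : ℝ≥0 => r v x y η) {v | (v : ℝ≥0∞) < T η ∧ η v = x} :=
  (hr.cont x y hxy).comp (f := fun v : ℝ≥0 => (v, η)) (by fun_prop) fun _ hv => hv

/-- Just after `v` the state is unchanged, and both `v < T η` and its negation persist to the right.
So continuity of `r` on its domain suffices, and joint measurability follows. -/
theorem IsTerminatedRates.tendsto_rate (hr : IsTerminatedRates T r) (y : V) (v : ℝ≥0)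
    (η : InfPath G) : Tendsto (fun s => rate T r y s η) (𝓝[>] v) (𝓝 (rate T r y v η)) := by
  by_cases hv : (v : ℝ≥0∞) < T η
  · by_cases hy : G.Adj (η v) y
    · have h1 : ∀ᶠ s : ℝ≥0 in 𝓝[>] v, (s : ℝ≥0∞) < T η :=
        (ENNReal.continuous_coe.tendsto v |>.mono_left nhdsWithin_le_nhds).eventually_lt_const hv
      have h2 : ∀ᶠ s in 𝓝[>] v, s ∈ {v' : ℝ≥0 | (v' : ℝ≥0∞) < T η ∧ η v' = η v} := by
        filter_upwards [h1, η.right_cont v] with s hs hs' using ⟨hs, hs'⟩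
      have h3 := hr.continuousOn_slice hy η v ⟨hv, rfl⟩
      have h4 : Tendsto (fun s : ℝ≥0 => r s (η v) y η) (𝓝[>] v) (𝓝 (r v (η v) y η)) :=
        h3.mono_left (le_inf nhdsWithin_le_nhds (le_principal_iff.mpr h2))
      rw [rate_of_lt hv hy]
      refine h4.congr' ?_
      filter_upwards [h2] with s hs
      rw [rate_of_lt hs.1 (by rwa [hs.2]), hs.2]
    · rw [rate_of_not_adj hy]
      refine tendsto_const_nhds.congr' ?_
      filter_upwards [η.right_cont v] with s hs
      rw [rate_of_not_adj (by rwa [hs])]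
  · rw [rate_of_not_lt hv]
    refine tendsto_const_nhds.congr' ?_
    filter_upwards [self_mem_nhdsWithin] with s hs
    rw [rate_of_not_lt]
    exact fun h => hv (lt_trans (by exact_mod_cast hs) h)

theorem IsTerminatedRates.measurable_rate_prod [Countable V] (hr : IsTerminatedRates T r) (y : V) :
    Measurable fun p : ℝ≥0 × InfPath G => rate T r y p.1 p.2 :=
  measurable_of_right_continuous (f := fun v η => rate T r y v η)
    (fun v => hr.measurable_rate y v) fun v η => hr.tendsto_rate y v η

/-- Once the path is frozen, right continuity improves to continuity, which the calculus of the
holding times needs. -/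
theorem IsTerminatedRates.continuousOn_rate (hr : IsTerminatedRates T r) (y : V) {a : ℝ≥0}
    {η : InfPath G} (hη : ∀ u, a ≤ u → η u = η a) :
    ContinuousOn (fun v => rate T r y v η) {v | a ≤ v ∧ (v : ℝ≥0∞) < T η} := by
  by_cases hy : G.Adj (η a) y
  · refine ((hr.continuousOn_slice hy η).mono fun v hv => ⟨hv.2, hη v hv.1⟩).congr fun v hv => ?_
    rw [rate_of_lt hv.2 (by rwa [hη v hv.1]), hη v hv.1]
  · refine continuousOn_const (c := 0) |>.congr fun v hv => ?_
    exact rate_of_not_adj (by rwa [hη v hv.1])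

/-- The total jump rate of `η` at time `v`. -/
def totalRate (T : InfPath G → ℝ≥0∞) (r : ℝ≥0 → V → V → InfPath G → ℝ≥0) (v : ℝ≥0)
    (η : InfPath G) : ℝ≥0∞ :=
  ∑' y, (rate T r y v η : ℝ≥0∞)

theorem totalRate_eq_sum [G.LocallyFinite] (v : ℝ≥0) (η : InfPath G) :
    totalRate T r v η = ((∑ y ∈ G.neighborFinset (η v), rate T r y v η : ℝ≥0) : ℝ≥0∞) := by
  rw [totalRate, ENNReal.ofNNReal_finsetSum]
  refine tsum_eq_sum fun y hy => ?_
  rw [rate_of_not_adj (by simpa using hy), ENNReal.coe_zero]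

theorem IsTerminatedRates.measurable_totalRate [Countable V] (hr : IsTerminatedRates T r) :
    Measurable fun p : ℝ≥0 × InfPath G => totalRate T r p.1 p.2 :=
  Measurable.tsum fun y => (hr.measurable_rate_prod y).coe_nnreal_ennreal

/-- The rate accumulated by `η` during `(a, c]`. -/
def cumRate (T : InfPath G → ℝ≥0∞) (r : ℝ≥0 → V → V → InfPath G → ℝ≥0) (η : InfPath G)
    (a c : ℝ≥0) : ℝ≥0∞ :=
  ∫⁻ v : ℝ in Ioc (a : ℝ) c, totalRate T r v.toNNReal η

theorem cumRate_self (η : InfPath G) (a : ℝ≥0) : cumRate T r η a a = 0 := by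
  simp [cumRate]

theorem cumRate_add (η : InfPath G) {a b c : ℝ≥0} (hab : a ≤ b) (hbc : b ≤ c) :
    cumRate T r η a b + cumRate T r η b c = cumRate T r η a c := by
  rw [cumRate, cumRate, cumRate, ← lintegral_union measurableSet_Ioc (Ioc_disjoint_Ioc_of_le le_rfl),
    Ioc_union_Ioc_eq_Ioc (by exact_mod_cast hab) (by exact_mod_cast hbc)]

theorem IsTerminatedRates.totalRate_congr (hr : IsTerminatedRates T r)
    {v : ℝ≥0} {η η' : InfPath G} (h : ∀ s ≤ v, η s = η' s) :
    totalRate T r v η = totalRate T r v η' := by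
  simp only [totalRate, hr.rate_congr h]

theorem IsTerminatedRates.cumRate_congr (hr : IsTerminatedRates T r)
    {η η' : InfPath G} {c : ℝ≥0} (h : ∀ s < c, η s = η' s) (a : ℝ≥0) :
    cumRate T r η a c = cumRate T r η' a c := by
  -- Dropping the null end point lets the two paths differ at `c` itself, as they do when a jump is
  -- appended at `c`.
  rw [cumRate, cumRate, ← restrict_Ioo_eq_restrict_Ioc]
  refine setLIntegral_congr_fun measurableSet_Ioo fun v hv => hr.totalRate_congr fun s hs => ?_
  refine h s (hs.trans_lt ?_)
  rw [Real.toNNReal_lt_iff_lt_coe ((NNReal.coe_nonneg a).trans hv.1.le)]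
  exact hv.2

theorem IsTerminatedRates.measurable_cumRate [Countable V] (hr : IsTerminatedRates T r) :
    Measurable fun p : (ℝ≥0 × InfPath G) × ℝ≥0 => cumRate T r p.1.2 p.1.1 p.2 := by
  have h1 : Measurable fun p : ((ℝ≥0 × InfPath G) × ℝ≥0) × ℝ => totalRate T r p.2.toNNReal p.1.1.2 :=
    (hr.measurable_totalRate).comp (measurable_snd.real_toNNReal.prodMk
      ((measurable_snd.comp measurable_fst).comp measurable_fst))
  have h2 : MeasurableSet {p : ((ℝ≥0 × InfPath G) × ℝ≥0) × ℝ | (p.1.1.1 : ℝ) < p.2 ∧ p.2 ≤ p.1.2} := by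
    refine (measurableSet_lt ?_ measurable_snd).inter (measurableSet_le measurable_snd ?_)
    · exact ((measurable_fst.comp measurable_fst).comp measurable_fst).coe_nnreal_real
    · exact (measurable_snd.comp measurable_fst).coe_nnreal_real
  have h3 := (h1.indicator h2).lintegral_prod_right' (ν := volume)
  convert h3 using 2 with p
  rw [cumRate, ← lintegral_indicator measurableSet_Ioc]
  rfl

/-- `exp (-Λ)` for `Λ ∈ [0, ∞]`. -/
def expNeg (Λ : ℝ≥0∞) : ℝ≥0∞ := if Λ = ⊤ then 0 else ENNReal.ofReal (Real.exp (-Λ.toReal))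

@[simp] theorem expNeg_zero : expNeg 0 = 1 := by simp [expNeg]

theorem expNeg_ofReal {x : ℝ} (hx : 0 ≤ x) :
    expNeg (ENNReal.ofReal x) = ENNReal.ofReal (Real.exp (-x)) := by
  simp [expNeg, ENNReal.toReal_ofReal hx]

theorem expNeg_add (Λ Λ' : ℝ≥0∞) : expNeg (Λ + Λ') = expNeg Λ * expNeg Λ' := by
  by_cases h : Λ = ⊤
  · simp [expNeg, h]
  by_cases h' : Λ' = ⊤
  · simp [expNeg, h']
  simp only [expNeg, h, h', ENNReal.add_eq_top, or_self, if_false]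
  rw [← ENNReal.ofReal_mul (Real.exp_nonneg _), ← Real.exp_add, ENNReal.toReal_add h h', neg_add]

theorem expNeg_le_one (Λ : ℝ≥0∞) : expNeg Λ ≤ 1 := by
  unfold expNeg
  split_ifs
  · exact zero_le
  · exact ENNReal.ofReal_le_one.mpr (Real.exp_le_one_iff.mpr (by simp))

theorem measurable_expNeg : Measurable expNeg := by
  refine Measurable.ite (measurableSet_singleton ⊤) measurable_const ?_
  fun_prop

open Classical in
/-- The density of the first jump after `a`, to `y` at time `v`, of a path with history `η`. -/
def jumpDensity (T : InfPath G → ℝ≥0∞) (r : ℝ≥0 → V → V → InfPath G → ℝ≥0) (y : V) (a : ℝ≥0)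
    (η : InfPath G) (v : ℝ≥0) : ℝ≥0∞ :=
  if a < v then expNeg (cumRate T r η a v) * rate T r y v η else 0

theorem jumpDensity_of_lt {y : V} {a v : ℝ≥0} {η : InfPath G} (h : a < v) :
    jumpDensity T r y a η v = expNeg (cumRate T r η a v) * rate T r y v η := if_pos h

/-- The Markov property of the density: survive from `a` to `g`, then restart at `g`. -/
theorem jumpDensity_mul {y : V} {a g v : ℝ≥0} (hag : a ≤ g) (hgv : g < v) (η : InfPath G) :
    jumpDensity T r y a η v = expNeg (cumRate T r η a g) * jumpDensity T r y g η v := by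
  rw [jumpDensity_of_lt (hag.trans_lt hgv), jumpDensity_of_lt hgv, ← mul_assoc, ← expNeg_add,
    cumRate_add η hag hgv.le]

theorem IsTerminatedRates.measurable_jumpDensity [Countable V] (hr : IsTerminatedRates T r) (y : V) :
    Measurable fun p : (ℝ≥0 × InfPath G) × ℝ≥0 => jumpDensity T r y p.1.1 p.1.2 p.2 := by
  refine Measurable.ite (measurableSet_lt (measurable_fst.comp measurable_fst) measurable_snd) ?_
    measurable_const
  refine (measurable_expNeg.comp (hr.measurable_cumRate)).mul ?_
  exact ((hr.measurable_rate_prod y).comp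
    (measurable_snd.prodMk (measurable_snd.comp measurable_fst))).coe_nnreal_ennreal

end

section


/-! ### Real analysis -/

theorem hasDerivAt_integral_of_mem_Ioo {q : ℝ → ℝ} {a b u : ℝ} (hq : ContinuousOn q (Icc a b))
    (hu : u ∈ Ioo a b) : HasDerivAt (fun v => ∫ w in a..v, q w) (q u) u := by
  have hmem : Icc a b ∈ 𝓝 u := Icc_mem_nhds hu.1 hu.2
  refine intervalIntegral.integral_hasDerivAt_right ?_
    ⟨Icc a b, hmem, hq.aestronglyMeasurable measurableSet_Icc⟩ (hq.continuousAt hmem)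
  exact (hq.mono (Icc_subset_Icc_right hu.2.le)).intervalIntegrable_of_Icc hu.1.le

theorem continuousOn_integral_Icc {q : ℝ → ℝ} {a b : ℝ} (hq : ContinuousOn q (Icc a b)) :
    ContinuousOn (fun v => ∫ w in a..v, q w) (Icc a b) := by
  rcases le_or_gt a b with hab | hab
  · have := intervalIntegral.continuousOn_primitive_interval (μ := volume) (f := q) (a := a) (b := b)
      (by rw [uIcc_of_le hab]; exact hq.integrableOn_Icc)
    rwa [uIcc_of_le hab] at this
  · rw [Icc_eq_empty (not_le.mpr hab)]
    exact continuousOn_empty _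

theorem integral_exp_neg_mul {q : ℝ → ℝ} {a b : ℝ} (hab : a ≤ b) (hq : ContinuousOn q (Icc a b)) :
    ∫ v in a..b, Real.exp (-∫ w in a..v, q w) * q v = 1 - Real.exp (-∫ w in a..b, q w) := by
  have hc := continuousOn_integral_Icc hq
  have h := intervalIntegral.integral_eq_sub_of_hasDeriv_right_of_le hab
    (f := fun v => -Real.exp (-∫ w in a..v, q w))
    (f' := fun v => Real.exp (-∫ w in a..v, q w) * q v) (by fun_prop)
    (fun v hv => by
      have := (hasDerivAt_integral_of_mem_Ioo hq hv).fun_neg.exp.fun_neg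
      simpa using this.hasDerivWithinAt)
    (ContinuousOn.intervalIntegrable_of_Icc hab (by fun_prop))
  rw [h]
  simp
  ring

/-- Only forward increments are controlled, but uniformly in the base point. Taking the smaller of
two points as base gives continuity from the left as well. -/
theorem continuousOn_of_increment_le {f : ℝ → ℝ} {a b C δ : ℝ} (hδ : 0 < δ)
    (hf : ∀ u h, a ≤ u → 0 < h → h < δ → u + h ≤ b → |f (u + h) - f u| ≤ C * h) :
    ContinuousOn f (Icc a b) := by
  have key : ∀ u ∈ Icc a b, ∀ v ∈ Icc a b, |v - u| < δ → |f v - f u| ≤ C * |v - u| := by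
    have aux : ∀ u ∈ Icc a b, ∀ v ∈ Icc a b, u < v → v - u < δ → |f v - f u| ≤ C * (v - u) := by
      intro u hu v hv huv hd
      have := hf u (v - u) hu.1 (sub_pos.mpr huv) hd (by linarith [hv.2])
      rwa [add_sub_cancel] at this
    intro u hu v hv hd
    rcases lt_trichotomy u v with h | rfl | h
    · rw [abs_of_pos (sub_pos.mpr h)] at hd ⊢
      exact aux u hu v hv h hd
    · simp
    · rw [abs_sub_comm v u, abs_of_pos (sub_pos.mpr h)] at hd ⊢
      rw [abs_sub_comm]
      exact aux v hv u hu h hd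
  intro u hu
  rw [ContinuousWithinAt, tendsto_iff_norm_sub_tendsto_zero]
  have h1 : Tendsto (fun v => C * |v - u|) (𝓝[Icc a b] u) (𝓝 0) := by
    have : Continuous fun v : ℝ => C * |v - u| := by fun_prop
    have h2 := this.tendsto u
    simp only [sub_self, abs_zero, mul_zero] at h2
    exact h2.mono_left nhdsWithin_le_nhds
  refine tendsto_of_tendsto_of_tendsto_of_le_of_le' tendsto_const_nhds h1
    (Eventually.of_forall fun v => norm_nonneg _) ?_
  have h3 : ∀ᶠ v in 𝓝[Icc a b] u, |v - u| < δ := by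
    have : Tendsto (fun v : ℝ => |v - u|) (𝓝 u) (𝓝 0) := by
      have h := (show Continuous fun v : ℝ => |v - u| by fun_prop).tendsto u
      simpa using h
    exact nhdsWithin_le_nhds (this.eventually_lt_const hδ)
  filter_upwards [h3, self_mem_nhdsWithin] with v hv hv'
  exact key u hu v hv' hv

theorem hasDerivWithinAt_Ici_of_increment {f : ℝ → ℝ} {b u φ : ℝ} (hub : u < b)
    (hf : ∀ ε > 0, ∃ δ > 0, ∀ h, 0 < h → h < δ → u + h ≤ b → |f (u + h) - f u - φ * h| ≤ ε * h) :
    HasDerivWithinAt f φ (Ici u) u := by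
  rw [hasDerivWithinAt_iff_isLittleO, Asymptotics.isLittleO_iff]
  intro ε hε
  obtain ⟨δ, hδ, h⟩ := hf ε hε
  filter_upwards [self_mem_nhdsWithin,
    nhdsWithin_le_nhds (Iio_mem_nhds (lt_min hub (lt_add_of_pos_right u hδ)))] with v hv hv'
  rcases (show u ≤ v from hv).eq_or_lt with rfl | hlt
  · simp
  · obtain ⟨h1, h2⟩ := lt_min_iff.mp (mem_Iio.mp hv')
    have := h (v - u) (sub_pos.mpr hlt) (by linarith) (by linarith)
    rw [add_sub_cancel] at this
    simpa [Real.norm_eq_abs, abs_of_pos (sub_pos.mpr hlt), mul_comm] using this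

/-- Survival and jump probabilities are determined by their uniform infinitesimal increments. -/
theorem survival_of_increments {ι : Type*} {N : Finset ι} {ρ J : ι → ℝ → ℝ} {S : ℝ → ℝ} {a b : ℝ}
    (hab : a ≤ b) (hρ : ∀ y ∈ N, ContinuousOn (ρ y) (Icc a b))
    (hS : ∀ u ∈ Icc a b, S u = 1 - ∑ y ∈ N, J y u)
    (hS0 : ∀ u ∈ Icc a b, 0 ≤ S u ∧ S u ≤ 1) (hJ0 : ∀ y ∈ N, J y a = 0)
    (hinc : ∀ y ∈ N, ∀ ε > 0, ∃ δ > 0, ∀ u h, a ≤ u → 0 < h → h < δ → u + h ≤ b →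
      |J y (u + h) - J y u - S u * (ρ y u * h)| ≤ S u * (ε * h)) :
    S b = Real.exp (-∫ w in a..b, ∑ y ∈ N, ρ y w) ∧
    ∀ y ∈ N, J y b = ∫ v in a..b, Real.exp (-∫ w in a..v, ∑ y ∈ N, ρ y w) * ρ y v := by
  -- With `ε = 1` the increments are at most `C + 1` times `h`, where `C` bounds the rate and `S ≤
  -- 1`.
  have hJc : ∀ y ∈ N, ContinuousOn (J y) (Icc a b) := by
    intro y hy
    obtain ⟨δ, hδ, h⟩ := hinc y hy 1 one_pos
    obtain ⟨C, hC⟩ := isCompact_Icc.exists_bound_of_continuousOn (hρ y hy)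
    refine continuousOn_of_increment_le (C := C + 1) hδ fun u k hu hk hkδ hub => ?_
    have hmem : u ∈ Icc a b := ⟨hu, by linarith⟩
    have h1 := h u k hu hk hkδ hub
    obtain ⟨h2, h3⟩ := hS0 u hmem
    have h4 := hC u hmem
    rw [Real.norm_eq_abs] at h4
    have h5 : |S u * (ρ y u * k)| ≤ C * k := by
      rw [abs_mul, abs_mul, abs_of_nonneg h2, abs_of_pos hk]
      calc S u * (|ρ y u| * k) ≤ 1 * (|ρ y u| * k) := by gcongr
        _ ≤ C * k := by rw [one_mul]; gcongr
    have h6 : S u * (1 * k) ≤ k := by nlinarith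
    have h7 := abs_add_le (J y (u + k) - J y u - S u * (ρ y u * k)) (S u * (ρ y u * k))
    rw [sub_add_cancel] at h7
    linarith
  have hSc : ContinuousOn S (Icc a b) :=
    (continuousOn_const.sub (continuousOn_finsetSum N hJc)).congr hS
  have hJd : ∀ y ∈ N, ∀ u ∈ Ico a b, HasDerivWithinAt (J y) (S u * ρ y u) (Ici u) u := by
    intro y hy u hu
    refine hasDerivWithinAt_Ici_of_increment hu.2 fun ε hε => ?_
    obtain ⟨δ, hδ, h⟩ := hinc y hy ε hε
    refine ⟨δ, hδ, fun k hk hkδ hub => ?_⟩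
    have h1 := h u k hu.1 hk hkδ hub
    obtain ⟨h2, h3⟩ := hS0 u ⟨hu.1, hu.2.le⟩
    rw [mul_assoc]
    refine h1.trans ?_
    have : 0 ≤ ε * k := by positivity
    nlinarith
  set q : ℝ → ℝ := fun w => ∑ y ∈ N, ρ y w with hq
  have hqc : ContinuousOn q (Icc a b) := continuousOn_finsetSum N hρ
  have hΛc := continuousOn_integral_Icc hqc
  have hSd : ∀ u ∈ Ioo a b, HasDerivWithinAt S (-(S u * q u)) (Ici u) u := by
    intro u hu
    have h1 := (HasDerivWithinAt.fun_sum fun y hy => hJd y hy u ⟨hu.1.le, hu.2⟩).const_sub 1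
    rw [← Finset.mul_sum] at h1
    refine h1.congr_of_eventuallyEq ?_ (hS u ⟨hu.1.le, hu.2.le⟩)
    filter_upwards [self_mem_nhdsWithin, nhdsWithin_le_nhds (Iio_mem_nhds hu.2)] with v hv hv'
    exact hS v ⟨hu.1.le.trans hv, le_of_lt hv'⟩
  have hSa : S a = 1 := by
    rw [hS a ⟨le_rfl, hab⟩, Finset.sum_eq_zero hJ0, sub_zero]
  -- Integrating factor: the product is continuous with vanishing right derivative, and it starts at
  -- `1`.
  have hconst : ∀ u ∈ Icc a b, S u * Real.exp (∫ w in a..u, q w) = 1 := by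
    intro u hu
    have hsub : Icc a u ⊆ Icc a b := Icc_subset_Icc_right hu.2
    have h := intervalIntegral.integral_eq_sub_of_hasDeriv_right_of_le hu.1
      (f := fun v => S v * Real.exp (∫ w in a..v, q w)) (f' := fun _ => 0)
      ((hSc.mul hΛc.rexp).mono hsub)
      (fun v hv => by
        have hv' : v ∈ Ioo a b := ⟨hv.1, hv.2.trans_le hu.2⟩
        have := (hSd v hv').fun_mul (hasDerivAt_integral_of_mem_Ioo hqc hv').exp.hasDerivWithinAt
        convert this.mono Ioi_subset_Ici_self using 1
        ring)
      intervalIntegrable_const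
    simp only [intervalIntegral.integral_same, Real.exp_zero, mul_one, hSa,
      intervalIntegral.integral_zero] at h
    linarith
  have hSe : ∀ u ∈ Icc a b, S u = Real.exp (-∫ w in a..u, q w) := by
    intro u hu
    rw [Real.exp_neg, ← mul_eq_one_iff_eq_inv₀ (Real.exp_ne_zero _)]
    exact hconst u hu
  refine ⟨hSe b ⟨hab, le_rfl⟩, fun y hy => ?_⟩
  -- With `S` known explicitly, the right derivative of `J y` is a continuous function and can be
  -- integrated.
  have h := intervalIntegral.integral_eq_sub_of_hasDeriv_right_of_le hab (f := J y)
    (f' := fun v => Real.exp (-∫ w in a..v, q w) * ρ y v) (hJc y hy)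
    (fun v hv => by
      rw [← hSe v ⟨hv.1.le, hv.2.le⟩]
      exact (hJd y hy v ⟨hv.1.le, hv.2⟩).mono Ioi_subset_Ici_self)
    (ContinuousOn.intervalIntegrable_of_Icc hab (hΛc.neg.rexp.mul (hρ y hy)))
  rw [h, hJ0 y hy, sub_zero]

/-- Uniform infinitesimal expansion of the jump probabilities. -/
theorem uniform_increment_of_continuousOn {q ρ : ℝ → ℝ} {a b c : ℝ} (hbc : b < c)
    (hq : ContinuousOn q (Icc a c)) (hρ : ContinuousOn ρ (Icc a c))
    (hq0 : ∀ u ∈ Icc a c, 0 ≤ q u) {ε : ℝ} (hε : 0 < ε) :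
    ∃ δ > 0, δ ≤ c - b ∧ ∀ u h, a ≤ u → u ≤ b → 0 < h → h < δ →
      |(∫ v in u..(u + h), Real.exp (-∫ w in u..v, q w) * ρ v) - ρ u * h| ≤ ε * h := by
  obtain ⟨C, hC⟩ := isCompact_Icc.exists_bound_of_continuousOn hq
  obtain ⟨D, hD⟩ := isCompact_Icc.exists_bound_of_continuousOn hρ
  have huc := isCompact_Icc.uniformContinuousOn_of_continuous hρ
  rw [Metric.uniformContinuousOn_iff] at huc
  obtain ⟨δ₁, hδ₁, h₁⟩ := huc (ε / 2) (by linarith)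
  -- The exponential differs from `1` by at most `|C| * h` and `ρ` is bounded by `|D|`; the summand
  -- `1` makes the division by `K` legitimate. The choice of `δ` below keeps `u + h` below `c`,
  -- makes `ρ` vary by less than `ε / 2`, and makes the error of the exponential at most `ε / 2`.
  set K : ℝ := |C| * |D| + 1 with hK
  have hK0 : 0 < K := by positivity
  refine ⟨min (c - b) (min δ₁ (ε / (2 * K))), by
    refine lt_min (by linarith) (lt_min hδ₁ (by positivity)), min_le_left _ _, ?_⟩
  intro u h hu hub hh hlt
  obtain ⟨l1, l2⟩ := lt_min_iff.mp hlt
  obtain ⟨l3, l4⟩ := lt_min_iff.mp l2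
  have hsub : Icc u (u + h) ⊆ Icc a c := Icc_subset_Icc hu (by linarith)
  have hle : u ≤ u + h := by linarith
  have hbound : ∀ v ∈ Icc u (u + h), ‖Real.exp (-∫ w in u..v, q w) * ρ v - ρ u‖ ≤ ε := by
    intro v hv
    have hsub' : Icc u v ⊆ Icc a c := (Icc_subset_Icc_right hv.2).trans hsub
    set Λ := ∫ w in u..v, q w
    have hΛ0 : 0 ≤ Λ := intervalIntegral.integral_nonneg hv.1 fun w hw => hq0 w (hsub' hw)
    have hΛ1 : Λ ≤ |C| * h := by
      have := intervalIntegral.norm_integral_le_of_norm_le_const (a := u) (b := v) (C := |C|) (f := q)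
        (fun w hw => by
          rw [uIoc_of_le hv.1] at hw
          exact (hC w (hsub' (Ioc_subset_Icc_self hw))).trans (le_abs_self C))
      rw [Real.norm_eq_abs, abs_of_nonneg hΛ0,
        abs_of_nonneg (show 0 ≤ v - u by linarith [hv.1])] at this
      refine this.trans ?_
      gcongr
      linarith [hv.2]
    have he1 : 1 - Λ ≤ Real.exp (-Λ) := by linarith [Real.add_one_le_exp (-Λ)]
    have he2 : Real.exp (-Λ) ≤ 1 := Real.exp_le_one_iff.mpr (by linarith)
    have hρv : |ρ v| ≤ |D| := (hD v (hsub hv)).trans (le_abs_self D)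
    have h2 : |ρ v - ρ u| < ε / 2 := by
      have := h₁ v (hsub hv) u (hsub ⟨le_rfl, hle⟩) (by
        rw [Real.dist_eq, abs_of_nonneg (by linarith [hv.1])]
        linarith [hv.2])
      rwa [Real.dist_eq] at this
    have h3 : |(Real.exp (-Λ) - 1) * ρ v| ≤ ε / 2 := by
      rw [abs_mul, abs_sub_comm, abs_of_nonneg (by linarith)]
      calc (1 - Real.exp (-Λ)) * |ρ v| ≤ (|C| * h) * |D| := by
            gcongr
            linarith
        _ = (|C| * |D|) * h := by ring
        _ ≤ K * h := by gcongr; linarith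
        _ ≤ K * (ε / (2 * K)) := by gcongr
        _ = ε / 2 := by field_simp
    rw [Real.norm_eq_abs]
    have h4 : Real.exp (-Λ) * ρ v - ρ u = (Real.exp (-Λ) - 1) * ρ v + (ρ v - ρ u) := by ring
    rw [h4]
    exact (abs_add_le _ _).trans (by linarith)
  have hint : IntervalIntegrable (fun v => Real.exp (-∫ w in u..v, q w) * ρ v) volume u (u + h) :=
    ContinuousOn.intervalIntegrable_of_Icc hle
      ((continuousOn_integral_Icc (hq.mono hsub)).neg.rexp.mul (hρ.mono hsub))
  have hc : ρ u * h = ∫ _ in u..(u + h), ρ u := by simp [mul_comm]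
  rw [hc, ← intervalIntegral.integral_sub hint intervalIntegrable_const]
  have := intervalIntegral.norm_integral_le_of_norm_le_const (a := u) (b := u + h) (C := ε)
    (f := fun v => Real.exp (-∫ w in u..v, q w) * ρ v - ρ u)
    (fun w hw => by
      rw [uIoc_of_le hle] at hw
      exact hbound w (Ioc_subset_Icc_self hw))
  rwa [Real.norm_eq_abs, add_sub_cancel_left, abs_of_pos hh] at this

end

section


variable {V : Type*} {G : SimpleGraph V} {T : InfPath G → ℝ≥0∞}
  {r : ℝ≥0 → V → V → InfPath G → ℝ≥0}

/-! ### Jump densities as real integrals -/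

theorem IsTerminatedRates.continuousOn_rate_real (hr : IsTerminatedRates T r) (y : V) {a c : ℝ≥0}
    {η : InfPath G} (hη : ∀ u, a ≤ u → η u = η a) (hc : (c : ℝ≥0∞) < T η) :
    ContinuousOn (fun v : ℝ => (rate T r y v.toNNReal η : ℝ)) (Icc (a : ℝ) c) := by
  have h := (hr.continuousOn_rate y hη).comp (s := Icc (a : ℝ) c) (f := Real.toNNReal)
    continuous_real_toNNReal.continuousOn fun v hv => by
      refine ⟨NNReal.le_toNNReal_of_coe_le hv.1, lt_of_le_of_lt ?_ hc⟩
      exact_mod_cast Real.toNNReal_le_iff_le_coe.mpr hv.2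
  exact NNReal.continuous_coe.comp_continuousOn h

theorem toNNReal_mem_Ioc {b c : ℝ≥0} {v : ℝ} (hv : v ∈ Ioc (b : ℝ) c) :
    v.toNNReal ∈ Ioc b c :=
  ⟨Real.lt_toNNReal_iff_coe_lt.mpr hv.1, Real.toNNReal_le_iff_le_coe.mpr hv.2⟩

theorem setLIntegral_ofReal_eq {f : ℝ → ℝ} {g : ℝ → ℝ≥0∞} {b c : ℝ} (hbc : b ≤ c)
    (hf : ContinuousOn f (Icc b c)) (hf0 : ∀ v ∈ Ioc b c, 0 ≤ f v)
    (hg : ∀ v ∈ Ioc b c, g v = ENNReal.ofReal (f v)) :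
    ∫⁻ v in Ioc b c, g v = ENNReal.ofReal (∫ v in b..c, f v) := by
  rw [setLIntegral_congr_fun measurableSet_Ioc hg, intervalIntegral.integral_of_le hbc,
    ofReal_integral_eq_lintegral_ofReal (hf.integrableOn_Icc.mono_set Ioc_subset_Icc_self)]
  exact (ae_restrict_iff' measurableSet_Ioc).mpr (ae_of_all _ hf0)

/-- The total rate of a path that stays at `η_a`, as a function of real time. -/
def totalRateReal [G.LocallyFinite] (T : InfPath G → ℝ≥0∞)
    (r : ℝ≥0 → V → V → InfPath G → ℝ≥0) (a : ℝ≥0) (η : InfPath G) (v : ℝ) : ℝ :=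
  ∑ y ∈ G.neighborFinset (η a), (rate T r y v.toNNReal η : ℝ)

theorem jumpDensity_of_not_adj {y : V} {a v : ℝ≥0} {η : InfPath G}
    (hη : ∀ u, a ≤ u → η u = η a) (hy : ¬ G.Adj (η a) y) : jumpDensity T r y a η v = 0 := by
  unfold jumpDensity
  split_ifs with h
  · rw [rate_of_not_adj (by rwa [hη v h.le])]
    simp
  · rfl

section

variable [G.LocallyFinite]

theorem totalRateReal_nonneg (a : ℝ≥0) (η : InfPath G) (v : ℝ) : 0 ≤ totalRateReal T r a η v :=
  Finset.sum_nonneg fun _ _ => NNReal.coe_nonneg _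

theorem totalRate_eq_ofReal {a : ℝ≥0} {η : InfPath G} {v : ℝ} (h : η v.toNNReal = η a) :
    totalRate T r v.toNNReal η = ENNReal.ofReal (totalRateReal T r a η v) := by
  rw [totalRate_eq_sum, h, totalRateReal, ← NNReal.coe_sum, ENNReal.ofReal_coe_nnreal]

variable {a b c : ℝ≥0} {η : InfPath G}

theorem IsTerminatedRates.continuousOn_totalRateReal (hr : IsTerminatedRates T r)
    (hη : ∀ u, a ≤ u → η u = η a) (hc : (c : ℝ≥0∞) < T η) :
    ContinuousOn (totalRateReal T r a η) (Icc (a : ℝ) c) :=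
  continuousOn_finsetSum _ fun y _ => hr.continuousOn_rate_real y hη hc

theorem IsTerminatedRates.cumRate_eq (hr : IsTerminatedRates T r)
    (hη : ∀ u, a ≤ u → η u = η a) (hab : a ≤ b) (hbc : b ≤ c) (hc : (c : ℝ≥0∞) < T η) :
    cumRate T r η b c = ENNReal.ofReal (∫ v in (b : ℝ)..c, totalRateReal T r a η v) := by
  refine setLIntegral_ofReal_eq (by exact_mod_cast hbc)
    ((hr.continuousOn_totalRateReal hη hc).mono (Icc_subset_Icc_left (by exact_mod_cast hab)))
    (fun v _ => totalRateReal_nonneg a η v) fun v hv => totalRate_eq_ofReal (hη _ ?_)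
  exact hab.trans (toNNReal_mem_Ioc hv).1.le

theorem IsTerminatedRates.cumRate_ne_top (hr : IsTerminatedRates T r)
    (hη : ∀ u, a ≤ u → η u = η a) (hac : a ≤ c) (hc : (c : ℝ≥0∞) < T η) :
    cumRate T r η a c ≠ ⊤ := by
  rw [hr.cumRate_eq hη le_rfl hac hc]
  exact ENNReal.ofReal_ne_top

theorem IsTerminatedRates.expNeg_cumRate_eq (hr : IsTerminatedRates T r)
    (hη : ∀ u, a ≤ u → η u = η a) (hac : a ≤ c) (hc : (c : ℝ≥0∞) < T η) :
    expNeg (cumRate T r η a c) =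
      ENNReal.ofReal (Real.exp (-∫ v in (a : ℝ)..c, totalRateReal T r a η v)) := by
  rw [hr.cumRate_eq hη le_rfl hac hc, expNeg_ofReal]
  exact intervalIntegral.integral_nonneg (by exact_mod_cast hac)
    fun v _ => totalRateReal_nonneg a η v

theorem IsTerminatedRates.setLIntegral_jumpDensity_eq (hr : IsTerminatedRates T r) (y : V)
    (hη : ∀ u, a ≤ u → η u = η a) (hab : a ≤ b) (hbc : b ≤ c) (hc : (c : ℝ≥0∞) < T η) :
    ∫⁻ v in Ioc (b : ℝ) c, jumpDensity T r y a η v.toNNReal =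
      ENNReal.ofReal (∫ v in (b : ℝ)..c,
        Real.exp (-∫ w in (a : ℝ)..v, totalRateReal T r a η w) * rate T r y v.toNNReal η) := by
  have hsub : Icc (b : ℝ) c ⊆ Icc (a : ℝ) c := Icc_subset_Icc_left (by exact_mod_cast hab)
  refine setLIntegral_ofReal_eq (by exact_mod_cast hbc) ?_
    (fun v _ => by positivity) fun v hv => ?_
  · exact ((continuousOn_integral_Icc (hr.continuousOn_totalRateReal hη hc)).mono hsub).neg.rexp.mul
      ((hr.continuousOn_rate_real y hη hc).mono hsub)
  · have hv' := toNNReal_mem_Ioc hv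
    have hcv : (v.toNNReal : ℝ≥0∞) < T η := lt_of_le_of_lt (by exact_mod_cast hv'.2) hc
    rw [jumpDensity_of_lt (hab.trans_lt hv'.1),
      hr.expNeg_cumRate_eq hη (hab.trans hv'.1.le) hcv,
      Real.coe_toNNReal v ((NNReal.coe_nonneg b).trans hv.1.le),
      ENNReal.ofReal_mul (Real.exp_nonneg _), ENNReal.ofReal_coe_nnreal]

/-- The probability of having jumped by time `c`. -/
theorem IsTerminatedRates.tsum_setLIntegral_jumpDensity (hr : IsTerminatedRates T r)
    (hη : ∀ u, a ≤ u → η u = η a) (hac : a ≤ c) (hc : (c : ℝ≥0∞) < T η) :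
    ∑' y, ∫⁻ v in Ioc (a : ℝ) c, jumpDensity T r y a η v.toNNReal =
      1 - expNeg (cumRate T r η a c) := by
  have hac' : (a : ℝ) ≤ c := by exact_mod_cast hac
  have hqc := hr.continuousOn_totalRateReal hη hc
  have hc0 := continuousOn_integral_Icc hqc
  rw [tsum_eq_sum (s := G.neighborFinset (η a)) fun y hy => by
    simp [jumpDensity_of_not_adj hη (show ¬ G.Adj (η a) y by simpa using hy)]]
  rw [Finset.sum_congr rfl fun y _ => hr.setLIntegral_jumpDensity_eq y hη le_rfl hac hc,
    ← ENNReal.ofReal_sum_of_nonneg fun y _ =>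
      intervalIntegral.integral_nonneg hac' fun v _ => by positivity,
    ← intervalIntegral.integral_finsetSum fun y _ => ContinuousOn.intervalIntegrable_of_Icc hac'
      (show ContinuousOn (fun v : ℝ => Real.exp (-∫ w in (a : ℝ)..v, totalRateReal T r a η w) *
        (rate T r y v.toNNReal η : ℝ)) _ from
          hc0.neg.rexp.mul (hr.continuousOn_rate_real y hη hc))]
  simp_rw [← Finset.mul_sum]
  have := integral_exp_neg_mul hac' hqc
  simp only [totalRateReal] at this ⊢
  rw [this, hr.expNeg_cumRate_eq hη hac hc, ENNReal.ofReal_sub _ (Real.exp_nonneg _),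
    ENNReal.ofReal_one]
  rfl

/-- Up to a time `c < T η` the mass is `1 - exp (-Λ)`. The density vanishes outside `(a, T η)`, so
monotone convergence along times increasing to `T η` gives the bound; the missing mass is the
probability of no jump before termination. -/
theorem IsTerminatedRates.tsum_lintegral_jumpDensity_le [Countable V] (hr : IsTerminatedRates T r)
    (hη : ∀ u, a ≤ u → η u = η a) :
    ∑' y, ∫⁻ v : ℝ, jumpDensity T r y a η v.toNNReal ≤ 1 := by
  have hm : ∀ y, Measurable fun v : ℝ => jumpDensity T r y a η v.toNNReal := fun y => by
    have h : Measurable fun v : ℝ => ((a, η), v.toNNReal) :=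
      measurable_const.prodMk measurable_real_toNNReal
    exact (hr.measurable_jumpDensity y).comp h
  rw [← lintegral_tsum fun y => (hm y).aemeasurable]
  set g : ℝ → ℝ≥0∞ := fun v => ∑' y, jumpDensity T r y a η v.toNNReal with hg
  have hzero : ∀ v : ℝ, ¬ ((a : ℝ) < v ∧ (v.toNNReal : ℝ≥0∞) < T η) → g v = 0 := by
    intro v hv
    refine ENNReal.tsum_eq_zero.mpr fun y => ?_
    unfold jumpDensity
    split_ifs with h
    · rw [rate_of_not_lt fun h' => hv ⟨Real.lt_toNNReal_iff_coe_lt.mp h, h'⟩]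
      simp
    · rfl
  rcases le_or_gt (T η) a with hT | hT
  · have : ∀ v, g v = 0 := fun v => hzero v fun h =>
      absurd (h.2.trans_le hT) (not_lt.mpr (by
        exact_mod_cast (Real.lt_toNNReal_iff_coe_lt.mpr h.1).le))
    rw [lintegral_congr this, lintegral_zero]
    exact zero_le_one
  obtain ⟨u, hu, huT, hlim⟩ := exists_seq_strictMono_tendsto' hT
  have hutop : ∀ n, u n ≠ ⊤ := fun n => ne_top_of_lt (huT n).2
  let s : ℕ → Set ℝ := fun n => Ioc (a : ℝ) (u n).toNNReal
  have hs : Monotone s := fun m n hmn => Ioc_subset_Ioc_right (by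
    exact_mod_cast ENNReal.toNNReal_mono (hutop n) (hu.monotone hmn))
  have hcover : ∫⁻ v, g v = ∫⁻ v in ⋃ n, s n, g v := by
    rw [← lintegral_indicator (.iUnion fun n => measurableSet_Ioc)]
    congr 1
    ext v
    by_cases hv : (a : ℝ) < v ∧ (v.toNNReal : ℝ≥0∞) < T η
    · obtain ⟨n, hn⟩ := (hlim.eventually_const_lt hv.2).exists
      rw [indicator_of_mem]
      refine mem_iUnion.mpr ⟨n, hv.1, Real.toNNReal_le_iff_le_coe.mp ?_⟩
      have := ENNReal.toNNReal_mono (hutop n) hn.le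
      simpa using this
    · have h0 := hzero v hv
      by_cases hmem : v ∈ ⋃ n, s n
      · rw [indicator_of_mem hmem]
      · rw [indicator_of_notMem hmem, h0]
  rw [hcover, setLIntegral_iUnion_of_directed _ hs.directed_le]
  refine iSup_le fun n => ?_
  have han : a ≤ (u n).toNNReal := by
    have := ENNReal.toNNReal_mono (hutop n) (huT n).1.le
    simpa using this
  have hnT : (((u n).toNNReal : ℝ≥0) : ℝ≥0∞) < T η := by
    rw [ENNReal.coe_toNNReal (hutop n)]
    exact (huT n).2
  change ∫⁻ v in Ioc (a : ℝ) (u n).toNNReal, g v ≤ 1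
  rw [hg, lintegral_tsum fun y => (hm y).aemeasurable,
    hr.tsum_setLIntegral_jumpDensity hη han hnT]
  exact tsub_le_self

end

end

section


variable {V : Type*} {G : SimpleGraph V} {T : InfPath G → ℝ≥0∞}
  {r : ℝ≥0 → V → V → InfPath G → ℝ≥0}

/-! ### The one-step Markov property at deterministic times -/

theorem measurableSet_nextJump_state [Countable V] (g c : ℝ≥0) (z : Option V) :
    MeasurableSet {ω : Path G | ω.nextJump g ≤ c ∧ ω (ω.nextJump g).toNNReal = z} := by
  have h1 := Path.measurable_nextJump (G := G) g
  have h2 : Measurable fun ω : Path G => ((ω.nextJump g).toNNReal, ω) :=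
    h1.ennreal_toNNReal.prodMk measurable_id
  have h3 := (Path.measurable_eval_prod (G := G)).comp h2
  exact (h1 measurableSet_Iic).inter (h3 (MeasurableSet.of_discrete (s := {z})))

theorem measurableSet_lt_nextJump [Countable V] (g c : ℝ≥0) :
    MeasurableSet {ω : Path G | (c : ℝ≥0∞) < ω.nextJump g} :=
  Path.measurable_nextJump g measurableSet_Ioi

theorem stays_eq {x : V} {g u : ℝ≥0} (hgu : g ≤ u) :
    stays G x g u = {ω | ω g = some x} ∩ {ω | (u : ℝ≥0∞) < ω.nextJump g} := by
  ext ω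
  simp only [stays, mem_ofPred_eq, mem_inter_iff, Path.lt_nextJump_iff]
  constructor
  · intro h
    exact ⟨h g le_rfl hgu, fun v hv hv' => by rw [h v hv hv', h g le_rfl hgu]⟩
  · rintro ⟨h, h'⟩ v hv hv'
    rw [h' v hv hv', h]

/-- The first jump after `g` happens by time `u` and leads from `x` to `y`. -/
def jumpBy (G : SimpleGraph V) (x y : V) (g u : ℝ≥0) : Set (Path G) :=
  {ω | ω g = some x} ∩ {ω | ω.nextJump g ≤ u ∧ ω (ω.nextJump g).toNNReal = some y}

theorem measurableSet_jumpBy [Countable V] (x y : V) (g u : ℝ≥0) :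
    MeasurableSet (jumpBy G x y g u) :=
  (Path.measurable_eval g (MeasurableSet.of_discrete (s := {some x}))).inter
    (measurableSet_nextJump_state g _ _)

theorem jumpBy_mono (x y : V) (g : ℝ≥0) {u u' : ℝ≥0} (h : u ≤ u') :
    jumpBy G x y g u ⊆ jumpBy G x y g u' := fun _ hω =>
  ⟨hω.1, hω.2.1.trans (by exact_mod_cast h), hω.2.2⟩

/-- The probability in the definition of the rates becomes an increment of the increasing function
`u ↦ μ (jumpBy G x y g u)`, to which calculus applies. -/
theorem firstJump_eq {x y : V} (hxy : G.Adj x y) {g u : ℝ≥0} (hgu : g ≤ u) (h : ℝ≥0) :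
    firstJump G x y g u h = jumpBy G x y g (u + h) \ jumpBy G x y g u := by
  ext ω
  constructor
  · rintro ⟨τ, h1, h2, h3, h4⟩
    have hg : ω g = some x := h3 g le_rfl (hgu.trans_lt h1)
    have hn : ω.nextJump g = τ := Path.nextJump_eq_coe_iff.mpr ⟨hgu.trans_lt h1, fun v hv hv' => by
      rw [h3 v hv hv', hg], by
        rw [h4, hg]
        exact fun hc => hxy.ne (Option.some_injective _ hc).symm⟩
    refine ⟨⟨hg, ?_, ?_⟩, fun hc => ?_⟩
    · rw [hn]
      exact_mod_cast h2
    · rw [hn]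
      exact h4
    · have : ω.nextJump g ≤ (u : ℝ≥0∞) := hc.2.1
      rw [hn] at this
      exact absurd h1 (not_lt.mpr (by exact_mod_cast this))
  · rintro ⟨⟨hg, h1, h2⟩, h3⟩
    have h1' : ω.nextJump g ≤ ((u + h : ℝ≥0) : ℝ≥0∞) := h1
    have h3' : (u : ℝ≥0∞) < ω.nextJump g := by
      by_contra hc
      exact h3 ⟨hg, not_lt.mp hc, h2⟩
    lift ω.nextJump g to ℝ≥0 using ne_top_of_le_ne_top ENNReal.coe_ne_top h1' with τ hτ
    obtain ⟨-, h5, -⟩ := Path.nextJump_eq_coe_iff.mp hτ.symm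
    exact ⟨τ, by exact_mod_cast h3', by exact_mod_cast h1', fun v hv hv' => by rw [h5 v hv hv', hg],
      by simpa using h2⟩

/-- Before its next jump the path is constant, so a death at that moment would be a death with a
left limit in `V`. -/
theorem DiesOnlyByExplosion.state_ne_none {ω : Path G} (h : DiesOnlyByExplosion ω) {g τ : ℝ≥0}
    (hg : ω g ≠ none) (hτ : ω.nextJump g = τ) : ω τ ≠ none := by
  intro hn
  obtain ⟨x, hx⟩ := Option.ne_none_iff_exists'.mp hg
  obtain ⟨h1, h2, -⟩ := Path.nextJump_eq_coe_iff.mp hτ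
  refine h τ hn x ?_
  filter_upwards [self_mem_nhdsWithin, nhdsWithin_le_nhds (Ioi_mem_nhds h1)] with s hs hs'
  rw [h2 s (le_of_lt hs') hs, hx]

section CondLaw

variable {Q : Measure (Path G)} {κ : Path G → Measure (Path G)} {g : ℝ≥0}

theorem IsCondLaw.measurable (h : IsCondLaw g Q κ) {A : Set (Path G)} (hA : MeasurableSet A) :
    Measurable fun ω => κ ω A :=
  (h.meas A hA).mono (Path.filt_le g) le_rfl

/-- What is known at time `g` stays known under the conditional law: test the disintegration with
`A` against its complement. -/
theorem IsCondLaw.ae_compl_eq_zero (h : IsCondLaw g Q κ) {A : Set (Path G)}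
    (hA : MeasurableSet[Path.filt G g] A) : ∀ᵐ ω ∂Q, ω ∈ A → κ ω Aᶜ = 0 := by
  have hA' := Path.filt_le g _ hA
  have h1 := h.disint Aᶜ A hA'.compl hA
  rw [inter_compl_self, measure_empty, eq_comm, lintegral_eq_zero_iff (h.measurable hA'.compl)] at h1
  exact (ae_restrict_iff' hA').mp h1

/-- The disintegration is applied to a measurable hull of the exceptional set, as `p` need not be
measurable. -/
theorem IsCondLaw.ae_ae (h : IsCondLaw g Q κ) {p : Path G → Prop} (hp : ∀ᵐ ω ∂Q, p ω) :
    ∀ᵐ ω ∂Q, ∀ᵐ ω' ∂κ ω, p ω' := by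
  have hm := measurableSet_toMeasurable Q {ω | ¬ p ω}
  have h1 := h.disint _ univ hm (@MeasurableSet.univ _ (Path.filt G g))
  rw [univ_inter, measure_toMeasurable, Measure.restrict_univ, show Q {ω | ¬ p ω} = 0 from hp,
    eq_comm, lintegral_eq_zero_iff (h.measurable hm)] at h1
  filter_upwards [h1] with ω hω
  exact measure_mono_null (subset_toMeasurable Q _) hω

end CondLaw

/-- The law of the first jump after a time `g`, for a path alive at `g`, given the path up to `g`. -/
structure HasOneStepLaw (T : InfPath G → ℝ≥0∞) (r : ℝ≥0 → V → V → InfPath G → ℝ≥0) (x₀ : V)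
    (Q : Measure (Path G)) : Prop where
  survive : ∀ g c : ℝ≥0, g ≤ c → ∀ B : Set (Path G), MeasurableSet[Path.filt G g] B →
    (∀ ω ∈ B, ω g ≠ none ∧ (c : ℝ≥0∞) < T (ω.freeze x₀ g)) →
      Q (B ∩ {ω | (c : ℝ≥0∞) < ω.nextJump g}) =
        ∫⁻ ω in B, expNeg (cumRate T r (ω.freeze x₀ g) g c) ∂Q
  jump : ∀ g c : ℝ≥0, g ≤ c → ∀ B : Set (Path G), MeasurableSet[Path.filt G g] B →
    (∀ ω ∈ B, ω g ≠ none ∧ (c : ℝ≥0∞) < T (ω.freeze x₀ g)) → ∀ y : V,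
      Q (B ∩ {ω | ω.nextJump g ≤ c ∧ ω (ω.nextJump g).toNNReal = some y}) =
        ∫⁻ ω in B, (∫⁻ v in Ioc (g : ℝ) c, jumpDensity T r y g (ω.freeze x₀ g) v.toNNReal) ∂Q

/-- Integrating the infinitesimal description of the first jump after `g`. -/
theorem law_of_increments [Countable V] [G.LocallyFinite] (hr : IsTerminatedRates T r)
    {μ : Measure (Path G)} [IsProbabilityMeasure μ] {η : InfPath G} {g c : ℝ≥0} (hgc : g ≤ c)
    (hη : ∀ u, g ≤ u → η u = η g) (hc : (c : ℝ≥0∞) < T η)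
    (hx : ∀ᵐ ω ∂μ, ω g = some (η g)) (hd : ∀ᵐ ω ∂μ, DiesOnlyByExplosion ω)
    (hinc : ∀ y, G.Adj (η g) y → ∀ ε : ℝ, 0 < ε → ∃ δ : ℝ≥0, 0 < δ ∧ ∀ u h : ℝ≥0, g ≤ u → u ≤ c →
      0 < h → h < δ → |μ.real (firstJump G (η g) y g u h)
        - μ.real (stays G (η g) g u) * (r u (η g) y η * h)|
          ≤ μ.real (stays G (η g) g u) * (ε * h)) :
    μ {ω | (c : ℝ≥0∞) < ω.nextJump g} = expNeg (cumRate T r η g c) ∧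
    ∀ y, μ {ω | ω.nextJump g ≤ c ∧ ω (ω.nextJump g).toNNReal = some y} =
      ∫⁻ v in Ioc (g : ℝ) c, jumpDensity T r y g η v.toNNReal := by
  set x := η g with hxdef
  have hgc' : (g : ℝ) ≤ c := by exact_mod_cast hgc
  set N := G.neighborFinset x with hN
  let J : V → ℝ → ℝ := fun y u => μ.real (jumpBy G x y g u.toNNReal)
  let S : ℝ → ℝ := fun u => μ.real (stays G x g u.toNNReal)
  have hgu : ∀ u ∈ Icc (g : ℝ) c, g ≤ u.toNNReal ∧ u.toNNReal ≤ c := fun u hu =>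
    ⟨NNReal.le_toNNReal_of_coe_le hu.1, Real.toNNReal_le_iff_le_coe.mpr hu.2⟩
  have hstays : ∀ u, g ≤ u → MeasurableSet (stays G x g u) := fun u hu => by
    rw [stays_eq hu]
    exact (Path.measurable_eval g (MeasurableSet.of_discrete (s := {some x}))).inter
      (Path.measurable_nextJump g measurableSet_Ioi)
  have key := survival_of_increments (N := N) (ρ := fun y v => (rate T r y v.toNNReal η : ℝ))
    (J := J) (S := S) hgc' (fun y _ => hr.continuousOn_rate_real y hη hc) ?_
    (fun u _ => ⟨measureReal_nonneg, measureReal_le_one⟩) ?_ ?_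
  · obtain ⟨h1, h2⟩ := key
    have hq : ∀ w, ∑ y ∈ N, (rate T r y w.toNNReal η : ℝ) = totalRateReal T r g η w := fun _ => rfl
    simp only [hq] at h1 h2
    constructor
    · have : μ {ω | (c : ℝ≥0∞) < ω.nextJump g} = μ (stays G x g c) := by
        rw [stays_eq hgc]
        refine measure_congr (eventuallyEq_set.mpr ?_)
        filter_upwards [hx] with ω hω
        exact ⟨fun h => ⟨hω, h⟩, fun h => h.2⟩
      rw [this, hr.expNeg_cumRate_eq hη hgc hc, ← h1]
      simp [S, ofReal_measureReal]
    · intro y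
      have : μ {ω | ω.nextJump g ≤ c ∧ ω (ω.nextJump g).toNNReal = some y} =
          μ (jumpBy G x y g c) := by
        refine measure_congr (eventuallyEq_set.mpr ?_)
        filter_upwards [hx] with ω hω
        exact ⟨fun h => ⟨hω, h⟩, fun h => h.2⟩
      rw [this]
      by_cases hy : G.Adj x y
      · have h3 := h2 y (by simpa [hN] using hy)
        rw [hr.setLIntegral_jumpDensity_eq y hη le_rfl hgc hc, ← h3]
        simp [J, ofReal_measureReal]
      · have : jumpBy G x y g c = ∅ := by
          ext ω
          simp only [mem_empty_iff_false, iff_false]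
          rintro ⟨h3, h4, h5⟩
          have h4' : ω.nextJump g ≤ c := h4
          lift ω.nextJump g to ℝ≥0 using ne_top_of_le_ne_top ENNReal.coe_ne_top h4' with τ hτ
          exact hy (Path.adj_of_nextJump hτ.symm h3 (by simpa using h5))
        rw [this, measure_empty]
        simp [jumpDensity_of_not_adj hη hy]
  · intro u hu
    obtain ⟨hu1, hu2⟩ := hgu u hu
    -- Almost surely the path has stayed put or has jumped to a neighbour; a first move into the
    -- cemetery is excluded. This is the relation `S = 1 - ∑ J y`.
    have hae : ((stays G x g u.toNNReal ∪ ⋃ y ∈ N, jumpBy G x y g u.toNNReal : Set (Path G)))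
        =ᵐ[μ] (univ : Set (Path G)) := by
      refine eventuallyEq_univ.mpr ?_
      filter_upwards [hx, hd] with ω hω hdω
      rcases lt_or_ge (u.toNNReal : ℝ≥0∞) (ω.nextJump g) with hlt | hle
      · left
        rw [stays_eq hu1]
        exact ⟨hω, hlt⟩
      · right
        have hτ := ENNReal.coe_toNNReal (ne_top_of_le_ne_top ENNReal.coe_ne_top hle)
        obtain ⟨y, hy⟩ := Option.ne_none_iff_exists'.mp
          (hdω.state_ne_none (by simp [hω]) hτ.symm)
        refine mem_iUnion₂.mpr ⟨y, ?_, hω, hle, hy⟩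
        simpa [hN] using Path.adj_of_nextJump hτ.symm hω hy
    have h1 : μ.real (stays G x g u.toNNReal ∪ ⋃ y ∈ N, jumpBy G x y g u.toNNReal) = 1 := by
      rw [measureReal_congr hae, probReal_univ]
    rw [measureReal_union ?_ (N.measurableSet_biUnion fun y _ => measurableSet_jumpBy x y g _)
        (measure_ne_top μ _) (measure_ne_top μ _),
      measureReal_biUnion_finset (by
        intro y _ y' _ hne
        refine Set.disjoint_left.mpr fun ω h h' => hne ?_
        exact Option.some_injective _ (h.2.2.symm.trans h'.2.2)) fun y _ => measurableSet_jumpBy x y g _] at h1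
    · simp only [J, S]
      linarith
    · rw [stays_eq hu1]
      refine Set.disjoint_left.mpr fun ω h h' => ?_
      obtain ⟨y, -, h'⟩ := mem_iUnion₂.mp h'
      exact not_lt.mpr h'.2.1 h.2
  · intro y _
    have : jumpBy G x y g g = ∅ := by
      ext ω
      simp only [mem_empty_iff_false, iff_false]
      exact fun h => absurd (ω.lt_nextJump g) (not_lt.mpr h.2.1)
    simp [J, this]
  · intro y hy ε hε
    have hy' : G.Adj x y := by simpa [hN] using hy
    obtain ⟨δ, hδ, h⟩ := hinc y hy' ε hε
    refine ⟨δ, by exact_mod_cast hδ, fun u k hu hk hkδ hub => ?_⟩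
    have hu0 : 0 ≤ u := (NNReal.coe_nonneg g).trans hu
    obtain ⟨hu1, hu2⟩ := hgu u ⟨hu, by linarith⟩
    have h1 := h u.toNNReal k.toNNReal hu1 hu2 (Real.toNNReal_pos.mpr hk)
      (by rwa [Real.toNNReal_lt_iff_lt_coe hk.le])
    rw [firstJump_eq hy' hu1, measureReal_sdiff (jumpBy_mono _ _ _ le_self_add)
      (measurableSet_jumpBy _ _ _ _), ← Real.toNNReal_add hu0 hk.le, Real.coe_toNNReal k hk.le] at h1
    have hrate : rate T r y u.toNNReal η = r u.toNNReal x y η := by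
      rw [rate_of_lt (lt_of_le_of_lt (by exact_mod_cast hu2) hc), hη _ hu1]
      rwa [hη _ hu1]
    simp only [J, S, hrate]
    exact h1

/-- Almost every conditional law at `g` sits at the current state, dies only by explosion and has
the infinitesimal rates of the frozen path. So `law_of_increments` computes it, and the result is
integrated over events of `ℱ_g`. -/
theorem EvolvesWithRates.hasOneStepLaw [Countable V] [G.LocallyFinite]
    (hr : IsTerminatedRates T r) (x₀ : V) {Q : Measure (Path G)}
    (hd : ∀ᵐ ω ∂Q, DiesOnlyByExplosion ω) (h : EvolvesWithRates T r Q) :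
    HasOneStepLaw T r x₀ Q := by
  have key : ∀ g : ℝ≥0, ∃ κ : Path G → Measure (Path G), IsCondLaw g Q κ ∧ ∀ᵐ ω ∂Q, ω g ≠ none →
      ∀ c : ℝ≥0, g ≤ c → (c : ℝ≥0∞) < T (ω.freeze x₀ g) →
        κ ω {ω | (c : ℝ≥0∞) < ω.nextJump g} = expNeg (cumRate T r (ω.freeze x₀ g) g c) ∧
        ∀ y, κ ω {ω | ω.nextJump g ≤ c ∧ ω (ω.nextJump g).toNNReal = some y} =
          ∫⁻ v in Ioc (g : ℝ) c, jumpDensity T r y g (ω.freeze x₀ g) v.toNNReal := by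
    intro g
    obtain ⟨κ, hκ, hae⟩ := h g
    refine ⟨κ, hκ, ?_⟩
    -- Countability of `V` gives a common null set for all states.
    have h1 : ∀ᵐ ω ∂Q, ∀ x : V, ω g = some x → κ ω {ω' | ω' g = some x}ᶜ = 0 :=
      ae_all_iff.mpr fun x =>
        hκ.ae_compl_eq_zero (Path.measurableSet_filt_eval le_rfl ({some x} : Set (Option V)))
    filter_upwards [hae, h1, hκ.ae_ae hd] with ω hω h1ω hdω hg c hgc hc
    have := hκ.prob ω
    refine law_of_increments hr hgc (fun u hu => Path.freeze_const x₀ g ω hu) hc ?_ hdω ?_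
    · exact h1ω _ (Path.freeze_of_le hg le_rfl).symm
    · intro y hy ε hε
      exact hω _ (Path.isFrozen_freeze hg) (lt_of_le_of_lt (by exact_mod_cast hgc) hc) y hy c hgc hc
        ε hε
  constructor
  · intro g c hgc B hB hBc
    obtain ⟨κ, hκ, hae⟩ := key g
    rw [hκ.disint _ B (measurableSet_lt_nextJump g c) hB]
    refine setLIntegral_congr_fun_ae (Path.filt_le g _ hB) ?_
    filter_upwards [hae] with ω hω hωB
    exact (hω (hBc ω hωB).1 c hgc (hBc ω hωB).2).1
  · intro g c hgc B hB hBc y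
    obtain ⟨κ, hκ, hae⟩ := key g
    rw [hκ.disint _ B (measurableSet_nextJump_state g _ _) hB]
    refine setLIntegral_congr_fun_ae (Path.filt_le g _ hB) ?_
    filter_upwards [hae] with ω hω hωB
    exact (hω (hBc ω hωB).1 c hgc (hBc ω hωB).2).2 y

end

section


variable {V : Type*} {G : SimpleGraph V} {T : InfPath G → ℝ≥0∞}
  {r : ℝ≥0 → V → V → InfPath G → ℝ≥0}

/-! ### Continuity of the one-step law in the initial time -/

theorem tendsto_integral_left {h : ℝ → ℝ} {a c : ℝ≥0} (hac : a < c)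
    (hh : ContinuousOn h (Icc (a : ℝ) c)) :
    Tendsto (fun g : ℝ≥0 => ∫ v in (g : ℝ)..c, h v) (𝓝[>] a) (𝓝 (∫ v in (a : ℝ)..c, h v)) ∧
    Tendsto (fun g : ℝ≥0 => ∫ v in (a : ℝ)..g, h v) (𝓝[>] a) (𝓝 0) := by
  have hac' : (a : ℝ) ≤ c := by exact_mod_cast hac.le
  have hcoe : Tendsto (fun g : ℝ≥0 => (g : ℝ)) (𝓝[>] a) (𝓝[Icc (a : ℝ) c] (a : ℝ)) := by
    refine tendsto_nhdsWithin_iff.mpr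
      ⟨(NNReal.continuous_coe.tendsto a).mono_left nhdsWithin_le_nhds, ?_⟩
    filter_upwards [self_mem_nhdsWithin, nhdsWithin_le_nhds (Iio_mem_nhds hac)] with g hg hg'
    exact ⟨by exact_mod_cast (le_of_lt hg), by exact_mod_cast (le_of_lt hg')⟩
  have h1 := ((continuousOn_integral_Icc hh) a ⟨le_rfl, hac'⟩).tendsto.comp hcoe
  rw [intervalIntegral.integral_same] at h1
  refine ⟨?_, h1⟩
  have h2 := h1.const_sub (∫ v in (a : ℝ)..c, h v)
  rw [sub_zero] at h2
  refine h2.congr' ?_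
  filter_upwards [self_mem_nhdsWithin, nhdsWithin_le_nhds (Iio_mem_nhds hac)] with g hg hg'
  have e1 : (a : ℝ) ≤ g := by exact_mod_cast (le_of_lt hg)
  have e2 : (g : ℝ) ≤ c := by exact_mod_cast (le_of_lt hg')
  have := intervalIntegral.integral_add_adjacent_intervals (μ := volume)
    ((hh.mono (Icc_subset_Icc_right e2)).intervalIntegrable_of_Icc e1)
    ((hh.mono (Icc_subset_Icc_left e1)).intervalIntegrable_of_Icc e2)
  simp only [Function.comp]
  linarith

section

variable [G.LocallyFinite] {a c : ℝ≥0} {η : InfPath G}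

theorem IsTerminatedRates.tendsto_expNeg_cumRate (hr : IsTerminatedRates T r)
    (hη : ∀ u, a ≤ u → η u = η a) (hac : a < c) (hc : (c : ℝ≥0∞) < T η) :
    Tendsto (fun g => expNeg (cumRate T r η g c)) (𝓝[>] a) (𝓝 (expNeg (cumRate T r η a c))) := by
  have h := (tendsto_integral_left hac (hr.continuousOn_totalRateReal hη hc)).1
  have h2 := ENNReal.tendsto_ofReal h.neg.rexp
  rw [hr.expNeg_cumRate_eq hη hac.le hc]
  refine h2.congr' ?_
  filter_upwards [self_mem_nhdsWithin, nhdsWithin_le_nhds (Iio_mem_nhds hac)] with g hg hg'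
  have e2 : (g : ℝ) ≤ c := by exact_mod_cast (le_of_lt hg')
  rw [hr.cumRate_eq hη (le_of_lt hg) (le_of_lt hg') hc, expNeg_ofReal]
  exact intervalIntegral.integral_nonneg e2 fun v _ => totalRateReal_nonneg a η v

/-- The density started at `g` is the one started at `a` divided by the probability of surviving
from `a` to `g`, which tends to `1`. -/
theorem IsTerminatedRates.tendsto_setLIntegral_jumpDensity (hr : IsTerminatedRates T r) (y : V)
    (hη : ∀ u, a ≤ u → η u = η a) (hac : a < c) (hc : (c : ℝ≥0∞) < T η) :
    Tendsto (fun g : ℝ≥0 => ∫⁻ v in Ioc (g : ℝ) c, jumpDensity T r y g η v.toNNReal) (𝓝[>] a)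
      (𝓝 (∫⁻ v in Ioc (a : ℝ) c, jumpDensity T r y a η v.toNNReal)) := by
  have hq := hr.continuousOn_totalRateReal hη hc
  have h1 := (tendsto_integral_left hac hq).2
  have h2 := (tendsto_integral_left hac
    (h := fun v => Real.exp (-∫ w in (a : ℝ)..v, totalRateReal T r a η w) * rate T r y v.toNNReal η)
    ((continuousOn_integral_Icc hq).neg.rexp.mul (hr.continuousOn_rate_real y hη hc))).1
  have h3 := ENNReal.Tendsto.mul (ENNReal.tendsto_ofReal h1.rexp) (Or.inr ENNReal.ofReal_ne_top)
    (ENNReal.tendsto_ofReal h2) (Or.inr ENNReal.ofReal_ne_top)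
  rw [Real.exp_zero, ENNReal.ofReal_one, one_mul] at h3
  rw [hr.setLIntegral_jumpDensity_eq y hη le_rfl hac.le hc]
  refine h3.congr' ?_
  filter_upwards [self_mem_nhdsWithin, nhdsWithin_le_nhds (Iio_mem_nhds hac)] with g hg hg'
  have hgT : (g : ℝ≥0∞) < T η := lt_trans (by exact_mod_cast hg') hc
  rw [← hr.setLIntegral_jumpDensity_eq y hη (le_of_lt hg) (le_of_lt hg') hc,
    setLIntegral_congr_fun measurableSet_Ioc fun v hv =>
      jumpDensity_mul (y := y) (le_of_lt hg) (toNNReal_mem_Ioc hv).1 η,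
    lintegral_const_mul' _ _ (ne_top_of_le_ne_top ENNReal.one_ne_top (expNeg_le_one _)),
    hr.expNeg_cumRate_eq hη (le_of_lt hg) hgT, ← mul_assoc,
    ← ENNReal.ofReal_mul (Real.exp_nonneg _), ← Real.exp_add, add_neg_cancel, Real.exp_zero,
    ENNReal.ofReal_one, one_mul]

theorem IsTerminatedRates.setLIntegral_jumpDensity_le_one [Countable V]
    (hr : IsTerminatedRates T r) (y : V) (hη : ∀ u, a ≤ u → η u = η a) (s : Set ℝ) :
    ∫⁻ v in s, jumpDensity T r y a η v.toNNReal ≤ 1 :=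
  (setLIntegral_le_lintegral _ _).trans
    ((ENNReal.le_tsum y).trans (hr.tsum_lintegral_jumpDensity_le hη))

end

/-! ### The strong Markov property at jump times -/

theorem Path.alive_of_lt_nextJump {ω : Path G} {a g : ℝ≥0} (hag : a ≤ g)
    (hg : (g : ℝ≥0∞) < ω.nextJump a) (ha : ω a ≠ none) : ω g ≠ none := by
  rwa [Path.eq_of_lt_nextJump hag hg]

/-- An identity valid at deterministic times extends to jump times by approximating these from
above. -/
theorem measure_inter_eq_of_grid [Countable V] {x₀ : V} {Q : Measure (Path G)} [IsFiniteMeasure Q]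
    {c : ℝ≥0} {E : ℝ≥0 → Set (Path G)} {w : ℝ≥0 → InfPath G → ℝ≥0∞} {k : ℕ}
    (hE : ∀ g ≤ c, ∀ B : Set (Path G), MeasurableSet[Path.filt G g] B →
      (∀ ω ∈ B, ω g ≠ none ∧ (c : ℝ≥0∞) < T (ω.freeze x₀ g)) →
        Q (B ∩ E g) = ∫⁻ ω in B, w g (ω.freeze x₀ g) ∂Q)
    (hEE : ∀ (ω : Path G) (a g : ℝ≥0), a ≤ g → (g : ℝ≥0∞) < ω.nextJump a → (ω ∈ E g ↔ ω ∈ E a))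
    (hEm' : MeasurableSet {ω : Path G | ω ∈ E (ω.jumpTime k).toNNReal})
    (hw : Measurable fun p : ℝ≥0 × InfPath G => w p.1 p.2)
    (hw1 : ∀ g η, (∀ u, g ≤ u → η u = η g) → w g η ≤ 1)
    (hwlim : ∀ (a : ℝ≥0) (η : InfPath G), (∀ u, a ≤ u → η u = η a) → a < c → (c : ℝ≥0∞) < T η →
      Tendsto (fun g => w g η) (𝓝[>] a) (𝓝 (w a η)))
    {C : Set (Path G)} (hC : MeasurableSet C)
    (hCk : ∀ ω ∈ C, ω.jumpTime k < c ∧ ω (ω.jumpTime k).toNNReal ≠ none ∧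
      (c : ℝ≥0∞) < T (ω.history x₀ k).2)
    (hdet : ∀ (g : ℝ≥0) (ω ω' : Path G), (∀ v ≤ g, ω v = ω' v) → ω.jumpTime k ≤ g → ω ∈ C → ω' ∈ C) :
    Q (C ∩ {ω | ω ∈ E (ω.jumpTime k).toNNReal}) =
      ∫⁻ ω in C, w (ω.history x₀ k).1 (ω.history x₀ k).2 ∂Q := by
  set a : Path G → ℝ≥0 := fun ω => (ω.jumpTime k).toNNReal with ha
  have ham : Measurable a := (Path.measurable_jumpTime k).ennreal_toNNReal
  have hak : ∀ ω ∈ C, ω.jumpTime k = a ω := fun ω hω =>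
    (ENNReal.coe_toNNReal (ne_top_of_lt (hCk ω hω).1)).symm
  have hnext : ∀ ω ∈ C, ω.jumpTime (k + 1) = ω.nextJump (a ω) := fun ω hω =>
    Path.jumpTime_succ (hak ω hω)
  have hac : ∀ ω ∈ C, a ω < c := fun ω hω => by
    have := (hCk ω hω).1
    rw [hak ω hω] at this
    exact_mod_cast this
  -- Grid times lie strictly after the jump, so at time `d n ω` the jump is already part of the
  -- past.
  let d : ℕ → Path G → ℝ≥0 := fun n ω => gridAbove n (a ω)
  have hdm : ∀ n, Measurable (d n) := fun n => (measurable_gridAbove n).comp ham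
  -- The grid is fine enough for `ω`: its next time comes neither after `c` nor after the following
  -- jump.
  let Cn : ℕ → Set (Path G) := fun n =>
    C ∩ ({ω | d n ω ≤ c} ∩ {ω | (d n ω : ℝ≥0∞) < ω.jumpTime (k + 1)})
  have hCn : ∀ n, MeasurableSet (Cn n) := fun n =>
    hC.inter ((measurableSet_le (hdm n) measurable_const).inter
      (measurableSet_lt (hdm n).coe_nnreal_ennreal (Path.measurable_jumpTime (k + 1))))
  have hfr : ∀ n, ∀ ω ∈ Cn n, ω.freeze x₀ (d n ω) = (ω.history x₀ k).2 := by
    rintro n ω ⟨h1, h2, h3⟩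
    refine Path.freeze_eq_of_lt_nextJump (lt_gridAbove n _).le ?_ x₀
    rwa [← hnext ω h1]
  -- Split by the countably many values `g` of `d n`. On each piece the frozen path at `g` is the
  -- history of the jump, and `E g` coincides with the event at the jump time.
  have hstep : ∀ n, Q (Cn n ∩ {ω | ω ∈ E (a ω)}) =
      ∫⁻ ω in Cn n, w (d n ω) (ω.history x₀ k).2 ∂Q := by
    intro n
    have hcount := countable_range_gridAbove n
    have : Countable (range (gridAbove n)) := hcount.to_subtype
    let Cg : range (gridAbove n) → Set (Path G) := fun g => Cn n ∩ {ω | d n ω = g}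
    have hCgm : ∀ g, MeasurableSet (Cg g) := fun g =>
      (hCn n).inter (hdm n (measurableSet_singleton _))
    have hunion : Cn n = ⋃ g, Cg g := by
      ext ω
      simp only [Cg, mem_iUnion, mem_inter_iff]
      exact ⟨fun h => ⟨⟨d n ω, mem_range_self _⟩, h, rfl⟩, fun ⟨_, h, _⟩ => h⟩
    have hdisj : Pairwise (Function.onFun Disjoint Cg) := fun g g' hne =>
      Set.disjoint_left.mpr fun ω h h' => hne (Subtype.ext (h.2.symm.trans h'.2))
    have hEa : MeasurableSet {ω : Path G | ω ∈ E (a ω)} := hEm'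
    conv_lhs => rw [hunion, iUnion_inter]
    conv_rhs => rw [hunion]
    rw [measure_iUnion (fun g g' hne => (hdisj hne).mono inter_subset_left inter_subset_left)
      fun g => (hCgm g).inter hEa, lintegral_iUnion hCgm hdisj]
    refine tsum_congr fun g => ?_
    rcases lt_or_ge c g.1 with hcg | hgc
    · have : Cg g = ∅ := by
        ext ω
        simp only [mem_empty_iff_false, iff_false]
        rintro ⟨⟨-, h2, -⟩, h4⟩
        have h2' : d n ω ≤ c := h2
        have h4' : d n ω = g := h4
        rw [h4'] at h2'
        exact absurd hcg (not_lt.mpr h2')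
      simp [this]
    · have hmem : ∀ ω ∈ Cg g, a ω ≤ g.1 ∧ (g.1 : ℝ≥0∞) < ω.nextJump (a ω) := by
        rintro ω ⟨⟨h1, -, h3⟩, h4⟩
        have h4' : d n ω = g := h4
        have h3' : (d n ω : ℝ≥0∞) < ω.jumpTime (k + 1) := h3
        rw [← h4', ← hnext ω h1]
        exact ⟨(lt_gridAbove n _).le, h3'⟩
      -- The path up to `g` shows the `k`-th jump and the absence of a further one by `g`, hence
      -- decides membership.
      have hfil : MeasurableSet[Path.filt G g.1] (Cg g) := by
        refine Path.measurableSet_filt_of_determined (hCgm g) (fun ω hω => ?_) ?_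
        · exact Path.alive_of_lt_nextJump (hmem ω hω).1 (hmem ω hω).2 (hCk ω hω.1.1).2.1
        · rintro ω ω' hag hω
          have hm := (hmem ω hω).1
          obtain ⟨⟨h1, h2, h3⟩, h4⟩ := hω
          have hle : ω.jumpTime k ≤ g.1 := by
            rw [hak ω h1]
            exact_mod_cast hm
          have ha' : a ω' = a ω := by
            simp only [ha, Path.jumpTime_congr hag hle]
          have hd' : d n ω' = d n ω := by simp only [d, ha']
          have h4' : d n ω = g := h4
          refine ⟨⟨hdet g ω ω' hag hle h1, ?_, ?_⟩, ?_⟩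
          · change d n ω' ≤ c
            rw [hd']
            exact h2
          · change (d n ω' : ℝ≥0∞) < ω'.jumpTime (k + 1)
            rw [hd', h4']
            refine Path.lt_jumpTime_succ_congr hag ?_
            rw [← h4']
            exact h3
          · change d n ω' = g
            rw [hd', h4']
      have hgT : ∀ ω ∈ Cg g, ω.freeze x₀ g.1 = (ω.history x₀ k).2 := fun ω hω => by
        have h4' : d n ω = g := hω.2
        rw [← h4']
        exact hfr n ω hω.1
      have hcond := hE g.1 hgc (Cg g) hfil fun ω hω =>
        ⟨Path.alive_of_lt_nextJump (hmem ω hω).1 (hmem ω hω).2 (hCk ω hω.1.1).2.1, by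
          rw [hgT ω hω]
          exact (hCk ω hω.1.1).2.2⟩
      have hset : Cg g ∩ {ω | ω ∈ E (a ω)} = Cg g ∩ E g.1 := by
        ext ω
        exact ⟨fun h => ⟨h.1, (hEE ω _ _ (hmem ω h.1).1 (hmem ω h.1).2).mpr h.2⟩,
          fun h => ⟨h.1, (hEE ω _ _ (hmem ω h.1).1 (hmem ω h.1).2).mp h.2⟩⟩
      rw [hset, hcond]
      refine setLIntegral_congr_fun (hCgm g) fun ω hω => ?_
      have h4' : d n ω = g := hω.2
      simp only [hgT ω hω, h4']
  -- The next jump comes strictly after the current one and `a ω < c`, so there is room for a grid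
  -- time.
  have hev : ∀ ω ∈ C, ∀ᶠ n in atTop, ω ∈ Cn n := by
    intro ω hω
    have h1 : ∀ᶠ g in 𝓝[>] (a ω), g < c := nhdsWithin_le_nhds (Iio_mem_nhds (hac ω hω))
    have h2 : ∀ᶠ g : ℝ≥0 in 𝓝[>] (a ω), (g : ℝ≥0∞) < ω.jumpTime (k + 1) := by
      have : ((a ω : ℝ≥0) : ℝ≥0∞) < ω.jumpTime (k + 1) := by
        rw [hnext ω hω]
        exact ω.lt_nextJump _
      exact (ENNReal.continuous_coe.tendsto (a ω) |>.mono_left nhdsWithin_le_nhds).eventually_lt_const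
        this
    filter_upwards [(tendsto_gridAbove (a ω)).eventually h1,
      (tendsto_gridAbove (a ω)).eventually h2] with n hn1 hn2
    exact ⟨hω, le_of_lt hn1, hn2⟩
  have hηm : Measurable fun ω : Path G => (ω.history x₀ k).2 :=
    measurable_snd.comp (Path.measurable_history x₀ k)
  have hηc : ∀ ω : Path G, ∀ u, a ω ≤ u → (ω.history x₀ k).2 u = (ω.history x₀ k).2 (a ω) :=
    fun ω u hu => Path.freeze_const x₀ _ ω hu
  have lim1 : Tendsto (fun n => Q (Cn n ∩ {ω | ω ∈ E (a ω)})) atTop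
      (𝓝 (Q (C ∩ {ω | ω ∈ E (a ω)}))) := by
    have := tendsto_lintegral_of_dominated_convergence (μ := Q) (fun _ => 1)
      (F := fun n => (Cn n ∩ {ω | ω ∈ E (a ω)}).indicator 1)
      (f := (C ∩ {ω | ω ∈ E (a ω)}).indicator 1)
      (fun n => measurable_one.indicator ((hCn n).inter hEm'))
      (fun n => ae_of_all _ fun ω => indicator_le_self' (fun _ _ => zero_le) ω)
      (by simp) (ae_of_all _ fun ω => ?_)
    · have e : ∀ n, ∫⁻ ω, (Cn n ∩ {ω | ω ∈ E (a ω)}).indicator 1 ω ∂Q =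
          Q (Cn n ∩ {ω | ω ∈ E (a ω)}) := fun n => lintegral_indicator_one ((hCn n).inter hEm')
      have e' : ∫⁻ ω, (C ∩ {ω | ω ∈ E (a ω)}).indicator 1 ω ∂Q = Q (C ∩ {ω | ω ∈ E (a ω)}) :=
        lintegral_indicator_one (hC.inter hEm')
      rw [e'] at this
      exact this.congr e
    · by_cases hω : ω ∈ C
      · refine tendsto_const_nhds.congr' ?_
        filter_upwards [hev ω hω] with n hn
        by_cases hωE : ω ∈ {ω | ω ∈ E (a ω)}
        · rw [indicator_of_mem (mem_inter hω hωE), indicator_of_mem (mem_inter hn hωE)]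
        · rw [indicator_of_notMem fun h => hωE h.2, indicator_of_notMem fun h => hωE h.2]
      · refine tendsto_const_nhds.congr fun n => ?_
        rw [indicator_of_notMem fun h => hω h.1, indicator_of_notMem fun h => hω h.1.1]
  -- Dominated convergence with bound `1`; pointwise this is right continuity of the one-step law in
  -- its initial time.
  have lim2 : Tendsto (fun n => ∫⁻ ω in Cn n, w (d n ω) (ω.history x₀ k).2 ∂Q) atTop
      (𝓝 (∫⁻ ω in C, w (a ω) (ω.history x₀ k).2 ∂Q)) := by
    simp_rw [← lintegral_indicator (hCn _), ← lintegral_indicator hC]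
    refine tendsto_lintegral_of_dominated_convergence (fun _ => 1)
      (fun n => (hw.comp ((hdm n).prodMk hηm)).indicator (hCn n)) (fun n => ae_of_all _ fun ω => ?_)
      (by simp) (ae_of_all _ fun ω => ?_)
    · by_cases hω : ω ∈ Cn n
      · rw [indicator_of_mem hω]
        refine hw1 _ _ fun u hu => ?_
        rw [hηc ω u ((lt_gridAbove n _).le.trans hu), hηc ω _ (lt_gridAbove n _).le]
      · rw [indicator_of_notMem hω]
        exact zero_le
    · by_cases hω : ω ∈ C
      · have := (hwlim (a ω) _ (hηc ω) (hac ω hω) (hCk ω hω).2.2).comp (tendsto_gridAbove (a ω))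
        rw [indicator_of_mem hω]
        refine this.congr' ?_
        filter_upwards [hev ω hω] with n hn
        rw [indicator_of_mem hn]
        rfl
      · refine tendsto_const_nhds.congr fun n => ?_
        rw [indicator_of_notMem hω, indicator_of_notMem fun h => hω h.1]
  refine tendsto_nhds_unique lim1 ?_
  simp_rw [hstep]
  exact lim2

end

/-! ### The one-step law at jump times -/

section


variable {V : Type*} {G : SimpleGraph V} {T : InfPath G → ℝ≥0∞}
  {r : ℝ≥0 → V → V → InfPath G → ℝ≥0}

theorem measurableSet_history_mem [Countable V] (x : ℕ → V) {D : ℕ → Set ℝ≥0} (hD : ∀ i, MeasurableSet (D i))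
    (k : ℕ) (x₀ : V) {B : Set (ℝ≥0 × InfPath G)} (hB : MeasurableSet B) :
    MeasurableSet (jumpEvent G x D k ∩ {ω | ω.history x₀ k ∈ B}) :=
  (measurableSet_jumpEvent x hD k).inter (Path.measurable_history x₀ k hB)

section

variable [Countable V] [G.LocallyFinite] {x₀ : V} {Q : Measure (Path G)} [IsFiniteMeasure Q]

/-- The set `B` keeps only histories whose jump precedes `c` and that are not terminated at `c`, the
range in which the one-step law is available. -/
theorem HasOneStepLaw.survive_jumpTime (hr : IsTerminatedRates T r)
    (hQ : HasOneStepLaw T r x₀ Q) (x : ℕ → V) {D : ℕ → Set ℝ≥0} (hD : ∀ i, MeasurableSet (D i))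
    (k : ℕ) {c : ℝ≥0} {B : Set (ℝ≥0 × InfPath G)} (hB : MeasurableSet B)
    (hBc : ∀ p ∈ B, p.1 < c ∧ (c : ℝ≥0∞) < T p.2) :
    Q (jumpEvent G x D k ∩ {ω | ω.history x₀ k ∈ B} ∩
        {ω | (c : ℝ≥0∞) < ω.nextJump (ω.jumpTime k).toNNReal}) =
      ∫⁻ ω in jumpEvent G x D k ∩ {ω | ω.history x₀ k ∈ B},
        expNeg (cumRate T r (ω.history x₀ k).2 (ω.history x₀ k).1 c) ∂Q := by
  have hjm : Measurable fun ω : Path G => ((ω.jumpTime k).toNNReal, ω) :=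
    (Path.measurable_jumpTime k).ennreal_toNNReal.prodMk measurable_id
  have hnm := (Path.measurable_nextJump_prod (G := G)).comp hjm
  have hwm : Measurable fun p : ℝ≥0 × InfPath G => expNeg (cumRate T r p.2 p.1 c) := by
    have := hr.measurable_cumRate.comp
      (measurable_id.prodMk (measurable_const (a := c)) : Measurable fun p : ℝ≥0 × InfPath G => (p, c))
    exact measurable_expNeg.comp this
  refine measure_inter_eq_of_grid (T := T) (c := c) (x₀ := x₀)
    (E := fun g => {ω : Path G | (c : ℝ≥0∞) < ω.nextJump g})
    (w := fun g η => expNeg (cumRate T r η g c)) (k := k)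
    (fun g hg B hB hBc => hQ.survive g c hg B hB hBc) ?_
    (measurableSet_lt measurable_const hnm) hwm (fun g η _ => expNeg_le_one _)
    (fun a η hη hac hc => hr.tendsto_expNeg_cumRate hη hac hc)
    (measurableSet_history_mem x hD k x₀ hB) ?_ ?_
  · intro ω a g hag hg
    simp only [mem_ofPred_eq, Path.nextJump_eq_of_lt hag hg]
  · rintro ω ⟨h1, h2⟩
    obtain ⟨h3, h4, -⟩ := h1 k le_rfl
    obtain ⟨h5, h6⟩ := hBc _ h2
    refine ⟨?_, by simp [h4], h6⟩
    rw [← ENNReal.coe_toNNReal h3]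
    exact_mod_cast h5
  · rintro g ω ω' hag hle ⟨h1, h2⟩
    refine ⟨jumpEvent_congr hag hle h1, ?_⟩
    change ω'.history x₀ k ∈ B
    rw [Path.history_congr hag hle]
    exact h2

theorem HasOneStepLaw.jump_jumpTime (hr : IsTerminatedRates T r)
    (hQ : HasOneStepLaw T r x₀ Q) (x : ℕ → V) {D : ℕ → Set ℝ≥0} (hD : ∀ i, MeasurableSet (D i))
    (k : ℕ) {c : ℝ≥0} {B : Set (ℝ≥0 × InfPath G)} (hB : MeasurableSet B)
    (hBc : ∀ p ∈ B, p.1 < c ∧ (c : ℝ≥0∞) < T p.2) (y : V) :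
    Q (jumpEvent G x D k ∩ {ω | ω.history x₀ k ∈ B} ∩
        {ω | ω.nextJump (ω.jumpTime k).toNNReal ≤ c ∧
          ω (ω.nextJump (ω.jumpTime k).toNNReal).toNNReal = some y}) =
      ∫⁻ ω in jumpEvent G x D k ∩ {ω | ω.history x₀ k ∈ B},
        (∫⁻ v in Ioc ((ω.history x₀ k).1 : ℝ) c,
          jumpDensity T r y (ω.history x₀ k).1 (ω.history x₀ k).2 v.toNNReal) ∂Q := by
  have hjm : Measurable fun ω : Path G => ((ω.jumpTime k).toNNReal, ω) :=
    (Path.measurable_jumpTime k).ennreal_toNNReal.prodMk measurable_id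
  have hnm := (Path.measurable_nextJump_prod (G := G)).comp hjm
  have hsm := (Path.measurable_eval_prod (G := G)).comp
    (hnm.ennreal_toNNReal.prodMk measurable_id)
  have hwm : Measurable fun p : ℝ≥0 × InfPath G =>
      ∫⁻ v in Ioc (p.1 : ℝ) c, jumpDensity T r y p.1 p.2 v.toNNReal := by
    have h1 : Measurable fun p : (ℝ≥0 × InfPath G) × ℝ => jumpDensity T r y p.1.1 p.1.2 p.2.toNNReal :=
      (hr.measurable_jumpDensity y).comp
        (measurable_fst.prodMk measurable_snd.real_toNNReal)
    have h2 : MeasurableSet {p : (ℝ≥0 × InfPath G) × ℝ | (p.1.1 : ℝ) < p.2 ∧ p.2 ≤ c} :=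
      (measurableSet_lt (measurable_fst.comp measurable_fst).coe_nnreal_real measurable_snd).inter
        (measurableSet_le measurable_snd measurable_const)
    have h3 := (h1.indicator h2).lintegral_prod_right' (ν := volume)
    convert h3 using 2 with p
    rw [← lintegral_indicator measurableSet_Ioc]
    rfl
  refine measure_inter_eq_of_grid (T := T) (c := c) (x₀ := x₀)
    (E := fun g => {ω : Path G | ω.nextJump g ≤ c ∧ ω (ω.nextJump g).toNNReal = some y})
    (w := fun g η => ∫⁻ v in Ioc (g : ℝ) c, jumpDensity T r y g η v.toNNReal) (k := k)
    (fun g hg B hB hBc => hQ.jump g c hg B hB hBc y) ?_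
    ((measurableSet_le hnm measurable_const).inter (hsm (MeasurableSet.of_discrete (s := {some y}))))
    hwm (fun g η hη => hr.setLIntegral_jumpDensity_le_one y hη _)
    (fun a η hη hac hc => hr.tendsto_setLIntegral_jumpDensity y hη hac hc)
    (measurableSet_history_mem x hD k x₀ hB) ?_ ?_
  · intro ω a g hag hg
    simp only [mem_ofPred_eq, Path.nextJump_eq_of_lt hag hg]
  · rintro ω ⟨h1, h2⟩
    obtain ⟨h3, h4, -⟩ := h1 k le_rfl
    obtain ⟨h5, h6⟩ := hBc _ h2
    refine ⟨?_, by simp [h4], h6⟩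
    rw [← ENNReal.coe_toNNReal h3]
    exact_mod_cast h5
  · rintro g ω ω' hag hle ⟨h1, h2⟩
    refine ⟨jumpEvent_congr hag hle h1, ?_⟩
    change ω'.history x₀ k ∈ B
    rw [Path.history_congr hag hle]
    exact h2

end

end

/-! ### Joint law of a history and the next jump time -/

section


variable {V : Type*} {G : SimpleGraph V} {T : InfPath G → ℝ≥0∞}
  {r : ℝ≥0 → V → V → InfPath G → ℝ≥0}

section

variable [Countable V] [G.LocallyFinite] {x₀ : V} {Q : Measure (Path G)} [IsFiniteMeasure Q]

/-- The event that the `(k+1)`-st jump exists, leads to `y`, and happens before the terminal time of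
the path that makes only `k` jumps. -/
def jumpsTo (T : InfPath G → ℝ≥0∞) (x₀ y : V) (k : ℕ) : Set (Path G) :=
  {ω | ω.jumpTime (k + 1) ≠ ⊤} ∩ ({ω | ω (ω.jumpTime (k + 1)).toNNReal = some y} ∩
    {ω | ((ω.jumpTime (k + 1)).toNNReal : ℝ≥0∞) < T (ω.history x₀ k).2})

omit [G.LocallyFinite] in
theorem measurableSet_jumpsTo (hT : IsLSCStoppingTime T) (x₀ y : V) (k : ℕ) :
    MeasurableSet (jumpsTo (G := G) T x₀ y k) := by
  have h1 := Path.measurable_jumpTime (G := G) (k + 1)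
  have h2 : Measurable fun ω : Path G => (ω.history x₀ k).2 :=
    measurable_snd.comp (Path.measurable_history x₀ k)
  exact (h1 (measurableSet_singleton ⊤).compl).inter
    ((Path.measurable_jumpState (k + 1) (MeasurableSet.of_discrete (s := {some y}))).inter
      (measurableSet_lt h1.ennreal_toNNReal.coe_nnreal_ennreal (hT.measurable.comp h2)))

omit [G.LocallyFinite] in
theorem measurable_jumpDensity_history (hr : IsTerminatedRates T r) (x₀ y : V) (k : ℕ)
    {F : (ℝ≥0 × InfPath G) × ℝ≥0 → ℝ≥0∞} (hF : Measurable F) :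
    Measurable fun p : Path G × ℝ =>
      jumpDensity T r y (p.1.history x₀ k).1 (p.1.history x₀ k).2 p.2.toNNReal *
        F (p.1.history x₀ k, p.2.toNNReal) := by
  have h : Measurable fun p : Path G × ℝ => (p.1.history x₀ k, p.2.toNNReal) :=
    ((Path.measurable_history x₀ k).comp measurable_fst).prodMk measurable_snd.real_toNNReal
  exact ((hr.measurable_jumpDensity y).comp h).mul (hF.comp h)

/-- The joint law of the history at the `k`-th jump and of the time of the next jump. -/
theorem HasOneStepLaw.lintegral_next (hT : IsLSCStoppingTime T) (hr : IsTerminatedRates T r)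
    (hQ : HasOneStepLaw T r x₀ Q) (x : ℕ → V) {D : ℕ → Set ℝ≥0} (hD : ∀ i, MeasurableSet (D i))
    (k : ℕ) (y : V) {F : (ℝ≥0 × InfPath G) × ℝ≥0 → ℝ≥0∞} (hF : Measurable F) :
    ∫⁻ ω in jumpEvent G x D k ∩ jumpsTo T x₀ y k,
        F (ω.history x₀ k, (ω.jumpTime (k + 1)).toNNReal) ∂Q =
      ∫⁻ ω in jumpEvent G x D k, (∫⁻ v : ℝ,
        jumpDensity T r y (ω.history x₀ k).1 (ω.history x₀ k).2 v.toNNReal *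
          F (ω.history x₀ k, v.toNNReal)) ∂Q := by
  set C := jumpEvent G x D k with hCdef
  have hC : MeasurableSet C := measurableSet_jumpEvent x hD k
  have hJ := measurableSet_jumpsTo (G := G) hT x₀ y k
  let J : Path G × ℝ → ℝ≥0∞ := fun p =>
    jumpDensity T r y (p.1.history x₀ k).1 (p.1.history x₀ k).2 p.2.toNNReal
  have hJm : Measurable J := by
    have := measurable_jumpDensity_history hr x₀ y k (F := 1) measurable_one
    simpa using this
  let φ : Path G → (ℝ≥0 × InfPath G) × ℝ≥0 := fun ω =>
    (ω.history x₀ k, (ω.jumpTime (k + 1)).toNNReal)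
  have hφ : Measurable φ :=
    (Path.measurable_history x₀ k).prodMk (Path.measurable_jumpTime (k + 1)).ennreal_toNNReal
  let ψ : Path G × ℝ → (ℝ≥0 × InfPath G) × ℝ≥0 := fun p => (p.1.history x₀ k, p.2.toNNReal)
  have hψ : Measurable ψ :=
    ((Path.measurable_history x₀ k).comp measurable_fst).prodMk measurable_snd.real_toNNReal
  -- Both sides are integrals of `F` against measures on pairs (history, next jump time), so it is
  -- enough to identify these measures.
  let M₁ : Measure ((ℝ≥0 × InfPath G) × ℝ≥0) := (Q.restrict (C ∩ jumpsTo T x₀ y k)).map φ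
  let M₂ : Measure ((ℝ≥0 × InfPath G) × ℝ≥0) :=
    (((Q.restrict C).prod volume).withDensity J).map ψ
  have hM₁ : ∀ F : (ℝ≥0 × InfPath G) × ℝ≥0 → ℝ≥0∞, Measurable F →
      ∫⁻ p, F p ∂M₁ = ∫⁻ ω in C ∩ jumpsTo T x₀ y k, F (φ ω) ∂Q := fun F hF =>
    lintegral_map hF hφ
  have hM₂ : ∀ F : (ℝ≥0 × InfPath G) × ℝ≥0 → ℝ≥0∞, Measurable F →
      ∫⁻ p, F p ∂M₂ = ∫⁻ ω in C, (∫⁻ v : ℝ, J (ω, v) * F (ψ (ω, v))) ∂Q := fun F hF => by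
    have h := lintegral_withDensity_eq_lintegral_mul ((Q.restrict C).prod volume) hJm (hF.comp hψ)
    rw [lintegral_prod _ (hJm.mul (hF.comp hψ)).aemeasurable] at h
    rw [lintegral_map hF hψ]
    exact h
  suffices M₁ = M₂ by
    have h := hM₂ F hF
    rw [← this, hM₁ F hF] at h
    exact h
  have hMa : ∀ S, MeasurableSet S → M₁ S = Q (C ∩ jumpsTo T x₀ y k ∩ φ ⁻¹' S) := fun S hS => by
    rw [Measure.map_apply hφ hS, Measure.restrict_apply (hφ hS), inter_comm]
  have hMb : ∀ S, MeasurableSet S → M₂ S =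
      ∫⁻ ω in C, (∫⁻ v : ℝ, J (ω, v) * S.indicator 1 (ψ (ω, v))) ∂Q := fun S hS => by
    rw [← hM₂ _ (measurable_one.indicator hS), lintegral_indicator_one hS]
  have hηc : ∀ ω : Path G, ∀ u, (ω.history x₀ k).1 ≤ u →
      (ω.history x₀ k).2 u = (ω.history x₀ k).2 (ω.history x₀ k).1 :=
    fun ω u hu => Path.freeze_const x₀ _ ω hu
  have hfin₁ : IsFiniteMeasure M₁ := inferInstance
  let A : ℝ≥0 → Set (ℝ≥0 × InfPath G) := fun c => {p | (c : ℝ≥0∞) < T p.2}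
  have hA : ∀ c, MeasurableSet (A c) := fun c =>
    measurableSet_lt measurable_const (hT.measurable.comp measurable_snd)
  -- the basic sets
  have hbasic : ∀ (c : ℝ≥0) (B : Set (ℝ≥0 × InfPath G)), MeasurableSet B → B ⊆ A c →
      M₁ (B ×ˢ Iic c) = M₂ (B ×ˢ Iic c) := by
    intro c B hB hBA
    -- Histories that end at or after `c` leave no room for a next jump by `c` and carry no mass on
    -- either side.
    set B' : Set (ℝ≥0 × InfPath G) := B ∩ {p | p.1 < c} with hB'
    have hB'm : MeasurableSet B' := hB.inter (measurableSet_lt measurable_fst measurable_const)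
    have hkey := hQ.jump_jumpTime hr x hD k (c := c) hB'm (fun p hp => ⟨hp.2, hBA hp.1⟩) y
    have hset : C ∩ jumpsTo T x₀ y k ∩ φ ⁻¹' (B ×ˢ Iic c) =
        jumpEvent G x D k ∩ {ω | ω.history x₀ k ∈ B'} ∩
        {ω | ω.nextJump (ω.jumpTime k).toNNReal ≤ c ∧
          ω (ω.nextJump (ω.jumpTime k).toNNReal).toNNReal = some y} := by
      ext ω
      constructor
      · rintro ⟨⟨h1, h2, h3, h4⟩, h5, h6⟩
        have hk := ENNReal.coe_toNNReal (h1 k le_rfl).1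
        have hnext := Path.jumpTime_succ hk.symm
        have h2' := ENNReal.coe_toNNReal h2
        have h6' : (ω.jumpTime (k + 1)).toNNReal ≤ c := h6
        have h7 : ω.jumpTime (k + 1) ≤ c := by
          rw [← h2']
          exact_mod_cast h6'
        refine ⟨⟨h1, h5, ?_⟩, ?_, ?_⟩
        · change (ω.jumpTime k).toNNReal < c
          have := (Path.jumpTime_lt_succ (h1 k le_rfl).1).trans_le h7
          rw [← hk] at this
          exact_mod_cast this
        · rw [← hnext]
          exact h7
        · rw [← hnext]
          exact h3
      · rintro ⟨⟨h1, h2, h3⟩, h4, h5⟩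
        have hk := ENNReal.coe_toNNReal (h1 k le_rfl).1
        have hnext := Path.jumpTime_succ hk.symm
        rw [← hnext] at h4 h5
        have h6 : ω.jumpTime (k + 1) ≠ ⊤ := ne_top_of_le_ne_top ENNReal.coe_ne_top h4
        have h7 : (ω.jumpTime (k + 1)).toNNReal ≤ c := by
          simpa using ENNReal.toNNReal_mono ENNReal.coe_ne_top h4
        refine ⟨⟨h1, h6, h5, ?_⟩, h2, h7⟩
        exact lt_of_le_of_lt (by exact_mod_cast h7) (show (c : ℝ≥0∞) < T (ω.history x₀ k).2 from hBA h2)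
    have hJzero : ∀ ω v, v ≤ (ω.history x₀ k).1 → J (ω, (v : ℝ≥0)) = 0 := by
      intro ω v hv
      simp only [J, Real.toNNReal_coe]
      exact if_neg (not_lt.mpr hv)
    rw [hMa _ (hB.prod measurableSet_Iic), hset, hkey, hMb _ (hB.prod measurableSet_Iic),
      ← lintegral_indicator (measurableSet_history_mem x hD k x₀ hB'm), ← lintegral_indicator hC]
    refine lintegral_congr fun ω => ?_
    by_cases hω : ω ∈ C
    · rw [indicator_of_mem hω]
      by_cases hωB : ω.history x₀ k ∈ B'
      · rw [indicator_of_mem (mem_inter hω hωB), ← lintegral_indicator measurableSet_Ioc]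
        refine lintegral_congr fun v => ?_
        by_cases hv : v ∈ Ioc ((ω.history x₀ k).1 : ℝ) c
        · have hmem : ψ (ω, v) ∈ B ×ˢ Iic c := ⟨hωB.1, (toNNReal_mem_Ioc hv).2⟩
          rw [indicator_of_mem hv, indicator_of_mem hmem]
          simp [J]
        · rw [indicator_of_notMem hv]
          by_cases hva : (ω.history x₀ k).1 < v.toNNReal
          · have hmem : ψ (ω, v) ∉ B ×ˢ Iic c := fun h => hv
              ⟨Real.lt_toNNReal_iff_coe_lt.mp hva, Real.toNNReal_le_iff_le_coe.mp h.2⟩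
            rw [indicator_of_notMem hmem, mul_zero]
          · have : J (ω, v) = 0 := if_neg hva
            rw [this, zero_mul]
      · rw [indicator_of_notMem fun h => hωB h.2]
        symm
        refine (lintegral_congr fun v => ?_).trans lintegral_zero
        by_cases hmem : ψ (ω, v) ∈ B ×ˢ Iic c
        · have hva : ¬ (ω.history x₀ k).1 < v.toNNReal := fun h =>
            hωB ⟨hmem.1, lt_of_lt_of_le h hmem.2⟩
          have : J (ω, v) = 0 := if_neg hva
          rw [this, zero_mul]
        · rw [indicator_of_notMem hmem, mul_zero]
    · rw [indicator_of_notMem hω, indicator_of_notMem fun h => hω h.1]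
  -- On one slab the basic rectangles are available for all smaller times, and half lines determine
  -- the law of the jump time.
  have hres : ∀ q : ℚ, M₁.restrict (A (Real.toNNReal q) ×ˢ Iic (Real.toNNReal q)) =
      M₂.restrict (A (Real.toNNReal q) ×ˢ Iic (Real.toNNReal q)) := by
    intro q
    set c : ℝ≥0 := (Real.toNNReal q) with hc
    refine Measure.ext_prod fun {s t} hs ht => ?_
    have hsA : MeasurableSet (s ∩ A c) := hs.inter (hA c)
    have hfst : (M₁.restrict ((s ∩ A c) ×ˢ Iic c)).map Prod.snd =
        (M₂.restrict ((s ∩ A c) ×ˢ Iic c)).map Prod.snd := by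
      refine Measure.ext_of_Iic _ _ fun c' => ?_
      rw [Measure.map_apply measurable_snd measurableSet_Iic,
        Measure.map_apply measurable_snd measurableSet_Iic,
        Measure.restrict_apply (measurable_snd measurableSet_Iic),
        Measure.restrict_apply (measurable_snd measurableSet_Iic)]
      have : (Prod.snd ⁻¹' Iic c' ∩ (s ∩ A c) ×ˢ Iic c : Set ((ℝ≥0 × InfPath G) × ℝ≥0)) =
          (s ∩ A c) ×ˢ Iic (min c c') := by
        ext p
        simp only [mem_inter_iff, mem_preimage, mem_Iic, mem_prod, le_min_iff]
        tauto
      rw [this]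
      refine hbasic _ _ hsA fun p hp => ?_
      exact lt_of_le_of_lt (by exact_mod_cast min_le_left c c') (show (c : ℝ≥0∞) < T p.2 from hp.2)
    have h := congrArg (fun m => m t) hfst
    simp only [Measure.map_apply measurable_snd ht, Measure.restrict_apply (measurable_snd ht)] at h
    rw [Measure.restrict_apply (hs.prod ht), Measure.restrict_apply (hs.prod ht)]
    have : (s ×ˢ t ∩ A c ×ˢ Iic c : Set ((ℝ≥0 × InfPath G) × ℝ≥0)) =
        Prod.snd ⁻¹' t ∩ (s ∩ A c) ×ˢ Iic c := by
      ext p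
      simp only [mem_inter_iff, mem_preimage, mem_Iic, mem_prod]
      tauto
    rw [this]
    exact h
  -- A rational number between the jump time and `T` selects a slab. Both measures live on this
  -- union, the first by the definition of `jumpsTo`, the second because its density vanishes from
  -- `T` on.
  have hcover : ∀ p : (ℝ≥0 × InfPath G) × ℝ≥0, (p.2 : ℝ≥0∞) < T p.1.2 →
      p ∈ ⋃ q : ℚ, A (Real.toNNReal q) ×ˢ Iic (Real.toNNReal q) := by
    intro p hp
    obtain ⟨q, hq0, hq1, hq2⟩ := ENNReal.lt_iff_exists_rat_btwn.mp hp
    exact mem_iUnion.mpr ⟨q, hq2, by exact_mod_cast hq1.le⟩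
  have hS : MeasurableSet {p : (ℝ≥0 × InfPath G) × ℝ≥0 | (p.2 : ℝ≥0∞) < T p.1.2} :=
    measurableSet_lt measurable_snd.coe_nnreal_ennreal
      (hT.measurable.comp (measurable_snd.comp measurable_fst))
  have h₁ : M₁.restrict (⋃ q : ℚ, A (Real.toNNReal q) ×ˢ Iic (Real.toNNReal q)) = M₁ := by
    refine Measure.restrict_eq_self_of_ae_mem ?_
    have h : ∀ᵐ p ∂M₁, (p.2 : ℝ≥0∞) < T p.1.2 := by
      refine (ae_map_iff hφ.aemeasurable hS).mpr ?_
      filter_upwards [ae_restrict_mem (hC.inter hJ)] with ω hω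
      exact hω.2.2.2
    filter_upwards [h] with p hp using hcover p hp
  have h₂ : M₂.restrict (⋃ q : ℚ, A (Real.toNNReal q) ×ˢ Iic (Real.toNNReal q)) = M₂ := by
    refine Measure.restrict_eq_self_of_ae_mem ?_
    have h : ∀ᵐ p ∂M₂, (p.2 : ℝ≥0∞) < T p.1.2 := by
      refine (ae_map_iff hψ.aemeasurable hS).mpr ?_
      rw [ae_withDensity_iff hJm]
      refine ae_of_all _ fun p hp => ?_
      by_contra hlt
      refine hp ?_
      change jumpDensity T r y _ _ _ = 0
      unfold jumpDensity
      split_ifs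
      · rw [rate_of_not_lt hlt]
        simp
      · rfl
    filter_upwards [h] with p hp using hcover p hp
  rw [← h₁, ← h₂]
  exact Measure.restrict_iUnion_congr.mpr hres

end

end

/-! ### The law of the history at the `l`-th jump -/

section


variable {V : Type*} {G : SimpleGraph V} {T : InfPath G → ℝ≥0∞}
  {r : ℝ≥0 → V → V → InfPath G → ℝ≥0}

/-- A history (time of the last jump, path frozen from then on) extended by a jump to `y` at time
`v`. -/
def extend (y : V) (p : ℝ≥0 × InfPath G) (v : ℝ≥0) : ℝ≥0 × InfPath G := (v, p.2.append p.1 v y)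

theorem measurable_extend [Countable V] (y : V) :
    Measurable fun p : (ℝ≥0 × InfPath G) × ℝ≥0 => extend y p.1 p.2 := by
  refine measurable_snd.prodMk (measurable_to_infPath fun s A => ?_)
  let _ : MeasurableSpace V := ⊤
  have h1 : MeasurableSet {p : (ℝ≥0 × InfPath G) × ℝ≥0 | p.1.2 s ∈ A} :=
    ((InfPath.measurable_eval s).comp (measurable_snd.comp measurable_fst)) (t := A) trivial
  have h2 := (measurableSet_canAppend (G := G) y).inter
    (measurableSet_le (measurable_snd (α := ℝ≥0 × InfPath G)) (measurable_const (a := s)))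
  have : {p : (ℝ≥0 × InfPath G) × ℝ≥0 | p.1.2.append p.1.1 p.2 y s ∈ A} =
      ({p | CanAppend p.1.2 p.1.1 p.2 y} ∩ {p | p.2 ≤ s}) ∩ {_p | y ∈ A} ∪
      ({p | CanAppend p.1.2 p.1.1 p.2 y} ∩ {p | p.2 ≤ s})ᶜ ∩ {p | p.1.2 s ∈ A} := by
    ext p
    change p.1.2.append p.1.1 p.2 y s ∈ A ↔ (CanAppend p.1.2 p.1.1 p.2 y ∧ p.2 ≤ s) ∧ y ∈ A ∨
      ¬ (CanAppend p.1.2 p.1.1 p.2 y ∧ p.2 ≤ s) ∧ p.1.2 s ∈ A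
    by_cases h : CanAppend p.1.2 p.1.1 p.2 y ∧ p.2 ≤ s
    · rw [InfPath.append_of_ge h.1 h.2]
      tauto
    · rw [show p.1.2.append p.1.1 p.2 y s = p.1.2 s from if_neg h]
      tauto
  rw [this]
  exact (h2.inter (MeasurableSet.const _)).union (h2.compl.inter h1)

/-- The iterated integral over the times of the first `l` jumps, which lead through the states
`x 1, …, x l` at times in `D 0, …, D (l - 1)`, of a function of the history at the `l`-th jump. -/
def jumpIntegral (T : InfPath G → ℝ≥0∞) (r : ℝ≥0 → V → V → InfPath G → ℝ≥0) (x : ℕ → V)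
    (D : ℕ → Set ℝ≥0) : ℕ → (ℝ≥0 × InfPath G → ℝ≥0∞) → ℝ≥0∞
  | 0, f => f (0, InfPath.const G (x 0))
  | l + 1, f => jumpIntegral T r x D l fun p => ∫⁻ v : ℝ,
      jumpDensity T r (x (l + 1)) p.1 p.2 v.toNNReal *
        (D l).indicator (fun v => f (extend (x (l + 1)) p v)) v.toNNReal

theorem jumpDensity_of_not_lt {y : V} {a v : ℝ≥0} {η : InfPath G} (h : ¬ (v : ℝ≥0∞) < T η) :
    jumpDensity T r y a η v = 0 := by
  unfold jumpDensity
  split_ifs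
  · rw [rate_of_not_lt h]
    simp
  · rfl

theorem Path.history_succ {ω : Path G} {k : ℕ} (hk : ω.jumpTime k ≠ ⊤) (hk1 : ω.jumpTime (k + 1) ≠ ⊤)
    {y : V} (hy : ω (ω.jumpTime (k + 1)).toNNReal = some y) (x₀ : V) :
    CanAppend (ω.history x₀ k).2 (ω.history x₀ k).1 (ω.jumpTime (k + 1)).toNNReal y ∧
      ω.history x₀ (k + 1) = extend y (ω.history x₀ k) (ω.jumpTime (k + 1)).toNNReal := by
  have h := Path.jumpTime_succ (ENNReal.coe_toNNReal hk).symm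
  rw [← ENNReal.coe_toNNReal hk1] at h
  obtain ⟨h1, h2⟩ := Path.freeze_nextJump h.symm hy x₀
  exact ⟨h1, Prod.ext rfl h2⟩

section

variable [Countable V] [G.LocallyFinite] {x₀ : V} {Q : Measure (Path G)} [IsProbabilityMeasure Q]

/-- The law of the history at the `l`-th jump on the set where it is not yet terminated. -/
theorem HasOneStepLaw.lintegral_history (hT : IsLSCStoppingTime T) (hr : IsTerminatedRates T r)
    (hQ : HasOneStepLaw T r x₀ Q) (h0 : ∀ᵐ ω ∂Q, ω 0 = some x₀) (x : ℕ → V) (hx : x 0 = x₀)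
    {D : ℕ → Set ℝ≥0} (hD : ∀ i, MeasurableSet (D i)) (l : ℕ) :
    ∀ {f : ℝ≥0 × InfPath G → ℝ≥0∞}, Measurable f → (∀ p, ¬ (p.1 : ℝ≥0∞) < T p.2 → f p = 0) →
      ∫⁻ ω in jumpEvent G x D l, f (ω.history x₀ l) ∂Q = jumpIntegral T r x D l f := by
  induction l with
  | zero =>
    intro f hf _
    have h1 : (jumpEvent G x D 0 : Set (Path G)) =ᵐ[Q] univ := by
      rw [jumpEvent_zero, hx]
      exact eventuallyEq_univ.mpr h0
    rw [setLIntegral_congr h1, setLIntegral_univ]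
    have h2 : ∀ᵐ ω ∂Q, f (ω.history x₀ 0) = f (0, InfPath.const G (x 0)) := by
      filter_upwards [h0] with ω hω
      congr 1
      refine Prod.ext (by simp [Path.history]) (InfPath.ext fun v => Option.some_injective _ ?_)
      change some (ω.freeze x₀ _ v) = some (x 0)
      rw [Path.jumpTime_zero, ENNReal.toNNReal_zero, Path.freeze_of_ge (by simp [hω]) zero_le, hω, hx]
    rw [lintegral_congr_ae h2]
    simp [jumpIntegral]
  | succ l ih =>
    intro f hf hf0
    set y := x (l + 1) with hy
    let F : (ℝ≥0 × InfPath G) × ℝ≥0 → ℝ≥0∞ :=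
      {p : (ℝ≥0 × InfPath G) × ℝ≥0 | p.2 ∈ D l}.indicator fun p => f (extend y p.1 p.2)
    have hF : Measurable F := (hf.comp (measurable_extend y)).indicator (measurable_snd (hD l))
    have hFm : Measurable fun q : (ℝ≥0 × InfPath G) × ℝ =>
        jumpDensity T r y q.1.1 q.1.2 q.2.toNNReal * F (q.1, q.2.toNNReal) := by
      have h : Measurable fun q : (ℝ≥0 × InfPath G) × ℝ => (q.1, q.2.toNNReal) :=
        measurable_fst.prodMk measurable_snd.real_toNNReal
      exact ((hr.measurable_jumpDensity y).comp h).mul (hF.comp h)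
    -- The new integrand vanishes on terminated histories, as the induction hypothesis demands: the
    -- density is positive only at times between `p.1` and `T p.2`.
    have hstep := ih (f := fun p => ∫⁻ v : ℝ, jumpDensity T r y p.1 p.2 v.toNNReal *
      F (p, v.toNNReal)) hFm.lintegral_prod_right' (fun p hp => by
        refine (lintegral_congr fun v => ?_).trans lintegral_zero
        by_cases hpv : p.1 < v.toNNReal
        · rw [jumpDensity_of_not_lt, zero_mul]
          exact fun h => hp (lt_trans (by exact_mod_cast hpv) h)
        · rw [show jumpDensity T r y p.1 p.2 v.toNNReal = 0 from if_neg hpv, zero_mul])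
    rw [← hQ.lintegral_next hT hr x hD l y hF] at hstep
    change _ = jumpIntegral T r x D l _
    refine Eq.trans ?_ hstep
    rw [← lintegral_indicator (measurableSet_jumpEvent x hD (l + 1)),
      ← lintegral_indicator ((measurableSet_jumpEvent x hD l).inter (measurableSet_jumpsTo hT x₀ y l))]
    refine lintegral_congr fun ω => ?_
    by_cases hω : ω ∈ jumpEvent G x D (l + 1)
    · rw [indicator_of_mem hω]
      rw [jumpEvent_succ] at hω
      obtain ⟨h1, h2, h3, h4⟩ := hω
      obtain ⟨h5, h6⟩ := Path.history_succ (h1 l le_rfl).1 h2 h3 x₀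
      by_cases h7 : ((ω.jumpTime (l + 1)).toNNReal : ℝ≥0∞) < T (ω.history x₀ l).2
      · have h8 : ω ∈ jumpEvent G x D l ∩ jumpsTo T x₀ y l := ⟨h1, h2, h3, h7⟩
        rw [indicator_of_mem h8, h6]
        have : (ω.history x₀ l, (ω.jumpTime (l + 1)).toNNReal) ∈
          {p : (ℝ≥0 × InfPath G) × ℝ≥0 | p.2 ∈ D l} := h4
        simp only [F, indicator_of_mem this]
        rfl
      -- The jump comes after the old path is terminated. By lower semicontinuity the new history is
      -- terminated too, and `f` vanishes on it.
      · rw [indicator_of_notMem fun h => h7 h.2.2.2, h6]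
        exact hf0 _ fun h => h7 (hT.lt_of_lt_append h5 h)
    · rw [indicator_of_notMem hω]
      by_cases h : ω ∈ jumpEvent G x D l ∩ jumpsTo T x₀ y l
      · rw [indicator_of_mem h]
        symm
        refine indicator_of_notMem (fun h' => hω ?_) _
        rw [jumpEvent_succ]
        exact ⟨h.1, h.2.1, h.2.2.1, h'⟩
      · rw [indicator_of_notMem h]

end

end

/-! ### Killing and the path probabilities -/

section


variable {V : Type*} {G : SimpleGraph V} {T : InfPath G → ℝ≥0∞}
  {r : ℝ≥0 → V → V → InfPath G → ℝ≥0}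

/-- The event that exactly `l` jumps have happened by time `t`, through the states `x 0, …, x l` at
times in `D 0, …, D (l - 1)`. -/
def walkEvent (G : SimpleGraph V) (x : ℕ → V) (D : ℕ → Set ℝ≥0) (l : ℕ) (t : ℝ≥0) : Set (Path G) :=
  jumpEvent G x D l ∩ {ω | ω.jumpTime l ≤ t ∧ (t : ℝ≥0∞) < ω.jumpTime (l + 1)}

theorem measurableSet_walkEvent [Countable V] (x : ℕ → V) {D : ℕ → Set ℝ≥0}
    (hD : ∀ i, MeasurableSet (D i)) (l : ℕ) (t : ℝ≥0) : MeasurableSet (walkEvent G x D l t) :=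
  (measurableSet_jumpEvent x hD l).inter
    ((measurableSet_le (Path.measurable_jumpTime l) measurable_const).inter
      (measurableSet_lt measurable_const (Path.measurable_jumpTime (l + 1))))

theorem eq_of_mem_walkEvent {x : ℕ → V} {D : ℕ → Set ℝ≥0} {l : ℕ} {t : ℝ≥0} {ω : Path G}
    (h : ω ∈ walkEvent G x D l t) : ω t = some (x l) := by
  obtain ⟨h1, h2, h3⟩ := h
  obtain ⟨h4, h5, -⟩ := h1 l le_rfl
  have h6 := ENNReal.coe_toNNReal h4
  rw [← h6] at h2
  rw [Path.eq_of_mem_Ico_jumpTime h6.symm (by exact_mod_cast h2) h3, h5]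

theorem walkEvent_congr {x : ℕ → V} {D : ℕ → Set ℝ≥0} {l : ℕ} {t : ℝ≥0} {ω ω' : Path G}
    (h : ∀ v ≤ t, ω v = ω' v) (hω : ω ∈ walkEvent G x D l t) : ω' ∈ walkEvent G x D l t :=
  ⟨jumpEvent_congr h hω.2.1 hω.1, (Path.jumpTime_congr h hω.2.1).trans_le hω.2.1,
    Path.lt_jumpTime_succ_congr h hω.2.2⟩

theorem freeze_of_mem_walkEvent {x : ℕ → V} {D : ℕ → Set ℝ≥0} {l : ℕ} {t : ℝ≥0} {ω : Path G}
    (h : ω ∈ walkEvent G x D l t) (x₀ : V) : ω.freeze x₀ t = (ω.history x₀ l).2 := by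
  obtain ⟨h1, h2, h3⟩ := h
  have h6 := ENNReal.coe_toNNReal (h1 l le_rfl).1
  rw [Path.jumpTime_succ h6.symm] at h3
  rw [← h6] at h2
  exact Path.freeze_eq_of_lt_nextJump (by exact_mod_cast h2) h3 x₀

/-- If a later frozen path has not terminated by `t`, neither has the one frozen at `t`, since they
agree up to `t`. Conversely, both `T` and the next jump leave room after `t`, and a time in this
room has the same frozen path; so the supremum exceeds `t` strictly. -/
theorem lt_deathTime_iff (hT : IsLSCStoppingTime T) {ω : Path G} {t : ℝ≥0} (h : ω t ≠ none)
    (x₀ : V) : (t : ℝ≥0∞) < deathTime T ω ↔ (t : ℝ≥0∞) < T (ω.freeze x₀ t) := by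
  simp only [deathTime, lt_iSup_iff]
  constructor
  · rintro ⟨s, ⟨η, hη, hs⟩, hts⟩
    have hts' : t ≤ s := by exact_mod_cast hts.le
    refine (hT.lt_congr fun v hv => Option.some_injective _ ?_).mp (hts.trans hs)
    rw [← hη v, min_eq_left (hv.trans hts'), Path.freeze_of_le h hv]
  · intro ht
    have hnj := ω.lt_nextJump t
    obtain ⟨c, hc1, hc2⟩ := ENNReal.lt_iff_exists_nnreal_btwn.mp (lt_min ht hnj)
    obtain ⟨hc3, hc4⟩ := lt_min_iff.mp hc2
    have htc : t ≤ c := by exact_mod_cast hc1.le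
    refine ⟨c, ⟨ω.freeze x₀ c, Path.isFrozen_freeze ?_, ?_⟩, hc1⟩
    · rwa [Path.eq_of_lt_nextJump htc hc4]
    · rwa [Path.freeze_eq_of_lt_nextJump htc hc4]

theorem Path.kill_of_lt {ω : Path G} {τ : ℝ≥0∞} {t : ℝ≥0} (h : (t : ℝ≥0∞) < τ) :
    ω.kill τ t = ω t := if_pos h

theorem Path.kill_of_not_lt {ω : Path G} {τ : ℝ≥0∞} {t : ℝ≥0} (h : ¬ (t : ℝ≥0∞) < τ) :
    ω.kill τ t = none := if_neg h

/-- On the walk event the path frozen at `t` is the history of the `l`-th jump, so surviving the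
killing is a condition on that history. -/
theorem kill_mem_walkEvent_iff (hT : IsLSCStoppingTime T) {x : ℕ → V} {D : ℕ → Set ℝ≥0} {l : ℕ}
    {t : ℝ≥0} (ω : Path G) (x₀ : V) : ω.kill (deathTime T ω) ∈ walkEvent G x D l t ↔
      ω ∈ walkEvent G x D l t ∧ (t : ℝ≥0∞) < T (ω.history x₀ l).2 := by
  have hagree : (t : ℝ≥0∞) < deathTime T ω → ∀ v ≤ t, ω.kill (deathTime T ω) v = ω v :=
    fun h v hv => Path.kill_of_lt (lt_of_le_of_lt (by exact_mod_cast hv) h)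
  constructor
  · intro h
    have h1 := eq_of_mem_walkEvent h
    have h2 : (t : ℝ≥0∞) < deathTime T ω := by
      by_contra h2
      rw [Path.kill_of_not_lt h2] at h1
      exact absurd h1 (by simp)
    have h3 := walkEvent_congr (hagree h2) h
    have h4 : ω t ≠ none := by simp [eq_of_mem_walkEvent h3]
    refine ⟨h3, ?_⟩
    rw [← freeze_of_mem_walkEvent h3]
    exact (lt_deathTime_iff hT h4 x₀).mp h2
  · rintro ⟨h1, h2⟩
    have h4 : ω t ≠ none := by simp [eq_of_mem_walkEvent h1]
    rw [← freeze_of_mem_walkEvent h1, ← lt_deathTime_iff hT h4 x₀] at h2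
    exact walkEvent_congr (fun v hv => (hagree h2 v hv).symm) h1

open Classical in
/-- The probability that a process with the history `p` stays put and is not terminated until time
`t`. -/
def stayProb (T : InfPath G → ℝ≥0∞) (r : ℝ≥0 → V → V → InfPath G → ℝ≥0) (t : ℝ≥0)
    (p : ℝ≥0 × InfPath G) : ℝ≥0∞ :=
  if p.1 ≤ t ∧ (t : ℝ≥0∞) < T p.2 then expNeg (cumRate T r p.2 p.1 t) else 0

section

variable [Countable V]

theorem measurable_stayProb (hT : IsLSCStoppingTime T) (hr : IsTerminatedRates T r) (t : ℝ≥0) :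
    Measurable (stayProb T r t) := by
  have h : Measurable fun p : ℝ≥0 × InfPath G => (p, t) := measurable_id.prodMk measurable_const
  exact Measurable.ite ((measurableSet_le measurable_fst measurable_const).inter
    (measurableSet_lt measurable_const (hT.measurable.comp measurable_snd)))
    (measurable_expNeg.comp (hr.measurable_cumRate.comp h)) measurable_const

variable [G.LocallyFinite] {x₀ : V} {Q : Measure (Path G)} [IsProbabilityMeasure Q]

theorem HasOneStepLaw.measure_walkEvent (hT : IsLSCStoppingTime T) (hr : IsTerminatedRates T r)
    (hQ : HasOneStepLaw T r x₀ Q) (h0 : ∀ᵐ ω ∂Q, ω 0 = some x₀) (x : ℕ → V) (hx : x 0 = x₀)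
    {D : ℕ → Set ℝ≥0} (hD : ∀ i, MeasurableSet (D i)) (l : ℕ) (t : ℝ≥0) :
    Q {ω | ω ∈ walkEvent G x D l t ∧ (t : ℝ≥0∞) < T (ω.history x₀ l).2} =
      jumpIntegral T r x D l (stayProb T r t) := by
  rw [← hQ.lintegral_history hT hr h0 x hx hD l (measurable_stayProb hT hr t) (fun p hp =>
    if_neg fun h => hp (lt_of_le_of_lt (by exact_mod_cast h.1) h.2))]
  have hTm : MeasurableSet {p : ℝ≥0 × InfPath G | (t : ℝ≥0∞) < T p.2} :=
    measurableSet_lt measurable_const (hT.measurable.comp measurable_snd)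
  -- The law at jump times needs room before `t`. A last jump exactly at `t`, the set `B₂`, is
  -- treated apart: there the next jump is automatically later and the survival factor is `1`.
  set B₁ : Set (ℝ≥0 × InfPath G) := {p | p.1 < t ∧ (t : ℝ≥0∞) < T p.2} with hB₁
  set B₂ : Set (ℝ≥0 × InfPath G) := {p | p.1 = t ∧ (t : ℝ≥0∞) < T p.2} with hB₂
  have hB₁m : MeasurableSet B₁ := (measurableSet_lt measurable_fst measurable_const).inter hTm
  have hB₂m : MeasurableSet B₂ := (measurableSet_eq_fun measurable_fst measurable_const).inter hTm
  set C := jumpEvent G x D l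
  have hC₁ := measurableSet_history_mem (G := G) x hD l x₀ hB₁m
  have hC₂ := measurableSet_history_mem (G := G) x hD l x₀ hB₂m
  have hset : {ω | ω ∈ walkEvent G x D l t ∧ (t : ℝ≥0∞) < T (ω.history x₀ l).2} =
      (C ∩ {ω | ω.history x₀ l ∈ B₁} ∩ {ω | (t : ℝ≥0∞) < ω.nextJump (ω.jumpTime l).toNNReal}) ∪
        (C ∩ {ω | ω.history x₀ l ∈ B₂}) := by
    ext ω
    constructor
    · rintro ⟨⟨h1, h2, h3⟩, h4⟩
      have h6 := ENNReal.coe_toNNReal (h1 l le_rfl).1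
      rw [← h6] at h2
      have h7 : (ω.jumpTime l).toNNReal ≤ t := by exact_mod_cast h2
      rw [Path.jumpTime_succ h6.symm] at h3
      rcases h7.lt_or_eq with h8 | h8
      · exact Or.inl ⟨⟨h1, h8, h4⟩, h3⟩
      · exact Or.inr ⟨h1, h8, h4⟩
    · rintro (⟨⟨h1, h2, h3⟩, h4⟩ | ⟨h1, h2, h3⟩)
      · have h6 := ENNReal.coe_toNNReal (h1 l le_rfl).1
        refine ⟨⟨h1, ?_, ?_⟩, h3⟩
        · rw [← h6]
          exact_mod_cast (show (ω.jumpTime l).toNNReal < t from h2).le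
        · rw [Path.jumpTime_succ h6.symm]
          exact h4
      · have h6 := ENNReal.coe_toNNReal (h1 l le_rfl).1
        have h2' : (ω.jumpTime l).toNNReal = t := h2
        rw [h2'] at h6
        exact ⟨⟨h1, h6.symm.le, h6 ▸ Path.jumpTime_lt_succ (h1 l le_rfl).1⟩, h3⟩
  have hdisj : Disjoint (C ∩ {ω | ω.history x₀ l ∈ B₁}) (C ∩ {ω | ω.history x₀ l ∈ B₂}) :=
    disjoint_left.mpr fun ω h h' => h.2.1.ne h'.2.1
  rw [hset, measure_union (hdisj.mono_left inter_subset_left) hC₂,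
    hQ.survive_jumpTime hr x hD l hB₁m (fun p hp => hp)]
  have h₁ : ∫⁻ ω in C ∩ {ω | ω.history x₀ l ∈ B₁},
      expNeg (cumRate T r (ω.history x₀ l).2 (ω.history x₀ l).1 t) ∂Q =
      ∫⁻ ω in C ∩ {ω | ω.history x₀ l ∈ B₁}, stayProb T r t (ω.history x₀ l) ∂Q :=
    setLIntegral_congr_fun hC₁ fun ω hω =>
      (if_pos (c := (ω.history x₀ l).1 ≤ t ∧ (t : ℝ≥0∞) < T (ω.history x₀ l).2)
        ⟨hω.2.1.le, hω.2.2⟩).symm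
  have h₂ : Q (C ∩ {ω | ω.history x₀ l ∈ B₂}) =
      ∫⁻ ω in C ∩ {ω | ω.history x₀ l ∈ B₂}, stayProb T r t (ω.history x₀ l) ∂Q := by
    rw [← setLIntegral_one]
    refine setLIntegral_congr_fun hC₂ fun ω hω => ?_
    have h2 : (ω.history x₀ l).1 = t := hω.2.1
    symm
    refine (if_pos (c := (ω.history x₀ l).1 ≤ t ∧ (t : ℝ≥0∞) < T (ω.history x₀ l).2)
        ⟨h2.le, hω.2.2⟩).trans ?_
    rw [h2, cumRate_self, expNeg_zero]
  rw [h₁, h₂, ← lintegral_union hC₂ hdisj, ← lintegral_indicator (hC₁.union hC₂),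
    ← lintegral_indicator (measurableSet_jumpEvent x hD l)]
  refine lintegral_congr fun ω => ?_
  by_cases hω : ω ∈ C
  · rw [indicator_of_mem hω]
    by_cases h : (ω.history x₀ l).1 ≤ t ∧ (t : ℝ≥0∞) < T (ω.history x₀ l).2
    · refine indicator_of_mem ?_ _
      rcases h.1.lt_or_eq with h8 | h8
      · exact Or.inl ⟨hω, h8, h.2⟩
      · exact Or.inr ⟨hω, h8, h.2⟩
    · rw [show stayProb T r t (ω.history x₀ l) = 0 from if_neg h]
      refine indicator_of_notMem (fun h' => h ?_) _
      rcases h' with ⟨-, h1, h2⟩ | ⟨-, h1, h2⟩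
      · exact ⟨le_of_lt h1, h2⟩
      · exact ⟨le_of_eq h1, h2⟩
  · rw [indicator_of_notMem hω]
    refine indicator_of_notMem (fun h' => hω ?_) _
    rcases h' with h | h
    · exact h.1
    · exact h.1

/-- The path probabilities of a process with jump rates. -/
theorem HasJumpRates.measure_walkEvent (hT : IsLSCStoppingTime T) (hr : IsTerminatedRates T r)
    {P : Measure (Path G)} (hP : HasJumpRates T r x₀ P) (x : ℕ → V) (hx : x 0 = x₀)
    {D : ℕ → Set ℝ≥0} (hD : ∀ i, MeasurableSet (D i)) (l : ℕ) (t : ℝ≥0) :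
    P (walkEvent G x D l t) = jumpIntegral T r x D l (stayProb T r t) := by
  obtain ⟨Q, hQp, h0, hexp, hev, hm, rfl⟩ := hP
  rw [Measure.map_apply_of_aemeasurable hm (measurableSet_walkEvent x hD l t),
    ← (EvolvesWithRates.hasOneStepLaw hr x₀ hexp hev).measure_walkEvent hT hr h0 x hx hD l t]
  congr 1
  ext ω
  exact kill_mem_walkEvent_iff hT ω x₀

end

end

/-! ### From iterated integrals to integrals over vectors of jump times -/

section


variable {V : Type*} {G : SimpleGraph V} {T : InfPath G → ℝ≥0∞}
  {r : ℝ≥0 → V → V → InfPath G → ℝ≥0}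

/-- The history at the `k`-th jump when the successive jumps lead to `x 1, x 2, …` at the times
`s 0, s 1, …`. -/
def stepHistory (G : SimpleGraph V) (x : ℕ → V) (s : ℕ → ℝ≥0) : ℕ → ℝ≥0 × InfPath G
  | 0 => (0, InfPath.const G (x 0))
  | k + 1 => extend (x (k + 1)) (stepHistory G x s k) (s k)

open Classical in
/-- The density of the times of the first `k` jumps. -/
def stepWeight (T : InfPath G → ℝ≥0∞) (r : ℝ≥0 → V → V → InfPath G → ℝ≥0) (x : ℕ → V)
    (D : ℕ → Set ℝ≥0) (s : ℕ → ℝ≥0) : ℕ → ℝ≥0∞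
  | 0 => 1
  | k + 1 => stepWeight T r x D s k *
      (jumpDensity T r (x (k + 1)) (stepHistory G x s k).1 (stepHistory G x s k).2 (s k) *
        (D k).indicator 1 (s k))

theorem stepHistory_congr {x : ℕ → V} {s s' : ℕ → ℝ≥0} {k : ℕ} (h : ∀ i < k, s i = s' i) :
    stepHistory G x s k = stepHistory G x s' k := by
  induction k with
  | zero => rfl
  | succ k ih =>
    rw [stepHistory, stepHistory, ih fun i hi => h i (hi.trans k.lt_succ_self), h k k.lt_succ_self]

theorem stepWeight_congr {x : ℕ → V} {D : ℕ → Set ℝ≥0} {s s' : ℕ → ℝ≥0} {k : ℕ}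
    (h : ∀ i < k, s i = s' i) : stepWeight T r x D s k = stepWeight T r x D s' k := by
  induction k with
  | zero => rfl
  | succ k ih =>
    have h' : ∀ i < k, s i = s' i := fun i hi => h i (hi.trans k.lt_succ_self)
    rw [stepWeight, stepWeight, ih h', stepHistory_congr h', h k k.lt_succ_self]

theorem measurable_stepHistory [Countable V] (x : ℕ → V) (k : ℕ) :
    Measurable fun s : ℕ → ℝ≥0 => stepHistory G x s k := by
  induction k with
  | zero => exact measurable_const
  | succ k ih => exact (measurable_extend (x (k + 1))).comp (ih.prodMk (measurable_pi_apply k))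

theorem IsTerminatedRates.measurable_stepWeight [Countable V] (hr : IsTerminatedRates T r)
    (x : ℕ → V) {D : ℕ → Set ℝ≥0} (hD : ∀ i, MeasurableSet (D i)) (k : ℕ) :
    Measurable fun s : ℕ → ℝ≥0 => stepWeight T r x D s k := by
  induction k with
  | zero => exact measurable_const
  | succ k ih =>
    refine ih.mul (Measurable.mul ?_ ?_)
    · exact (hr.measurable_jumpDensity (x (k + 1))).comp
        ((measurable_stepHistory x k).prodMk (measurable_pi_apply k))
    · exact (measurable_one.indicator (hD k)).comp (measurable_pi_apply k)

/-- A vector of jump times, extended by zeros. -/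
def padTimes {l : ℕ} (s : Fin l → ℝ) (i : ℕ) : ℝ≥0 := if h : i < l then (s ⟨i, h⟩).toNNReal else 0

theorem measurable_padTimes (l : ℕ) : Measurable (padTimes (l := l)) := by
  refine measurable_pi_iff.mpr fun i => ?_
  unfold padTimes
  split_ifs with h
  · exact (measurable_pi_apply _).real_toNNReal
  · exact measurable_const

/-- Fubini, peeling off the last coordinate: weight and history after `l` jumps depend on the first
`l` times only. -/
theorem jumpIntegral_eq_lintegral [Countable V] (hr : IsTerminatedRates T r)
    (x : ℕ → V) {D : ℕ → Set ℝ≥0} (hD : ∀ i, MeasurableSet (D i)) (l : ℕ) :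
    ∀ {f : ℝ≥0 × InfPath G → ℝ≥0∞}, Measurable f → jumpIntegral T r x D l f =
      ∫⁻ s : Fin l → ℝ, stepWeight T r x D (padTimes s) l * f (stepHistory G x (padTimes s) l) := by
  induction l with
  | zero =>
    intro f _
    rw [volume_pi, Measure.pi_of_empty, lintegral_dirac]
    simp [jumpIntegral, stepWeight, stepHistory]
  | succ l ih =>
    intro f hf
    have hH : Measurable fun s : Fin (l + 1) → ℝ =>
        stepWeight T r x D (padTimes s) (l + 1) * f (stepHistory G x (padTimes s) (l + 1)) :=
      ((hr.measurable_stepWeight x hD (l + 1)).comp (measurable_padTimes _)).mul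
        (hf.comp ((measurable_stepHistory x (l + 1)).comp (measurable_padTimes _)))
    have he := (volume_preserving_piFinSuccAbove (fun _ : Fin (l + 1) => ℝ) (Fin.last l)).symm
    have hprod := lintegral_prod_symm (μ := (volume : Measure ℝ))
      (ν := (volume : Measure (Fin l → ℝ))) _ (hH.comp he.measurable).aemeasurable
    rw [← Measure.volume_eq_prod] at hprod
    rw [← he.lintegral_comp hH]
    refine Eq.trans ?_ hprod.symm
    have hfm : Measurable fun q : (ℝ≥0 × InfPath G) × ℝ =>
        jumpDensity T r (x (l + 1)) q.1.1 q.1.2 q.2.toNNReal *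
          (D l).indicator (fun v => f (extend (x (l + 1)) q.1 v)) q.2.toNNReal := by
      have h : Measurable fun q : (ℝ≥0 × InfPath G) × ℝ => (q.1, q.2.toNNReal) :=
        measurable_fst.prodMk measurable_snd.real_toNNReal
      have h2 : Measurable fun q : (ℝ≥0 × InfPath G) × ℝ≥0 =>
          {q : (ℝ≥0 × InfPath G) × ℝ≥0 | q.2 ∈ D l}.indicator
            (fun q => f (extend (x (l + 1)) q.1 q.2)) q :=
        (hf.comp (measurable_extend (x (l + 1)))).indicator (measurable_snd (hD l))
      exact ((hr.measurable_jumpDensity (x (l + 1))).comp h).mul (h2.comp h)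
    rw [jumpIntegral, ih hfm.lintegral_prod_right']
    refine lintegral_congr fun s => ?_
    refine (lintegral_const_mul _ (hfm.comp measurable_prodMk_left)).symm.trans ?_
    refine lintegral_congr fun v => ?_
    change stepWeight T r x D (padTimes s) l *
      (jumpDensity T r (x (l + 1)) (stepHistory G x (padTimes s) l).1
        (stepHistory G x (padTimes s) l).2 v.toNNReal * (D l).indicator
          (fun v => f (extend (x (l + 1)) (stepHistory G x (padTimes s) l) v)) v.toNNReal) =
      stepWeight T r x D (padTimes ((MeasurableEquiv.piFinSuccAbove (fun _ : Fin (l + 1) => ℝ)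
        (Fin.last l)).symm (v, s))) (l + 1) * f (stepHistory G x (padTimes
          ((MeasurableEquiv.piFinSuccAbove (fun _ : Fin (l + 1) => ℝ)
            (Fin.last l)).symm (v, s))) (l + 1))
    set u : ℕ → ℝ≥0 := padTimes
      ((MeasurableEquiv.piFinSuccAbove (fun _ : Fin (l + 1) => ℝ) (Fin.last l)).symm (v, s)) with hu
    have hus : ∀ i < l, padTimes s i = u i := fun i hi => by
      simp only [hu, padTimes, hi, hi.trans l.lt_succ_self, dif_pos]
      simp [MeasurableEquiv.piFinSuccAbove, Fin.snoc, hi]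
    have huv : u l = v.toNNReal := by
      simp only [hu, padTimes, l.lt_succ_self, dif_pos]
      congr 1
      change (MeasurableEquiv.piFinSuccAbove (fun _ : Fin (l + 1) => ℝ) (Fin.last l)).symm (v, s)
        (Fin.last l) = v
      simp [MeasurableEquiv.piFinSuccAbove]
    rw [stepWeight_congr hus, stepHistory_congr hus, ← huv, stepWeight, stepHistory]
    by_cases h : u l ∈ D l
    · simp only [indicator_of_mem h, Pi.one_apply, mul_one, mul_assoc]
    · simp only [indicator_of_notMem h, mul_zero, zero_mul]

/-! ### Chains of increasing jump times -/

/-- The two claims are proved together: once the path rests at `x k`, the next jump is legal, so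
appending it really moves the path to `x (k + 1)`. -/
theorem canAppend_stepHistory {x : ℕ → V} {s : ℕ → ℝ≥0} {l : ℕ}
    (hx : ∀ i < l, G.Adj (x i) (x (i + 1))) (hs : ∀ i < l, (stepHistory G x s i).1 < s i) :
    ∀ k ≤ l, (∀ u, (stepHistory G x s k).1 ≤ u → (stepHistory G x s k).2 u = x k) ∧
      (k < l → CanAppend (stepHistory G x s k).2 (stepHistory G x s k).1 (s k) (x (k + 1))) := by
  have haux : ∀ k, (∀ u, (stepHistory G x s k).1 ≤ u → (stepHistory G x s k).2 u = x k) →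
      k < l → CanAppend (stepHistory G x s k).2 (stepHistory G x s k).1 (s k) (x (k + 1)) := by
    intro k h hk
    refine ⟨hs k hk, fun u hu => ?_, ?_⟩
    · rw [h u hu, h _ le_rfl]
    · rw [h _ le_rfl]
      exact hx k hk
  intro k
  induction k with
  | zero => exact fun _ => ⟨fun u _ => rfl, haux 0 fun u _ => rfl⟩
  | succ k ih =>
    intro hk
    have h1 := (ih (Nat.le_of_succ_le hk)).2 hk
    have h2 : ∀ u, (stepHistory G x s (k + 1)).1 ≤ u → (stepHistory G x s (k + 1)).2 u = x (k + 1) :=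
      fun u hu => InfPath.append_of_ge h1 hu
    exact ⟨h2, haux _ h2⟩

/-- The survival factors of the holding intervals merge into one exponential along the final path,
because appending a jump does not change the rate accumulated before it. -/
theorem stepWeight_eq (hr : IsTerminatedRates T r) {x : ℕ → V} {D : ℕ → Set ℝ≥0} {s : ℕ → ℝ≥0}
    {l : ℕ} (hs : ∀ i < l, (stepHistory G x s i).1 < s i) (hD : ∀ i < l, s i ∈ D i) :
    ∀ k ≤ l, stepWeight T r x D s k =
      expNeg (cumRate T r (stepHistory G x s k).2 0 (stepHistory G x s k).1) *
        ∏ j ∈ Finset.range k, (rate T r (x (j + 1)) (s j) (stepHistory G x s j).2 : ℝ≥0∞) := by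
  intro k
  induction k with
  | zero =>
    intro _
    simp [stepWeight, stepHistory, cumRate_self]
  | succ k ih =>
    intro hk
    have h1 : cumRate T r (stepHistory G x s (k + 1)).2 0 (stepHistory G x s (k + 1)).1 =
        cumRate T r (stepHistory G x s k).2 0 (stepHistory G x s k).1 +
          cumRate T r (stepHistory G x s k).2 (stepHistory G x s k).1 (s k) := by
      rw [cumRate_add _ zero_le (hs k hk).le]
      exact hr.cumRate_congr (fun v hv => InfPath.append_of_lt hv) 0
    rw [stepWeight, ih (Nat.le_of_succ_le hk), h1, expNeg_add, jumpDensity_of_lt (hs k hk),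
      indicator_of_mem (hD k hk), Finset.prod_range_succ]
    simp only [Pi.one_apply, mul_one]
    ring

theorem stepWeight_eq_zero {x : ℕ → V} {D : ℕ → Set ℝ≥0} {s : ℕ → ℝ≥0} {l : ℕ}
    (h : ¬ ∀ i < l, (stepHistory G x s i).1 < s i ∧ s i ∈ D i) : stepWeight T r x D s l = 0 := by
  induction l with
  | zero => exact absurd (fun i hi => absurd hi i.not_lt_zero) h
  | succ l ih =>
    rw [stepWeight]
    by_cases h1 : ∀ i < l, (stepHistory G x s i).1 < s i ∧ s i ∈ D i
    · by_cases h2 : (stepHistory G x s l).1 < s l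
      · have h3 : s l ∉ D l := fun h3 => h fun i hi => by
          rcases Nat.lt_succ_iff_lt_or_eq.mp hi with hi | rfl
          · exact h1 i hi
          · exact ⟨h2, h3⟩
        rw [indicator_of_notMem h3]
        simp
      · rw [show jumpDensity T r (x (l + 1)) (stepHistory G x s l).1 (stepHistory G x s l).2 (s l) = 0
          from if_neg h2]
        simp
    · rw [ih h1, zero_mul]

/-- If the path with `l` jumps is not terminated by time `t`, no jump came too late. -/
theorem lt_of_lt_stepHistory (hT : IsLSCStoppingTime T) {x : ℕ → V} {s : ℕ → ℝ≥0} {l : ℕ}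
    (hx : ∀ i < l, G.Adj (x i) (x (i + 1))) (hs : ∀ i < l, (stepHistory G x s i).1 < s i)
    (hl : ((stepHistory G x s l).1 : ℝ≥0∞) < T (stepHistory G x s l).2) :
    ∀ k < l, (s k : ℝ≥0∞) < T (stepHistory G x s k).2 := by
  induction l with
  | zero => exact fun k hk => absurd hk k.not_lt_zero
  | succ l ih =>
    have h1 := (canAppend_stepHistory hx hs l l.le_succ).2 l.lt_succ_self
    have h2 : (s l : ℝ≥0∞) < T (stepHistory G x s l).2 := hT.lt_of_lt_append h1 hl
    intro k hk
    rcases Nat.lt_succ_iff_lt_or_eq.mp hk with hk | rfl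
    · exact ih (fun i hi => hx i (hi.trans l.lt_succ_self)) (fun i hi => hs i (hi.trans l.lt_succ_self))
        (lt_trans (by exact_mod_cast hs l l.lt_succ_self) h2) k hk
    · exact h2

/-- Excludes the value `⊤`, where `expNeg` is not a real exponential. On each holding interval the
path is frozen and not yet terminated, for the earlier ones by lower semicontinuity, so the rates
are continuous there. -/
theorem cumRate_stepHistory_ne_top [G.LocallyFinite] (hT : IsLSCStoppingTime T) (hr : IsTerminatedRates T r) {x : ℕ → V}
    {s : ℕ → ℝ≥0} {l : ℕ} (hx : ∀ i < l, G.Adj (x i) (x (i + 1)))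
    (hs : ∀ i < l, (stepHistory G x s i).1 < s i) {t : ℝ≥0} (ht : (stepHistory G x s l).1 ≤ t)
    (hl : (t : ℝ≥0∞) < T (stepHistory G x s l).2) :
    cumRate T r (stepHistory G x s l).2 0 t ≠ ⊤ := by
  induction l generalizing t with
  | zero => exact hr.cumRate_ne_top (fun u _ => rfl) zero_le hl
  | succ l ih =>
    have hcan := canAppend_stepHistory hx hs
    have hle : (s l : ℝ≥0∞) ≤ t := by exact_mod_cast ht
    rw [← cumRate_add _ zero_le ht]
    refine ENNReal.add_ne_top.mpr ⟨?_, ?_⟩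
    · rw [show cumRate T r (stepHistory G x s (l + 1)).2 0 (stepHistory G x s (l + 1)).1 =
        cumRate T r (stepHistory G x s l).2 0 (s l) from
        hr.cumRate_congr (fun v hv => InfPath.append_of_lt hv) 0]
      exact ih (fun i hi => hx i (hi.trans l.lt_succ_self)) (fun i hi => hs i (hi.trans l.lt_succ_self))
        (hs l l.lt_succ_self).le
        (lt_of_lt_stepHistory hT hx hs (lt_of_le_of_lt hle hl) l l.lt_succ_self)
    · refine hr.cumRate_ne_top (fun u hu => ?_) ht hl
      rw [(hcan (l + 1) le_rfl).1 u hu, (hcan (l + 1) le_rfl).1 _ le_rfl]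

end

section


variable {V : Type*} {G : SimpleGraph V} {T : InfPath G → ℝ≥0∞}
  {r : ℝ≥0 → V → V → InfPath G → ℝ≥0}

/-! ### Step paths as iterated extensions -/

theorem stepFun_eq {l : ℕ} (x : Fin (l + 1) → V) {s : Fin l → ℝ≥0} {k n : ℕ} {v : ℝ≥0} (hn : n ≤ l)
    (h : ∀ i : Fin l, i.1 < k ∧ s i ≤ v ↔ i.1 < n) :
    stepFun x s k v = x ⟨n, Nat.lt_succ_of_le hn⟩ := by
  unfold stepFun
  congr 1
  rw [Fin.ext_iff]
  simp only [h, Fin.card_filter_val_lt, min_eq_right hn]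

/-- The time stored in the `i`-th history is that of the previous jump, or `0` for `i = 0`; hence
the positivity clause. -/
theorem stepHistory_fst_lt_iff {l : ℕ} {xe : ℕ → V} {s : Fin l → ℝ≥0} {se : ℕ → ℝ≥0}
    (hse : ∀ i : Fin l, se i = s i) :
    (∀ i < l, (stepHistory G xe se i).1 < se i) ↔ StrictMono s ∧ ∀ i, 0 < s i := by
  constructor
  · intro h
    have key : ∀ j < l, 0 < se j ∧ ∀ i < j, se i < se j := by
      intro j
      induction j with
      | zero => exact fun h0 => ⟨h 0 h0, fun i hi => absurd hi i.not_lt_zero⟩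
      | succ j ih =>
        intro hj
        have h1 : se j < se (j + 1) := h (j + 1) hj
        obtain ⟨h2, h3⟩ := ih (j.lt_succ_self.trans hj)
        refine ⟨h2.trans h1, fun i hi => ?_⟩
        rcases Nat.lt_succ_iff_lt_or_eq.mp hi with hi | rfl
        · exact (h3 i hi).trans h1
        · exact h1
    refine ⟨fun i j hij => ?_, fun i => ?_⟩
    · rw [← hse, ← hse]
      exact (key j j.2).2 i hij
    · rw [← hse]
      exact (key i i.2).1
  · rintro ⟨h1, h2⟩ i hi
    cases i with
    | zero =>
      have := h2 ⟨0, hi⟩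
      rwa [← hse] at this
    | succ i =>
      have := h1 (show (⟨i, i.lt_succ_self.trans hi⟩ : Fin l) < ⟨i + 1, hi⟩ from i.lt_succ_self)
      rwa [← hse, ← hse] at this

theorem stepHistory_fst_le_iff {l : ℕ} {xe : ℕ → V} {s : Fin l → ℝ≥0} {se : ℕ → ℝ≥0}
    (hse : ∀ i : Fin l, se i = s i) (hs : StrictMono s) {k : ℕ} (hk : k ≤ l) {v : ℝ≥0} :
    (stepHistory G xe se k).1 ≤ v ↔ ∀ i : Fin l, i.1 < k → s i ≤ v := by
  cases k with
  | zero => exact ⟨fun _ i hi => absurd hi i.1.not_lt_zero, fun _ => zero_le⟩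
  | succ k =>
    have hk' : se k = s ⟨k, hk⟩ := hse ⟨k, hk⟩
    change se k ≤ v ↔ _
    rw [hk']
    exact ⟨fun h i hi => (hs.monotone (Fin.mk_le_mk.mpr (Nat.le_of_lt_succ hi) : i ≤ ⟨k, hk⟩)).trans h,
      fun h => h _ k.lt_succ_self⟩

theorem stepPath_eq_of_mem {l : ℕ} {x : Fin (l + 1) → V}
    (hx : ∀ i : Fin l, G.Adj (x i.castSucc) (x i.succ)) {xe : ℕ → V}
    (hxe : ∀ i : Fin (l + 1), xe i = x i) {s : Fin l → ℝ≥0} (hs : StrictMono s) {se : ℕ → ℝ≥0}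
    (hse : ∀ i : Fin l, se i = s i) {k n : ℕ} (hkn : k ≤ n) (hk : k ≤ l) {v : ℝ≥0}
    (hv : (stepHistory G xe se k).1 ≤ v) (hv' : k < n → k < l → v < se k) :
    stepPath x hx s hs n v = xe k := by
  have h := (stepHistory_fst_le_iff hse hs hk).mp hv
  rw [hxe ⟨k, Nat.lt_succ_of_le hk⟩]
  refine stepFun_eq x hk fun i => ⟨fun hi => ?_, fun hi => ⟨hi.trans_le hkn, h i hi⟩⟩
  by_contra hik
  rw [not_lt] at hik
  have h1 := hv' (hik.trans_lt hi.1) (hik.trans_lt i.2)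
  rw [hse ⟨k, hik.trans_lt i.2⟩] at h1
  exact absurd (h1.trans_le (hs.monotone (Fin.mk_le_mk.mpr hik))) (not_lt.mpr hi.2)

theorem adj_of_forall_fin {l : ℕ} {x : Fin (l + 1) → V}
    (hx : ∀ i : Fin l, G.Adj (x i.castSucc) (x i.succ)) {xe : ℕ → V}
    (hxe : ∀ i : Fin (l + 1), xe i = x i) : ∀ i < l, G.Adj (xe i) (xe (i + 1)) := by
  intro i hi
  have := hx ⟨i, hi⟩
  rw [← hxe, ← hxe] at this
  exact this

theorem stepHistory_snd {l : ℕ} {x : Fin (l + 1) → V}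
    (hx : ∀ i : Fin l, G.Adj (x i.castSucc) (x i.succ)) {xe : ℕ → V}
    (hxe : ∀ i : Fin (l + 1), xe i = x i) {s : Fin l → ℝ≥0} (hs : StrictMono s)
    (hs0 : ∀ i, 0 < s i) {se : ℕ → ℝ≥0} (hse : ∀ i : Fin l, se i = s i) :
    ∀ k ≤ l, (stepHistory G xe se k).2 = stepPath x hx s hs k := by
  have hlt := (stepHistory_fst_lt_iff (G := G) (xe := xe) hse).mpr ⟨hs, hs0⟩
  intro k
  induction k with
  | zero =>
    intro _
    ext v
    exact (stepPath_eq_of_mem (k := 0) hx hxe hs hse le_rfl (Nat.zero_le l) (zero_le (a := v))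
      fun h => absurd h (lt_irrefl 0)).symm
  | succ k ih =>
    intro hk
    have hc := (canAppend_stepHistory (adj_of_forall_fin hx hxe) hlt k (Nat.le_of_succ_le hk)).2 hk
    ext v
    change (stepHistory G xe se k).2.append (stepHistory G xe se k).1 (se k) (xe (k + 1)) v = _
    rcases lt_or_ge v (se k) with hv | hv
    · rw [InfPath.append_of_lt hv, ih (Nat.le_of_succ_le hk)]
      have hfil : ∀ i : Fin l, i.1 < k ∧ s i ≤ v ↔ i.1 < k + 1 ∧ s i ≤ v := by
        refine fun i => ⟨fun h => ⟨h.1.trans k.lt_succ_self, h.2⟩, fun h => ⟨?_, h.2⟩⟩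
        refine lt_of_le_of_ne (Nat.le_of_lt_succ h.1) fun hik => ?_
        rw [← hik, hse i] at hv
        exact absurd h.2 (not_le.mpr hv)
      change stepFun x s k v = stepFun x s (k + 1) v
      simp only [stepFun, hfil]
    · rw [InfPath.append_of_ge hc hv]
      exact (stepPath_eq_of_mem hx hxe hs hse le_rfl hk hv fun h => absurd h (lt_irrefl _)).symm

/-- Consecutive states are adjacent, hence distinct, so the prescribed times of a step path are its
true jump times; conversely a path alive at `t` is constant between its jump times. -/
theorem pathEvent_eq_walkEvent {l : ℕ} {x : Fin (l + 1) → V}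
    (hx : ∀ i : Fin l, G.Adj (x i.castSucc) (x i.succ)) {xe : ℕ → V}
    (hxe : ∀ i : Fin (l + 1), xe i = x i) {D : Fin l → Set ℝ≥0} {De : ℕ → Set ℝ≥0}
    (hDe : ∀ i : Fin l, De i = D i) (t : ℝ≥0) : pathEvent x hx D t = walkEvent G xe De l t := by
  have hadj := adj_of_forall_fin hx hxe
  ext ω
  constructor
  · rintro ⟨s, hs, hsD, hω⟩
    let se : ℕ → ℝ≥0 := fun i => if h : i < l then s ⟨i, h⟩ else 0
    have hse : ∀ i : Fin l, se i = s i := fun i => by simp [se]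
    have hlt := (stepHistory_fst_lt_iff (G := G) (xe := xe) hse).mpr ⟨hs, fun i => (hsD i).1⟩
    have hst : ∀ k < l, se k ≤ t := fun k hk => by
      have := (hsD ⟨k, hk⟩).2.1
      rwa [← hse] at this
    have hat : ∀ k ≤ l, (stepHistory G xe se k).1 ≤ t := fun k hk => by
      cases k with
      | zero => exact zero_le
      | succ k => exact hst k hk
    have hval : ∀ k ≤ l, ∀ v, (stepHistory G xe se k).1 ≤ v → v ≤ t → (k < l → v < se k) →
        ω v = some (xe k) := fun k hk v hv hvt hv' => by
      rw [hω v hvt, stepPath_eq_of_mem hx hxe hs hse hk hk hv fun h _ => hv' h]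
    have hjump : ∀ k ≤ l, ω.jumpTime k = (stepHistory G xe se k).1 := by
      intro k
      induction k with
      | zero => exact fun _ => rfl
      | succ k ih =>
        intro hk
        rw [Path.jumpTime_succ (ih (Nat.le_of_succ_le hk))]
        have hle := Nat.le_of_succ_le hk
        have h0 := hval k hle _ le_rfl (hat k hle) fun h => hlt k h
        refine Path.nextJump_eq_coe_iff.mpr ⟨hlt k hk, fun u hu hu' => ?_, ?_⟩
        · rw [h0]
          exact hval k hle u hu (hu'.le.trans (hst k hk)) fun _ => hu'
        · rw [h0, hval (k + 1) hk _ le_rfl (hat _ hk) fun h => hlt (k + 1) h]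
          exact fun h => (hadj k hk).ne (Option.some_injective _ h).symm
    refine ⟨fun i hi => ?_, ?_, ?_⟩
    · rw [hjump i hi]
      refine ⟨ENNReal.coe_ne_top, ?_, fun h0 => ?_⟩
      · rw [ENNReal.toNNReal_coe]
        exact hval i hi _ le_rfl (hat i hi) fun h => hlt i h
      · obtain ⟨i, rfl⟩ := Nat.exists_eq_succ_of_ne_zero h0
        rw [ENNReal.toNNReal_coe]
        have := (hsD ⟨i, hi⟩).2.2
        rw [← hse, ← hDe] at this
        exact this
    · rw [hjump l le_rfl]
      exact_mod_cast hat l le_rfl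
    · rw [Path.jumpTime_succ (hjump l le_rfl)]
      refine Path.lt_nextJump_iff.mpr fun u hu hu' => ?_
      rw [hval l le_rfl u hu hu' fun h => absurd h (lt_irrefl l),
        hval l le_rfl _ le_rfl (hat l le_rfl) fun h => absurd h (lt_irrefl l)]
  · rintro hω
    have halive : ω t ≠ none := by simp [eq_of_mem_walkEvent hω]
    obtain ⟨h1, h2, h3⟩ := hω
    -- Index `i` carries the time of jump `i + 1`; indices from `l` on, where the jump may not
    -- exist, play no role.
    let se : ℕ → ℝ≥0 := fun i => (ω.jumpTime (i + 1)).toNNReal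
    let s : Fin l → ℝ≥0 := fun i => se i
    have hse : ∀ i : Fin l, se i = s i := fun i => rfl
    have hjump : ∀ k ≤ l, ω.jumpTime k = (stepHistory G xe se k).1 := by
      intro k hk
      cases k with
      | zero => rfl
      | succ k => exact (ENNReal.coe_toNNReal (h1 (k + 1) hk).1).symm
    have hlt : ∀ i < l, (stepHistory G xe se i).1 < se i := fun i hi => by
      have := Path.jumpTime_lt_succ (h1 i hi.le).1
      rw [hjump i hi.le, hjump (i + 1) hi] at this
      exact_mod_cast this
    obtain ⟨hs, hs0⟩ := (stepHistory_fst_lt_iff hse).mp hlt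
    refine ⟨s, hs, fun i => ⟨hs0 i, ?_, ?_⟩, fun v hv => ?_⟩
    · have h4 : ω.jumpTime (i + 1) ≤ t := (ω.jumpTime_mono i.2).trans h2
      rw [hjump (i + 1) i.2] at h4
      exact_mod_cast h4
    · rw [← hDe]
      exact (h1 (i + 1) i.2).2.2 (Nat.succ_ne_zero _)
    · obtain ⟨k, hk1, hk2⟩ := Path.exists_jumpTime_le_lt (Path.alive_of_le hv halive)
      have hkl : k ≤ l := by
        by_contra hkl
        rw [not_le] at hkl
        have h5 : (t : ℝ≥0∞) < v := h3.trans_le ((ω.jumpTime_mono hkl).trans hk1)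
        exact absurd hv (not_le.mpr (by exact_mod_cast h5))
      have hk3 := hjump k hkl
      rw [hk3] at hk1
      rw [Path.eq_of_mem_Ico_jumpTime hk3 (by exact_mod_cast hk1) hk2]
      have h6 := (h1 k hkl).2.1
      rw [hk3, ENNReal.toNNReal_coe] at h6
      rw [h6, stepPath_eq_of_mem hx hxe hs hse hkl hkl (by exact_mod_cast hk1)]
      intro h7 _
      rw [hjump (k + 1) h7] at hk2
      exact_mod_cast hk2

/-! ### The density of the jump times -/

theorem IsTerminatedRates.toReal_cumRate [Countable V] [G.LocallyFinite] (hr : IsTerminatedRates T r)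
    {η : InfPath G} {t : ℝ≥0} (ht : (t : ℝ≥0∞) < T η) :
    (cumRate T r η 0 t).toReal = ∫ v in (0 : ℝ)..t, ∑ y ∈ G.neighborFinset (η v.toNNReal),
      (r v.toNNReal (η v.toNNReal) y η : ℝ) := by
  have hm : Measurable fun v : ℝ => totalRate T r v.toNNReal η :=
    hr.measurable_totalRate.comp (measurable_real_toNNReal.prodMk measurable_const)
  rw [cumRate, ← integral_toReal hm.aemeasurable (ae_of_all _ fun v => by
    rw [totalRate_eq_sum]
    exact ENNReal.coe_lt_top), NNReal.coe_zero, intervalIntegral.integral_of_le t.coe_nonneg]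
  refine setIntegral_congr_fun measurableSet_Ioc fun v hv => ?_
  rw [totalRate_eq_sum, ENNReal.coe_toReal, NNReal.coe_sum]
  refine Finset.sum_congr rfl fun y hy => ?_
  rw [rate_of_lt (lt_of_le_of_lt ?_ ht) (by simpa using hy)]
  exact_mod_cast Real.toNNReal_le_iff_le_coe.mpr hv.2

/-- `stayProb` admits a last jump at `t` itself while `pathDensity` asks for strictly earlier jumps;
the hypothesis `hst` avoids this discrepancy, which concerns a null set only. -/
theorem stepWeight_mul_stayProb [Countable V] [G.LocallyFinite] (hT : IsLSCStoppingTime T)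
    (hr : IsTerminatedRates T r) {l : ℕ} {x : Fin (l + 1) → V}
    (hx : ∀ i : Fin l, G.Adj (x i.castSucc) (x i.succ)) {xe : ℕ → V}
    (hxe : ∀ i : Fin (l + 1), xe i = x i) {D : Fin l → Set ℝ≥0} {De : ℕ → Set ℝ≥0}
    (hDe : ∀ i : Fin l, De i = D i) {t : ℝ≥0} {s : Fin l → ℝ} (hst : ∀ i, s i ≠ t) :
    stepWeight T r xe De (padTimes s) l * stayProb T r t (stepHistory G xe (padTimes s) l) =
      {s : Fin l → ℝ | ∀ i, 0 ≤ s i ∧ (s i).toNNReal ∈ D i}.indicator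
        (fun s => ENNReal.ofReal (pathDensity T r x hx t fun i => (s i).toNNReal)) s := by
  set se := padTimes s with hsed
  have hse : ∀ i : Fin l, se i = (s i).toNNReal := fun i => by simp [hsed, padTimes]
  have hadj := adj_of_forall_fin hx hxe
  by_cases h : ∀ i < l, (stepHistory G xe se i).1 < se i ∧ se i ∈ De i
  · have hlt : ∀ i < l, (stepHistory G xe se i).1 < se i := fun i hi => (h i hi).1
    obtain ⟨hs, hs0⟩ := (stepHistory_fst_lt_iff hse).mp hlt
    have hsD : s ∈ {s : Fin l → ℝ | ∀ i, 0 ≤ s i ∧ (s i).toNNReal ∈ D i} := fun i =>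
      ⟨(Real.toNNReal_pos.mp (hs0 i)).le, by rw [← hse, ← hDe]; exact (h i i.2).2⟩
    rw [indicator_of_mem hsD, pathDensity, dif_pos hs]
    have hsnd := stepHistory_snd hx hxe hs hs0 hse
    have hiff : ((stepHistory G xe se l).1 ≤ t ∧ (t : ℝ≥0∞) < T (stepHistory G xe se l).2) ↔
        (∀ i, 0 < (s i).toNNReal ∧ (s i).toNNReal < t) ∧
          (t : ℝ≥0∞) < T (stepPath x hx _ hs l) := by
      rw [hsnd l le_rfl, stepHistory_fst_le_iff hse hs le_rfl]
      refine and_congr_left fun _ => ⟨fun h' i => ⟨hs0 i, lt_of_le_of_ne (h' i i.2) fun he => ?_⟩,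
        fun h' i _ => (h' i).2.le⟩
      refine hst i ?_
      rw [← he, Real.coe_toNNReal _ (hsD i).1]
    by_cases hc : (stepHistory G xe se l).1 ≤ t ∧ (t : ℝ≥0∞) < T (stepHistory G xe se l).2
    · rw [if_pos (hiff.mp hc), stayProb, if_pos hc, stepWeight_eq hr hlt (fun i hi => (h i hi).2) l le_rfl,
        mul_right_comm, ← expNeg_add, cumRate_add _ zero_le hc.1, mul_comm, ENNReal.ofReal_mul
          (Finset.prod_nonneg fun _ _ => NNReal.coe_nonneg _),
        ENNReal.ofReal_prod_of_nonneg fun _ _ => NNReal.coe_nonneg _, Finset.prod_range]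
      congr 1
      · refine Finset.prod_congr rfl fun j _ => ?_
        have h1 := lt_of_lt_stepHistory hT hadj hlt
          (lt_of_le_of_lt (by exact_mod_cast hc.1) hc.2) j j.2
        have h2 : (stepHistory G xe se j).2 (se j) = x j.castSucc := by
          rw [(canAppend_stepHistory hadj hlt j j.2.le).1 _ (hlt j j.2).le]
          exact hxe j.castSucc
        have h3 : xe (j + 1) = x j.succ := hxe j.succ
        rw [rate_of_lt h1 (by rw [h2, h3]; exact hx j), h2, h3, hsnd j j.2.le, hse j,
          ENNReal.ofReal_coe_nnreal]
      · have h4 := hc.2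
        rw [hsnd l le_rfl] at h4
        rw [expNeg, if_neg (cumRate_stepHistory_ne_top hT hr hadj hlt hc.1 hc.2), hsnd l le_rfl,
          hr.toReal_cumRate h4]
    · rw [if_neg fun h' => hc (hiff.mpr h'), stayProb, if_neg hc]
      simp
  · rw [stepWeight_eq_zero h, zero_mul]
    by_cases hsD : s ∈ {s : Fin l → ℝ | ∀ i, 0 ≤ s i ∧ (s i).toNNReal ∈ D i}
    · rw [indicator_of_mem hsD, pathDensity]
      split_ifs with hs h'
      · exfalso
        have hlt := (stepHistory_fst_lt_iff (G := G) (xe := xe) hse).mpr ⟨hs, fun i => (h'.1 i).1⟩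
        refine h fun i hi => ⟨hlt i hi, ?_⟩
        have := (hsD ⟨i, hi⟩).2
        rw [← hse, ← hDe] at this
        exact this
      · simp
      · simp
    · rw [indicator_of_notMem hsD]

theorem HasJumpRates.measure_pathEvent [Countable V] [G.LocallyFinite] (hT : IsLSCStoppingTime T)
    (hr : IsTerminatedRates T r) {x₀ : V} {P : Measure (Path G)} (hP : HasJumpRates T r x₀ P) {l : ℕ}
    {x : Fin (l + 1) → V} (hx : ∀ i : Fin l, G.Adj (x i.castSucc) (x i.succ))
    {D : Fin l → Set ℝ≥0} (t : ℝ≥0) (hx0 : x 0 = x₀) (hD : ∀ i, MeasurableSet (D i)) :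
    P (pathEvent x hx D t) = ∫⁻ s in {s : Fin l → ℝ | ∀ i, 0 ≤ s i ∧ (s i).toNNReal ∈ D i},
      ENNReal.ofReal (pathDensity T r x hx t (fun i => (s i).toNNReal)) := by
  let xe : ℕ → V := fun i => if h : i < l + 1 then x ⟨i, h⟩ else x₀
  have hxe : ∀ i : Fin (l + 1), xe i = x i := fun i => dif_pos i.2
  let De : ℕ → Set ℝ≥0 := fun i => if h : i < l then D ⟨i, h⟩ else univ
  have hDe : ∀ i : Fin l, De i = D i := fun i => dif_pos i.2
  have hDem : ∀ i, MeasurableSet (De i) := fun i => by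
    by_cases h : i < l
    · simpa [De, h] using hD ⟨i, h⟩
    · simp [De, h]
  have hset : MeasurableSet {s : Fin l → ℝ | ∀ i, 0 ≤ s i ∧ (s i).toNNReal ∈ D i} := by
    have : {s : Fin l → ℝ | ∀ i, 0 ≤ s i ∧ (s i).toNNReal ∈ D i} =
        ⋂ i, ({s | 0 ≤ s i} ∩ {s | (s i).toNNReal ∈ D i}) := by
      ext s
      simp
    rw [this]
    exact .iInter fun i => (measurableSet_le measurable_const (measurable_pi_apply i)).inter
      ((measurable_pi_apply i).real_toNNReal (hD i))
  rw [pathEvent_eq_walkEvent hx hxe hDe, hP.measure_walkEvent hT hr xe ((hxe 0).trans hx0) hDem,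
    jumpIntegral_eq_lintegral hr xe hDem l (measurable_stayProb hT hr t), ← lintegral_indicator hset]
  refine lintegral_congr_ae ?_
  -- Coordinate hyperplanes are Lebesgue null sets.
  have hne : ∀ᵐ s : Fin l → ℝ, ∀ i, s i ≠ t := by
    refine ae_all_iff.mpr fun i => ?_
    have h := Measure.pi_hyperplane (fun _ : Fin l => (volume : Measure ℝ)) i (t : ℝ)
    exact compl_mem_ae_iff.mpr h
  filter_upwards [hne] with s hs
  exact stepWeight_mul_stayProb hT hr hx hxe hDe hs

end

/-! ### Uniqueness of the law -/

section


variable {V : Type*} {G : SimpleGraph V} {T : InfPath G → ℝ≥0∞}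
  {r : ℝ≥0 → V → V → InfPath G → ℝ≥0}

/-- The events that determine a law on `Ω`. -/
def walkEvents (G : SimpleGraph V) : Set (Set (Path G)) :=
  {S | ∃ (x : ℕ → V) (D : ℕ → Set ℝ≥0) (l : ℕ) (t : ℝ≥0), (∀ i, MeasurableSet (D i)) ∧
    S = walkEvent G x D l t}

/-- If the two events are compatible, the itinerary up to `t` is an initial piece of the one up to
`t'`. The event at `t` then only restricts the jump times of the longer one: jumps `1, …, l` obey
both constraints and come by `t`, and jump `l + 1` comes after `t`. -/
theorem walkEvent_inter_of_le {x x' : ℕ → V} {D D' : ℕ → Set ℝ≥0} {l l' : ℕ} {t t' : ℝ≥0}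
    (hD : ∀ i, MeasurableSet (D i)) (hD' : ∀ i, MeasurableSet (D' i)) (ht : t ≤ t')
    (hne : (walkEvent G x D l t ∩ walkEvent G x' D' l' t').Nonempty) :
    walkEvent G x D l t ∩ walkEvent G x' D' l' t' ∈ walkEvents G := by
  obtain ⟨ω₀, ⟨h1, h2, h3⟩, h1', h2', h3'⟩ := hne
  have ht' : (t : ℝ≥0∞) ≤ t' := by exact_mod_cast ht
  have hll : l ≤ l' := by
    by_contra hll
    rw [not_le] at hll
    exact absurd ((h3'.trans_le (ω₀.jumpTime_mono hll)).trans_le (h2.trans ht')) (lt_irrefl _)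
  have hxx : ∀ i ≤ l, x i = x' i := fun i hi => by
    have := (h1 i hi).2.1
    rw [(h1' i (hi.trans hll)).2.1] at this
    exact (Option.some_injective _ this).symm
  refine ⟨x', fun i => D' i ∩ if i < l then D i ∩ Iic t else if i = l then Ioi t else univ, l', t',
    fun i => (hD' i).inter ?_, ?_⟩
  · split_ifs
    · exact (hD i).inter measurableSet_Iic
    · exact measurableSet_Ioi
    · exact .univ
  · ext ω
    constructor
    · rintro ⟨⟨h1, h2, h3⟩, h1', h2', h3'⟩
      refine ⟨fun i hi => ⟨(h1' i hi).1, (h1' i hi).2.1, fun h0 => ⟨(h1' i hi).2.2 h0, ?_⟩⟩, h2', h3'⟩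
      obtain ⟨i, rfl⟩ := Nat.exists_eq_succ_of_ne_zero h0
      change (ω.jumpTime (i + 1)).toNNReal ∈ if i < l then D i ∩ Iic t else if i = l then Ioi t else univ
      have hcoe := ENNReal.coe_toNNReal (h1' (i + 1) hi).1
      split_ifs with hil hil
      · refine ⟨(h1 (i + 1) hil).2.2 h0, ?_⟩
        have := (ω.jumpTime_mono hil).trans h2
        rw [Nat.succ_eq_add_one, ← hcoe] at this
        exact_mod_cast this
      · rw [← hil, ← hcoe] at h3
        exact_mod_cast h3
      · trivial
    · rintro ⟨h1, h2, h3⟩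
      have hmem : ∀ i, i + 1 ≤ l' → (ω.jumpTime (i + 1)).toNNReal ∈ D' i ∩
          if i < l then D i ∩ Iic t else if i = l then Ioi t else univ :=
        fun i hi => (h1 (i + 1) hi).2.2 i.succ_ne_zero
      refine ⟨⟨fun i hi => ⟨(h1 i (hi.trans hll)).1, ?_, fun h0 => ?_⟩, ?_, ?_⟩,
        fun i hi => ⟨(h1 i hi).1, (h1 i hi).2.1, fun h0 => ((h1 i hi).2.2 h0).1⟩, h2, h3⟩
      · rw [hxx i hi]
        exact (h1 i (hi.trans hll)).2.1
      · obtain ⟨i, rfl⟩ := Nat.exists_eq_succ_of_ne_zero h0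
        have := (hmem i (hi.trans hll)).2
        rw [if_pos (show i < l from hi)] at this
        exact this.1
      · rcases Nat.eq_zero_or_pos l with rfl | hl
        · simp
        · obtain ⟨i, rfl⟩ := Nat.exists_eq_succ_of_ne_zero hl.ne'
          have := (hmem i hll).2
          rw [if_pos i.lt_succ_self] at this
          rw [← ENNReal.coe_toNNReal (h1 (i + 1) hll).1]
          exact_mod_cast this.2
      · rcases hll.lt_or_eq with hl | rfl
        · have := (hmem l hl).2
          rw [if_neg (lt_irrefl l), if_pos rfl] at this
          rw [← ENNReal.coe_toNNReal (h1 (l + 1) hl).1]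
          exact_mod_cast this
        · exact lt_of_le_of_lt ht' h3

theorem isPiSystem_walkEvents : IsPiSystem (walkEvents G) := by
  rintro _ ⟨x, D, l, t, hD, rfl⟩ _ ⟨x', D', l', t', hD', rfl⟩ hne
  rcases le_total t t' with h | h
  · exact walkEvent_inter_of_le hD hD' h hne
  · rw [inter_comm] at hne ⊢
    exact walkEvent_inter_of_le hD' hD h hne

/-- Being at `y` at time `t` is a countable union over the finite itineraries that end in `y`; being
dead is the complement of all these. -/
theorem generateFrom_walkEvents [Countable V] :
    (inferInstance : MeasurableSpace (Path G)) = MeasurableSpace.generateFrom (walkEvents G) := by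
  refine le_antisymm (iSup_le fun t => ?_) (MeasurableSpace.generateFrom_le ?_)
  · have hsome : ∀ y, MeasurableSet[MeasurableSpace.generateFrom (walkEvents G)]
        ((fun ω : Path G => ω t) ⁻¹' {some y}) := by
      intro y
      have : (fun ω : Path G => ω t) ⁻¹' {some y} = ⋃ p : Σ l : ℕ, {x : Fin (l + 1) → V // x (Fin.last l) = y},
          walkEvent G (fun i => if h : i < p.1 + 1 then p.2.1 ⟨i, h⟩ else y) (fun _ => univ) p.1 t := by
        ext ω
        rw [mem_iUnion]
        constructor
        · intro hω
          have hω' : ω t = some y := hω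
          have halive : ω t ≠ none := by simp [hω']
          obtain ⟨l, h1, h2⟩ := Path.exists_jumpTime_le_lt halive
          have h3 : ∀ i ≤ l, ω.jumpTime i ≤ t := fun i hi => (ω.jumpTime_mono hi).trans h1
          have h4 : ∀ i ≤ l, ω.jumpTime i ≠ ⊤ := fun i hi => ne_top_of_le_ne_top ENNReal.coe_ne_top (h3 i hi)
          have h5 : ∀ i ≤ l, (ω.jumpTime i).toNNReal ≤ t := fun i hi => by
            simpa using ENNReal.toNNReal_mono ENNReal.coe_ne_top (h3 i hi)
          have h6 : ∀ i ≤ l, ∃ z, ω (ω.jumpTime i).toNNReal = some z := fun i hi =>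
            Option.ne_none_iff_exists'.mp (Path.alive_of_le (h5 i hi) halive)
          have : Nonempty V := ⟨y⟩
          choose! z hz using h6
          have h7 : z l = y := Option.some_injective _ (by
            rw [← hz l le_rfl, ← hω', Path.eq_of_mem_Ico_jumpTime
              (ENNReal.coe_toNNReal (h4 l le_rfl)).symm (h5 l le_rfl) h2])
          refine ⟨⟨l, fun i => z i, h7⟩, fun i hi => ⟨h4 i hi, ?_, fun _ => trivial⟩, h1, h2⟩
          rw [hz i hi]
          have hi' : i < l + 1 := Nat.lt_succ_of_le hi
          simp [hi']
        · rintro ⟨⟨l, x, hx⟩, h⟩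
          change ω t = some y
          rw [eq_of_mem_walkEvent h, dif_pos l.lt_succ_self]
          exact congrArg some hx
      rw [this]
      exact .iUnion fun p => MeasurableSpace.measurableSet_generateFrom
        ⟨_, _, _, _, fun _ => .univ, rfl⟩
    have hmeas : Measurable[MeasurableSpace.generateFrom (walkEvents G)] fun ω : Path G => ω t := by
      refine @measurable_to_countable' _ _ _ _ (_) _ fun o => ?_
      cases o with
      | some y => exact hsome y
      | none =>
        have : (fun ω : Path G => ω t) ⁻¹' {none} = (⋃ y, (fun ω : Path G => ω t) ⁻¹' {some y})ᶜ := by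
          ext ω
          simp only [mem_preimage, mem_singleton_iff, mem_compl_iff, mem_iUnion, not_exists]
          exact ⟨fun h y => by simp [h], fun h => by
            by_contra h'
            obtain ⟨y, hy⟩ := Option.ne_none_iff_exists'.mp h'
            exact h y hy⟩
        rw [this]
        exact (MeasurableSet.iUnion hsome).compl
    exact hmeas.comap_le
  · rintro _ ⟨x, D, l, t, hD, rfl⟩
    exact measurableSet_walkEvent x hD l t

theorem HasJumpRates.isProbabilityMeasure {x₀ : V} {P : Measure (Path G)} (hP : HasJumpRates T r x₀ P) :
    IsProbabilityMeasure P := by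
  obtain ⟨Q, hQp, -, -, -, hm, rfl⟩ := hP
  exact Measure.isProbabilityMeasure_map hm

theorem HasJumpRates.measure_walkEvent_of_ne [Countable V] {x₀ : V} {P : Measure (Path G)}
    (hP : HasJumpRates T r x₀ P) {x : ℕ → V} (hx : x 0 ≠ x₀) {D : ℕ → Set ℝ≥0}
    (hD : ∀ i, MeasurableSet (D i)) (l : ℕ) (t : ℝ≥0) : P (walkEvent G x D l t) = 0 := by
  obtain ⟨Q, hQp, h0, hexp, hev, hm, rfl⟩ := hP
  rw [Measure.map_apply_of_aemeasurable hm (measurableSet_walkEvent x hD l t)]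
  refine measure_mono_null (fun ω hω => ?_) h0
  intro h
  have h1 := (hω.1 0 (Nat.zero_le l)).2.1
  rw [Path.jumpTime_zero, ENNReal.toNNReal_zero] at h1
  by_cases h2 : ((0 : ℝ≥0) : ℝ≥0∞) < deathTime T ω
  · rw [Path.kill_of_lt h2, h] at h1
    exact hx (Option.some_injective _ h1).symm
  · rw [Path.kill_of_not_lt h2] at h1
    exact absurd h1 (by simp)

theorem HasJumpRates.unique [Countable V] [G.LocallyFinite] (hT : IsLSCStoppingTime T)
    (hr : IsTerminatedRates T r) {x₀ : V} {P P' : Measure (Path G)} (hP : HasJumpRates T r x₀ P)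
    (hP' : HasJumpRates T r x₀ P') : P = P' := by
  have := hP.isProbabilityMeasure
  have := hP'.isProbabilityMeasure
  refine ext_of_generate_finite (walkEvents G) generateFrom_walkEvents isPiSystem_walkEvents ?_ (by simp)
  rintro _ ⟨x, D, l, t, hD, rfl⟩
  by_cases hx : x 0 = x₀
  · rw [hP.measure_walkEvent hT hr x hx hD, hP'.measure_walkEvent hT hr x hx hD]
  · rw [hP.measure_walkEvent_of_ne hx hD, hP'.measure_walkEvent_of_ne hx hD]

end

section


variable {V : Type*} {G : SimpleGraph V}

/-! ### Paths built from a chain of jumps -/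

open Classical in
/-- The next state of a chain of histories, if the proposed jump time and target are `z`; the time
`⊤` means that there are no further jumps. -/
def advance (S : ℝ≥0∞ × InfPath G) (z : ℝ × V) : ℝ≥0∞ × InfPath G :=
  if S.1 ≠ ⊤ ∧ CanAppend S.2 S.1.toNNReal z.1.toNNReal z.2 then
    ((z.1.toNNReal : ℝ≥0∞), S.2.append S.1.toNNReal z.1.toNNReal z.2) else (⊤, S.2)

/-- The successive jump times, each with the path frozen after that jump. -/
structure IsJumpChain (x₀ : V) (S : ℕ → ℝ≥0∞ × InfPath G) : Prop where
  zero : S 0 = (0, InfPath.const G x₀)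
  succ : ∀ k, ∃ z, S (k + 1) = advance (S k) z

variable {x₀ : V} {S : ℕ → ℝ≥0∞ × InfPath G}

theorem IsJumpChain.succ_cases (hS : IsJumpChain x₀ S) (k : ℕ) :
    S (k + 1) = (⊤, (S k).2) ∨ ∃ (a v : ℝ≥0) (y : V), (S k).1 = a ∧ CanAppend (S k).2 a v y ∧
      S (k + 1) = ((v : ℝ≥0∞), (S k).2.append a v y) := by
  obtain ⟨z, hz⟩ := hS.succ k
  rw [hz, advance]
  split_ifs with h
  · exact Or.inr ⟨_, _, _, (ENNReal.coe_toNNReal h.1).symm, h.2, rfl⟩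
  · exact Or.inl rfl

theorem IsJumpChain.lt_succ (hS : IsJumpChain x₀ S) {k : ℕ} (h : (S k).1 ≠ ⊤) :
    (S k).1 < (S (k + 1)).1 := by
  rcases hS.succ_cases k with h' | ⟨a, v, y, ha, hc, h'⟩
  · rw [h']
    exact h.lt_top
  · rw [h', ha]
    exact ENNReal.coe_lt_coe.mpr hc.1

theorem IsJumpChain.mono (hS : IsJumpChain x₀ S) : Monotone fun k => (S k).1 := by
  refine monotone_nat_of_le_succ fun k => ?_
  by_cases h : (S k).1 = ⊤
  · rcases hS.succ_cases k with h' | ⟨a, v, y, ha, -, -⟩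
    · change _ ≤ (S (k + 1)).1
      rw [h']
      exact le_top
    · simp [ha] at h
  · exact (hS.lt_succ h).le

theorem IsJumpChain.const (hS : IsJumpChain x₀ S) (k : ℕ) {a : ℝ≥0} (ha : (S k).1 = a) :
    ∀ u, a ≤ u → (S k).2 u = (S k).2 a := by
  cases k with
  | zero =>
    rw [hS.zero]
    exact fun u _ => rfl
  | succ k =>
    rcases hS.succ_cases k with h' | ⟨b, v, y, hb, hc, h'⟩
    · simp [h'] at ha
    · rw [h'] at ha ⊢
      have hva : v = a := ENNReal.coe_injective ha
      subst hva
      intro u hu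
      change (S k).2.append b v y u = (S k).2.append b v y v
      rw [InfPath.append_of_ge hc hu, InfPath.append_of_ge hc le_rfl]

/-- Later stages alter the path only from later jump times on, so before the next jump the `k`-th
path is already final. -/
theorem IsJumpChain.agree (hS : IsJumpChain x₀ S) {k j : ℕ} (hkj : k ≤ j) {t : ℝ≥0}
    (ht : (t : ℝ≥0∞) < (S (k + 1)).1) : (S j).2 t = (S k).2 t := by
  induction j, hkj using Nat.le_induction with
  | base => rfl
  | succ j hj ih =>
    have ht' : (t : ℝ≥0∞) < (S (j + 1)).1 := ht.trans_le (hS.mono (Nat.succ_le_succ hj))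
    rw [← ih]
    rcases hS.succ_cases j with h' | ⟨b, v, y, hb, hc, h'⟩
    · rw [h']
    · rw [h'] at ht' ⊢
      exact InfPath.append_of_lt (ENNReal.coe_lt_coe.mp ht')

open Classical in
/-- The position at time `t`; `none` if infinitely many jumps have happened by then. -/
def chainFun (S : ℕ → ℝ≥0∞ × InfPath G) (t : ℝ≥0) : Option V :=
  if h : ∃ k, (t : ℝ≥0∞) < (S (k + 1)).1 then some ((S (Nat.find h)).2 t) else none

theorem IsJumpChain.chainFun_eq (hS : IsJumpChain x₀ S) {k : ℕ} {t : ℝ≥0}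
    (ht : (t : ℝ≥0∞) < (S (k + 1)).1) : chainFun S t = some ((S k).2 t) := by
  classical
  have h : ∃ k, (t : ℝ≥0∞) < (S (k + 1)).1 := ⟨k, ht⟩
  rw [chainFun, dif_pos h, hS.agree (Nat.find_min' h ht) (Nat.find_spec h)]

theorem exists_lt_of_chainFun_ne {t : ℝ≥0} (h : chainFun S t ≠ none) :
    ∃ k, (t : ℝ≥0∞) < (S (k + 1)).1 := by
  by_contra h'
  exact h (dif_neg h')

/-- The path with the given chain of jumps. -/
def chainPath (S : ℕ → ℝ≥0∞ × InfPath G) (hS : IsJumpChain x₀ S) : Path G where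
  toFun := chainFun S
  absorb := by
    intro s t hst h
    by_contra h'
    obtain ⟨k, hk⟩ := exists_lt_of_chainFun_ne h'
    rw [hS.chainFun_eq (lt_of_le_of_lt (by exact_mod_cast hst) hk)] at h
    exact absurd h (by simp)
  right_cont := by
    intro t
    by_cases h : ∃ k, (t : ℝ≥0∞) < (S (k + 1)).1
    · obtain ⟨k, hk⟩ := h
      have h1 : ∀ᶠ s : ℝ≥0 in 𝓝[>] t, (s : ℝ≥0∞) < (S (k + 1)).1 :=
        (ENNReal.continuous_coe.tendsto t |>.mono_left nhdsWithin_le_nhds).eventually_lt_const hk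
      filter_upwards [h1, (S k).2.right_cont t] with s hs hs'
      rw [hS.chainFun_eq hs, hS.chainFun_eq hk, hs']
    · filter_upwards [self_mem_nhdsWithin] with s hs
      have h' : ¬ ∃ k, (s : ℝ≥0∞) < (S (k + 1)).1 := fun ⟨k, hk⟩ =>
        h ⟨k, lt_trans (by exact_mod_cast hs) hk⟩
      rw [chainFun, chainFun, dif_neg h, dif_neg h']
  left_lim := by
    intro t y hy
    obtain ⟨k, hk⟩ := exists_lt_of_chainFun_ne (S := S) (t := t) (by simp [hy])
    obtain ⟨x, hx, hl⟩ := (S k).2.left_lim t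
    rw [hS.chainFun_eq hk] at hy
    rw [Option.some_injective _ hy] at hx
    refine ⟨x, hx, ?_⟩
    filter_upwards [hl, self_mem_nhdsWithin] with s hs hs'
    rw [hS.chainFun_eq (lt_trans (by exact_mod_cast hs') hk), hs]

theorem chainPath_eq (hS : IsJumpChain x₀ S) {k : ℕ} {t : ℝ≥0}
    (ht : (t : ℝ≥0∞) < (S (k + 1)).1) : chainPath S hS t = some ((S k).2 t) :=
  hS.chainFun_eq ht

theorem exists_lt_of_chainPath_ne (hS : IsJumpChain x₀ S) {t : ℝ≥0} (h : chainPath S hS t ≠ none) :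
    ∃ k, (S k).1 ≤ t ∧ (t : ℝ≥0∞) < (S (k + 1)).1 := by
  classical
  have h' := exists_lt_of_chainFun_ne h
  refine ⟨Nat.find h', ?_, Nat.find_spec h'⟩
  rcases Nat.eq_zero_or_pos (Nat.find h') with h0 | h0
  · rw [h0, hS.zero]
    exact zero_le
  · have := Nat.find_min h' (Nat.sub_lt h0 one_pos)
    rw [show Nat.find h' - 1 + 1 = Nat.find h' from Nat.sub_add_cancel h0] at this
    exact not_lt.mp this

theorem chainPath_zero (hS : IsJumpChain x₀ S) : chainPath S hS 0 = some x₀ := by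
  have h0 : (S 0).1 ≠ ⊤ := by simp [hS.zero]
  have h := hS.lt_succ h0
  rw [chainPath_eq hS (k := 0) (lt_of_le_of_lt zero_le h), hS.zero]
  rfl

variable {k : ℕ} {g : ℝ≥0}

theorem isFrozen_chainPath (hS : IsJumpChain x₀ S) (h1 : (S k).1 ≤ g)
    (h2 : (g : ℝ≥0∞) < (S (k + 1)).1) : IsFrozen (chainPath S hS) g (S k).2 := by
  intro v
  have hk := ENNReal.coe_toNNReal (ne_top_of_le_ne_top ENNReal.coe_ne_top h1)
  rw [← hk] at h1
  rw [chainPath_eq hS (lt_of_le_of_lt (by exact_mod_cast min_le_right v g) h2)]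
  rcases le_total v g with h | h
  · rw [min_eq_left h]
  · have h3 := hS.const k hk.symm
    have h1' : (S k).1.toNNReal ≤ g := by exact_mod_cast h1
    rw [min_eq_right h, h3 g h1', h3 v (h1'.trans h)]

/-- The times of the chain are true jump times, since an appended jump leads to a neighbour and so
to a different state. -/
theorem nextJump_chainPath (hS : IsJumpChain x₀ S) (h1 : (S k).1 ≤ g)
    (h2 : (g : ℝ≥0∞) < (S (k + 1)).1) : (chainPath S hS).nextJump g = (S (k + 1)).1 := by
  have hk := ENNReal.coe_toNNReal (ne_top_of_le_ne_top ENNReal.coe_ne_top h1)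
  rw [← hk] at h1
  have h1' : (S k).1.toNNReal ≤ g := by exact_mod_cast h1
  have h3 := hS.const k hk.symm
  have hconst : ∀ v, g ≤ v → (v : ℝ≥0∞) < (S (k + 1)).1 → chainPath S hS v = chainPath S hS g := by
    intro v hv hv'
    rw [chainPath_eq hS hv', chainPath_eq hS h2, h3 v (h1'.trans hv), h3 g h1']
  rcases hS.succ_cases k with h' | ⟨a, v, y, ha, hc, h'⟩
  · rw [h']
    refine ENNReal.eq_top_of_forall_nnreal_le fun c => le_of_lt (Path.lt_nextJump_iff.mpr ?_)
    intro v hv _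
    exact hconst v hv (by rw [h']; exact ENNReal.coe_lt_top)
  · have hv : (S (k + 1)).1 = v := by rw [h']
    rw [hv] at hconst h2 ⊢
    refine Path.nextJump_eq_coe_iff.mpr ⟨by exact_mod_cast h2, fun u hu hu' =>
      hconst u hu (by exact_mod_cast hu'), ?_⟩
    have h4 : (v : ℝ≥0∞) < (S (k + 1 + 1)).1 := by
      rw [← hv]
      exact hS.lt_succ (by simp [hv])
    rw [chainPath_eq hS h4, chainPath_eq hS (k := k) (t := g) (by rwa [hv]), h',
      h3 g h1', InfPath.append_of_ge hc le_rfl, ha, ENNReal.toNNReal_coe]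
    exact fun h => hc.2.2.ne (Option.some_injective _ h).symm

theorem chainPath_jump (hS : IsJumpChain x₀ S) (h : (S (k + 1)).1 ≠ ⊤) :
    chainPath S hS (S (k + 1)).1.toNNReal = some ((S (k + 1)).2 (S (k + 1)).1.toNNReal) := by
  refine chainPath_eq hS ?_
  rw [ENNReal.coe_toNNReal h]
  exact hS.lt_succ h

/-- At a time of death all chain times have passed. A left limit would make the path constant just
before, but another chain time falls strictly inside that interval. -/
theorem diesOnlyByExplosion_chainPath (hS : IsJumpChain x₀ S) :
    DiesOnlyByExplosion (chainPath S hS) := by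
  intro t ht x hx
  have hle : ∀ k, (S (k + 1)).1 ≤ t := by
    intro k
    by_contra h
    rw [chainPath_eq hS (not_le.mp h)] at ht
    exact absurd ht (by simp)
  have ht0 : 0 < t := by
    refine pos_iff_ne_zero.mpr fun h0 => ?_
    rw [h0, chainPath_zero] at ht
    exact absurd ht (by simp)
  obtain ⟨u, hu, hu'⟩ := (mem_nhdsLT_iff_exists_Ioo_subset' ht0).mp hx
  obtain ⟨w, hw1, hw2⟩ := exists_between (show u < t from hu)
  have hxw : chainPath S hS w = some x := hu' ⟨hw1, hw2⟩
  obtain ⟨k, hk1, hk2⟩ := exists_lt_of_chainPath_ne hS (by simp [hxw] : chainPath S hS w ≠ none)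
  have hfin : (S (k + 1)).1 ≠ ⊤ := ne_top_of_le_ne_top ENNReal.coe_ne_top (hle k)
  have hj := nextJump_chainPath hS hk1 hk2
  rw [← ENNReal.coe_toNNReal hfin] at hj hk2
  have hlt : (S (k + 1)).1.toNNReal < t := by
    have h1 := (hS.lt_succ hfin).trans_le (hle (k + 1))
    rw [← ENNReal.coe_toNNReal hfin] at h1
    exact_mod_cast h1
  refine (Path.nextJump_eq_coe_iff.mp hj).2.2 ?_
  have hwk : w < (S (k + 1)).1.toNNReal := by exact_mod_cast hk2
  rw [hxw]
  exact hu' ⟨hw1.trans hwk, hlt⟩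

end

section


variable {V : Type*} {G : SimpleGraph V} {T : InfPath G → ℝ≥0∞}
  {r : ℝ≥0 → V → V → InfPath G → ℝ≥0}

/-! ### The law of the next jump -/

section

variable [Countable V] [MeasurableSpace V] [DiscreteMeasurableSpace V]

theorem measurableSet_canAppend_prod :
    MeasurableSet {q : (ℝ≥0 × InfPath G) × (ℝ × V) |
      CanAppend q.1.2 q.1.1 q.2.1.toNNReal q.2.2} := by
  have : {q : (ℝ≥0 × InfPath G) × (ℝ × V) | CanAppend q.1.2 q.1.1 q.2.1.toNNReal q.2.2} =
      ⋃ y, {q | q.2.2 = y} ∩ {q | CanAppend q.1.2 q.1.1 q.2.1.toNNReal y} := by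
    ext q
    simp
  rw [this]
  refine .iUnion fun y => ?_
  have h : Measurable fun q : (ℝ≥0 × InfPath G) × (ℝ × V) => (q.1, q.2.1.toNNReal) :=
    measurable_fst.prodMk (measurable_fst.comp measurable_snd).real_toNNReal
  exact ((measurable_snd.comp measurable_snd) (measurableSet_singleton y)).inter
    (h (measurableSet_canAppend y))

theorem measurable_advance :
    Measurable fun q : (ℝ≥0∞ × InfPath G) × (ℝ × V) => advance q.1 q.2 := by
  have hp : Measurable fun q : (ℝ≥0∞ × InfPath G) × (ℝ × V) => ((q.1.1.toNNReal, q.1.2), q.2) :=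
    ((measurable_fst.comp measurable_fst).ennreal_toNNReal.prodMk
      (measurable_snd.comp measurable_fst)).prodMk measurable_snd
  have hset : MeasurableSet {q : (ℝ≥0∞ × InfPath G) × (ℝ × V) |
      q.1.1 ≠ ⊤ ∧ CanAppend q.1.2 q.1.1.toNNReal q.2.1.toNNReal q.2.2} :=
    ((measurable_fst.comp measurable_fst) (measurableSet_singleton ⊤).compl).inter
      (hp measurableSet_canAppend_prod)
  have hext : Measurable fun q : (ℝ≥0 × InfPath G) × (ℝ × V) =>
      extend q.2.2 q.1 q.2.1.toNNReal := by
    have h1 : Measurable fun q : ((ℝ≥0 × InfPath G) × ℝ) × V => extend q.2 q.1.1 q.1.2.toNNReal := by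
      refine measurable_from_prod_countable_left fun y => ?_
      exact (measurable_extend y).comp (measurable_fst.prodMk measurable_snd.real_toNNReal)
    have h2 : Measurable fun q : (ℝ≥0 × InfPath G) × (ℝ × V) => ((q.1, q.2.1), q.2.2) :=
      (measurable_fst.prodMk (measurable_fst.comp measurable_snd)).prodMk
        (measurable_snd.comp measurable_snd)
    exact h1.comp h2
  have hext' := hext.comp hp
  exact Measurable.ite hset ((measurable_fst.comp hext').coe_nnreal_ennreal.prodMk
    (measurable_snd.comp hext')) (measurable_const.prodMk (measurable_snd.comp measurable_fst))

/-- The density of the time and the target of the next jump. -/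
def nextDensity (T : InfPath G → ℝ≥0∞) (r : ℝ≥0 → V → V → InfPath G → ℝ≥0) (p : ℝ≥0 × InfPath G)
    (z : ℝ × V) : ℝ≥0∞ :=
  jumpDensity T r z.2 p.1 p.2 z.1.toNNReal

theorem IsTerminatedRates.measurable_nextDensity (hr : IsTerminatedRates T r) :
    Measurable fun q : (ℝ≥0 × InfPath G) × (ℝ × V) => nextDensity T r q.1 q.2 := by
  have h1 : Measurable fun q : ((ℝ≥0 × InfPath G) × ℝ) × V =>
      jumpDensity T r q.2 q.1.1.1 q.1.1.2 q.1.2.toNNReal := by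
    refine measurable_from_prod_countable_left fun y => ?_
    have h : Measurable fun x : (ℝ≥0 × InfPath G) × ℝ => (x.1, x.2.toNNReal) :=
      measurable_fst.prodMk measurable_snd.real_toNNReal
    exact (hr.measurable_jumpDensity y).comp h
  have h2 : Measurable fun q : (ℝ≥0 × InfPath G) × (ℝ × V) => ((q.1, q.2.1), q.2.2) :=
    (measurable_fst.prodMk (measurable_fst.comp measurable_snd)).prodMk
      (measurable_snd.comp measurable_snd)
  exact h1.comp h2

/-- The total mass of the density of the next jump. -/
def nextMass (T : InfPath G → ℝ≥0∞) (r : ℝ≥0 → V → V → InfPath G → ℝ≥0) (p : ℝ≥0 × InfPath G) :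
    ℝ≥0∞ :=
  ∫⁻ z : ℝ × V, nextDensity T r p z ∂((volume : Measure ℝ).prod Measure.count)

theorem setLIntegral_nextDensity (hr : IsTerminatedRates T r) (p : ℝ≥0 × InfPath G)
    {A : Set (ℝ × V)} (hA : MeasurableSet A) :
    ∫⁻ z in A, nextDensity T r p z ∂((volume : Measure ℝ).prod Measure.count) =
      ∑' y, ∫⁻ v in {v : ℝ | (v, y) ∈ A}, jumpDensity T r y p.1 p.2 v.toNNReal := by
  have hm : Measurable (A.indicator (nextDensity T r p)) :=
    (hr.measurable_nextDensity.comp measurable_prodMk_left).indicator hA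
  rw [← lintegral_indicator hA, lintegral_prod_symm _ hm.aemeasurable, lintegral_count]
  refine tsum_congr fun y => ?_
  have hAy : MeasurableSet {v : ℝ | (v, y) ∈ A} := measurable_prodMk_right hA
  rw [← lintegral_indicator hAy]
  rfl

open Classical in
/-- The law of the time and target of the next jump; the mass left is put at time `-1`. -/
def nextLaw (T : InfPath G → ℝ≥0∞) (r : ℝ≥0 → V → V → InfPath G → ℝ≥0) (x₀ : V)
    (p : ℝ≥0 × InfPath G) : Measure (ℝ × V) :=
  -- For paths frozen from `p.1` on the first case always applies; the second only makes the kernel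
  -- total. Time `-1` stands for no jump: it is truncated to `0`, which never comes after `p.1`, so
  -- `advance` rejects it.
  if nextMass T r p ≤ 1 then
    ((volume : Measure ℝ).prod Measure.count).withDensity (nextDensity T r p) +
      (1 - nextMass T r p) • Measure.dirac (-1, x₀)
  else Measure.dirac (-1, x₀)

omit [Countable V] [DiscreteMeasurableSpace V] in
theorem isProbabilityMeasure_nextLaw (x₀ : V) (p : ℝ≥0 × InfPath G) :
    IsProbabilityMeasure (nextLaw T r x₀ p) := by
  unfold nextLaw
  split_ifs with h
  · constructor
    rw [Measure.add_apply, withDensity_apply _ .univ, Measure.restrict_univ, Measure.smul_apply,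
      measure_univ, smul_eq_mul, mul_one]
    exact add_tsub_cancel_of_le h
  · infer_instance

/-- The law of the next jump as a kernel. -/
def nextKernel (hr : IsTerminatedRates T r) (x₀ : V) :
    ProbabilityTheory.Kernel (ℝ≥0 × InfPath G) (ℝ × V) where
  toFun := nextLaw T r x₀
  measurable' := by
    have hmass : Measurable (nextMass T r) := hr.measurable_nextDensity.lintegral_prod_right'
    refine Measure.measurable_of_measurable_coe _ fun A hA => ?_
    have h1 : Measurable fun p : ℝ≥0 × InfPath G =>
        ∫⁻ z, A.indicator (nextDensity T r p) z ∂((volume : Measure ℝ).prod Measure.count) :=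
      (hr.measurable_nextDensity.indicator (measurable_snd hA)).lintegral_prod_right'
    have : (fun p => nextLaw T r x₀ p A) = fun p => if nextMass T r p ≤ 1 then
        ∫⁻ z, A.indicator (nextDensity T r p) z ∂((volume : Measure ℝ).prod Measure.count) +
          (1 - nextMass T r p) * Measure.dirac (-1, x₀) A else Measure.dirac (-1, x₀) A := by
      funext p
      unfold nextLaw
      split_ifs
      · rw [Measure.add_apply, withDensity_apply _ hA, Measure.smul_apply, lintegral_indicator hA,
          smul_eq_mul]
      · rfl
    rw [this]
    exact Measurable.ite (measurableSet_le hmass measurable_const)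
      (h1.add ((measurable_const.sub hmass).mul_const _)) measurable_const

instance (hr : IsTerminatedRates T r) (x₀ : V) :
    ProbabilityTheory.IsMarkovKernel (nextKernel hr x₀) :=
  ⟨fun p => isProbabilityMeasure_nextLaw x₀ p⟩

variable [G.LocallyFinite] {a c g : ℝ≥0} {η : InfPath G}

theorem nextLaw_apply (hr : IsTerminatedRates T r) (x₀ : V) (hη : ∀ u, a ≤ u → η u = η a)
    {A : Set (ℝ × V)} (hA : MeasurableSet A) (h0 : (-1, x₀) ∉ A) :
    nextLaw T r x₀ (a, η) A =
      ∑' y, ∫⁻ v in {v : ℝ | (v, y) ∈ A}, jumpDensity T r y a η v.toNNReal := by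
  have hm : nextMass T r (a, η) ≤ 1 := by
    have h := setLIntegral_nextDensity hr (a, η) .univ
    simp only [Measure.restrict_univ, mem_univ, ofPred_true] at h
    rw [nextMass, h]
    exact hr.tsum_lintegral_jumpDensity_le hη
  rw [nextLaw, if_pos hm, Measure.add_apply, Measure.smul_apply, Measure.dirac_apply' _ hA,
    indicator_of_notMem h0, smul_zero, add_zero, withDensity_apply _ hA,
    setLIntegral_nextDensity hr (a, η) hA]

omit [Countable V] [MeasurableSpace V] [DiscreteMeasurableSpace V] [G.LocallyFinite] in
theorem lt_advance_iff {z : ℝ × V} :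
    (c : ℝ≥0∞) < (advance ((a : ℝ≥0∞), η) z).1 ↔
      ¬ (CanAppend η a z.1.toNNReal z.2 ∧ z.1.toNNReal ≤ c) := by
  unfold advance
  by_cases h : CanAppend η a z.1.toNNReal z.2
  · rw [if_pos ⟨ENNReal.coe_ne_top, h⟩]
    simp [h]
  · rw [if_neg fun h' => h h'.2]
    simp [h]

omit [Countable V] [MeasurableSpace V] [DiscreteMeasurableSpace V] [G.LocallyFinite] in
theorem advance_jump_iff {y : V} {z : ℝ × V} :
    ((g : ℝ≥0∞) < (advance ((a : ℝ≥0∞), η) z).1 ∧ (advance ((a : ℝ≥0∞), η) z).1 ≤ c ∧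
      (advance ((a : ℝ≥0∞), η) z).2 (advance ((a : ℝ≥0∞), η) z).1.toNNReal = y) ↔
      CanAppend η a z.1.toNNReal z.2 ∧ z.1.toNNReal ∈ Ioc g c ∧ z.2 = y := by
  unfold advance
  by_cases h : CanAppend η a z.1.toNNReal z.2
  · rw [if_pos ⟨ENNReal.coe_ne_top, h⟩]
    have h' := InfPath.append_of_ge h le_rfl
    simp only [ENNReal.toNNReal_coe, h', h, true_and, mem_Ioc, ENNReal.coe_lt_coe, ENNReal.coe_le_coe,
      and_assoc]
  · rw [if_neg fun h' => h h'.2]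
    simp [h]

omit [Countable V] [MeasurableSpace V] [DiscreteMeasurableSpace V] [G.LocallyFinite] in
theorem canAppend_iff_mem (hη : ∀ u, a ≤ u → η u = η a) {y : V} (hy : G.Adj (η a) y) (hag : a ≤ g)
    {v : ℝ} : CanAppend η a v.toNNReal y ∧ v.toNNReal ∈ Ioc g c ↔ v ∈ Ioc (g : ℝ) c := by
  constructor
  · rintro ⟨-, h1, h2⟩
    exact ⟨Real.lt_toNNReal_iff_coe_lt.mp h1, Real.toNNReal_le_iff_le_coe.mp h2⟩
  · intro h
    have h' := toNNReal_mem_Ioc h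
    exact ⟨⟨hag.trans_lt h'.1, hη, hy⟩, h'⟩

theorem nextLaw_jump (hr : IsTerminatedRates T r) (x₀ : V) (hη : ∀ u, a ≤ u → η u = η a)
    (hag : a ≤ g) (y : V) :
    nextLaw T r x₀ (a, η) {z | (g : ℝ≥0∞) < (advance ((a : ℝ≥0∞), η) z).1 ∧
      (advance ((a : ℝ≥0∞), η) z).1 ≤ c ∧
        (advance ((a : ℝ≥0∞), η) z).2 (advance ((a : ℝ≥0∞), η) z).1.toNNReal = y} =
      ∫⁻ v in Ioc (g : ℝ) c, jumpDensity T r y a η v.toNNReal := by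
  simp only [advance_jump_iff]
  have hm : MeasurableSet {z : ℝ × V | CanAppend η a z.1.toNNReal z.2 ∧ z.1.toNNReal ∈ Ioc g c ∧ z.2 = y} := by
    have h1 : MeasurableSet {z : ℝ × V | CanAppend η a z.1.toNNReal z.2} :=
      measurable_prodMk_left (x := (a, η)) measurableSet_canAppend_prod
    exact h1.inter ((measurable_fst.real_toNNReal measurableSet_Ioc).inter
      (measurable_snd (measurableSet_singleton y)))
  rw [nextLaw_apply hr x₀ hη hm, tsum_eq_single y]
  · by_cases hy : G.Adj (η a) y
    · congr 2
      ext v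
      change CanAppend η a v.toNNReal y ∧ v.toNNReal ∈ Ioc g c ∧ y = y ↔ _
      rw [← canAppend_iff_mem hη hy hag]
      simp
    · simp only [jumpDensity_of_not_adj hη hy, lintegral_zero]
  · intro y' hy'
    have : {v : ℝ | (v, y') ∈ {z : ℝ × V | CanAppend η a z.1.toNNReal z.2 ∧ z.1.toNNReal ∈ Ioc g c ∧ z.2 = y}}
        = ∅ := by
      ext v
      simp [hy']
    rw [this]
    simp
  · rintro ⟨h, -⟩
    exact not_lt_zero (lt_of_lt_of_eq h.1 (Real.toNNReal_of_nonpos (by norm_num)))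

/-- Computed through the complement, a jump by time `c`, because that event does not contain the
atom at `-1`. -/
theorem nextLaw_survive (hr : IsTerminatedRates T r) (x₀ : V) (hη : ∀ u, a ≤ u → η u = η a)
    (hac : a ≤ c) (hc : (c : ℝ≥0∞) < T η) :
    nextLaw T r x₀ (a, η) {z | (c : ℝ≥0∞) < (advance ((a : ℝ≥0∞), η) z).1} =
      expNeg (cumRate T r η a c) := by
  have := isProbabilityMeasure_nextLaw (T := T) (r := r) x₀ (a, η)
  simp only [lt_advance_iff]
  have hm : MeasurableSet {z : ℝ × V | CanAppend η a z.1.toNNReal z.2 ∧ z.1.toNNReal ≤ c} := by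
    have h1 : MeasurableSet {z : ℝ × V | CanAppend η a z.1.toNNReal z.2} :=
      measurable_prodMk_left (x := (a, η)) measurableSet_canAppend_prod
    exact h1.inter (measurable_fst.real_toNNReal measurableSet_Iic)
  have hval : nextLaw T r x₀ (a, η) {z : ℝ × V | CanAppend η a z.1.toNNReal z.2 ∧ z.1.toNNReal ≤ c} =
      1 - expNeg (cumRate T r η a c) := by
    rw [nextLaw_apply hr x₀ hη hm, ← hr.tsum_setLIntegral_jumpDensity hη hac hc]
    · refine tsum_congr fun y => ?_
      by_cases hy : G.Adj (η a) y
      · congr 2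
        ext v
        change CanAppend η a v.toNNReal y ∧ v.toNNReal ≤ c ↔ _
        rw [← canAppend_iff_mem hη hy le_rfl]
        exact and_congr_right fun h => ⟨fun h' => ⟨h.1, h'⟩, fun h' => h'.2⟩
      · simp only [jumpDensity_of_not_adj hη hy, lintegral_zero]
    · rintro ⟨h, -⟩
      exact not_lt_zero (lt_of_lt_of_eq h.1 (Real.toNNReal_of_nonpos (by norm_num)))
  have hcompl : {z : ℝ × V | ¬ (CanAppend η a z.1.toNNReal z.2 ∧ z.1.toNNReal ≤ c)} =
      {z : ℝ × V | CanAppend η a z.1.toNNReal z.2 ∧ z.1.toNNReal ≤ c}ᶜ := rfl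
  rw [hcompl, prob_compl_eq_one_sub hm, hval]
  exact ENNReal.sub_sub_cancel ENNReal.one_ne_top (expNeg_le_one _)

end

end

section


variable {V : Type*} {G : SimpleGraph V} {T : InfPath G → ℝ≥0∞}
  {r : ℝ≥0 → V → V → InfPath G → ℝ≥0}

/-! ### The random chain of jumps -/

/-- The chain of jumps in which the `k`-th next jump is sampled by `f` from `e k`. -/
def randomChain (f : ℝ≥0 × InfPath G → unitInterval → ℝ × V) (x₀ : V) (e : ℕ → unitInterval) :
    ℕ → ℝ≥0∞ × InfPath G
  | 0 => (0, InfPath.const G x₀)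
  | k + 1 => advance (randomChain f x₀ e k)
      (f ((randomChain f x₀ e k).1.toNNReal, (randomChain f x₀ e k).2) (e k))

variable {f : ℝ≥0 × InfPath G → unitInterval → ℝ × V} {x₀ : V}

theorem isJumpChain_randomChain (e : ℕ → unitInterval) : IsJumpChain x₀ (randomChain f x₀ e) :=
  ⟨rfl, fun _ => ⟨_, rfl⟩⟩

theorem randomChain_congr {e e' : ℕ → unitInterval} {k : ℕ} (h : ∀ i < k, e i = e' i) :
    randomChain f x₀ e k = randomChain f x₀ e' k := by
  induction k with
  | zero => rfl
  | succ k ih =>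
    rw [randomChain, randomChain, ih fun i hi => h i (hi.trans k.lt_succ_self), h k k.lt_succ_self]

/-- The process with jumps sampled by `f`. -/
def randomPath (f : ℝ≥0 × InfPath G → unitInterval → ℝ × V) (x₀ : V) (e : ℕ → unitInterval) :
    Path G :=
  chainPath (randomChain f x₀ e) (isJumpChain_randomChain e)

/-- The law of independent uniform variables. -/
def uniformLaw : Measure (ℕ → unitInterval) := Measure.infinitePi fun _ => volume

instance : IsProbabilityMeasure uniformLaw := by
  unfold uniformLaw
  infer_instance

section

variable [Countable V] [MeasurableSpace V] [DiscreteMeasurableSpace V]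

theorem measurable_randomChain (hf : Measurable (Function.uncurry f)) (x₀ : V) (k : ℕ) :
    Measurable fun e => randomChain f x₀ e k := by
  induction k with
  | zero => exact measurable_const
  | succ k ih =>
    have h1 : Measurable fun e : ℕ → unitInterval =>
        (((randomChain f x₀ e k).1.toNNReal, (randomChain f x₀ e k).2), e k) :=
      ((measurable_fst.comp ih).ennreal_toNNReal.prodMk (measurable_snd.comp ih)).prodMk
        (measurable_pi_apply k)
    exact measurable_advance.comp (ih.prodMk (hf.comp h1))

theorem measurable_randomPath (hf : Measurable (Function.uncurry f)) (x₀ : V) :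
    Measurable (randomPath f x₀) := by
  refine measurable_to_path fun s A => ?_
  have h : Measurable fun e => randomPath f x₀ e s := by
    have hsome : ∀ y, MeasurableSet ((fun e => randomPath f x₀ e s) ⁻¹' {some y}) := by
      intro y
      have : (fun e => randomPath f x₀ e s) ⁻¹' {some y} = ⋃ k : ℕ,
          {e | (s : ℝ≥0∞) < (randomChain f x₀ e (k + 1)).1} ∩ {e | (randomChain f x₀ e k).2 s = y} := by
        ext e
        simp only [mem_preimage, mem_singleton_iff, mem_iUnion, mem_inter_iff, mem_ofPred_eq]
        constructor
        · intro h
          obtain ⟨k, -, hk⟩ := exists_lt_of_chainPath_ne (isJumpChain_randomChain e)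
            (by rw [randomPath] at h; simp [h] :
              chainPath (randomChain f x₀ e) (isJumpChain_randomChain e) s ≠ none)
          exact ⟨k, hk, Option.some_injective _ ((chainPath_eq (isJumpChain_randomChain e) hk).symm.trans h)⟩
        · rintro ⟨k, hk, h⟩
          rw [randomPath, chainPath_eq (isJumpChain_randomChain e) hk, h]
      rw [this]
      refine .iUnion fun k => ?_
      exact (measurableSet_lt measurable_const (measurable_fst.comp (measurable_randomChain hf x₀ _))).inter
        (((InfPath.measurable_eval s).comp (measurable_snd.comp (measurable_randomChain hf x₀ k)))
          (measurableSet_singleton y))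
    refine measurable_to_countable' fun o => ?_
    cases o with
    | some y => exact hsome y
    | none =>
      have : (fun e => randomPath f x₀ e s) ⁻¹' {none} =
          (⋃ y, (fun e => randomPath f x₀ e s) ⁻¹' {some y})ᶜ := by
        ext e
        simp only [mem_preimage, mem_singleton_iff, mem_compl_iff, mem_iUnion, not_exists]
        exact ⟨fun h y => by simp [h], fun h => by
          by_contra h'
          obtain ⟨y, hy⟩ := Option.ne_none_iff_exists'.mp h'
          exact h y hy⟩
      rw [this]
      exact (MeasurableSet.iUnion hsome).compl
  exact h (t := A) trivial

/-- The `k`-th stage is a function of the variables with index below `k`; `pad` writes it explicitly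
as such. -/
theorem indepFun_randomChain (hf : Measurable (Function.uncurry f)) (x₀ : V) (k : ℕ) :
    ProbabilityTheory.IndepFun (fun e => randomChain f x₀ e k) (fun e => e k) uniformLaw := by
  have h := ProbabilityTheory.iIndepFun_infinitePi (P := fun _ : ℕ => (volume : Measure unitInterval))
    (X := fun _ u => u) (fun _ => measurable_id)
  have h1 := h.indepFun_finset (Finset.range k) {k} (by simp) fun i => measurable_pi_apply i
  let pad : ((i : Finset.range k) → unitInterval) → ℕ → unitInterval := fun u i =>
    if h : i ∈ Finset.range k then u ⟨i, h⟩ else 0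
  have hpad : Measurable pad := by
    refine measurable_pi_iff.mpr fun i => ?_
    by_cases hi : i ∈ Finset.range k
    · simpa only [pad, hi, dif_pos] using measurable_pi_apply _
    · simpa only [pad, hi, dif_neg, not_false_iff] using measurable_const
  have h2 := h1.comp ((measurable_randomChain hf x₀ k).comp hpad)
    (measurable_pi_apply (⟨k, Finset.mem_singleton_self k⟩ : ({k} : Finset ℕ)))
  have h3 : (fun e => randomChain f x₀ e k) = ((fun e => randomChain f x₀ e k) ∘ pad) ∘
      fun (a : ℕ → unitInterval) (i : Finset.range k) => a i := by
    funext e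
    refine randomChain_congr fun i hi => ?_
    simp [pad, hi]
  rw [h3]
  exact h2

/-- By independence the variable `e k` can be integrated out first, which turns the sampling
function `f` into the law of the next jump. -/
theorem lintegral_next_uniformLaw (hr : IsTerminatedRates T r)
    (hf : Measurable (Function.uncurry f)) (hfK : ∀ p, volume.map (f p) = nextKernel hr x₀ p) (k : ℕ)
    {F : (ℝ≥0∞ × InfPath G) × (ℝ × V) → ℝ≥0∞} (hF : Measurable F) :
    ∫⁻ e, F (randomChain f x₀ e k,
        f ((randomChain f x₀ e k).1.toNNReal, (randomChain f x₀ e k).2) (e k)) ∂uniformLaw =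
      ∫⁻ e, (∫⁻ z, F (randomChain f x₀ e k, z)
        ∂(nextLaw T r x₀ ((randomChain f x₀ e k).1.toNNReal, (randomChain f x₀ e k).2))) ∂uniformLaw := by
  have hS := measurable_randomChain hf x₀ k
  have hprod := (indepFun_randomChain hf x₀ k).map_prod_eq_prod_map_map hS.aemeasurable
    (measurable_pi_apply k).aemeasurable
  have huk : uniformLaw.map (fun e => e k) = (volume : Measure unitInterval) :=
    Measure.infinitePi_map_eval _ k
  have hp : Measurable fun q : (ℝ≥0∞ × InfPath G) × unitInterval => ((q.1.1.toNNReal, q.1.2), q.2) :=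
    ((measurable_fst.comp measurable_fst).ennreal_toNNReal.prodMk
      (measurable_snd.comp measurable_fst)).prodMk measurable_snd
  have hg : Measurable fun q : (ℝ≥0∞ × InfPath G) × unitInterval =>
      (q.1, f (q.1.1.toNNReal, q.1.2) q.2) := measurable_fst.prodMk (hf.comp hp)
  have hFg := hF.comp hg
  have h1 := lintegral_map (μ := uniformLaw) hFg (hS.prodMk (measurable_pi_apply k))
  rw [hprod, huk, lintegral_prod _ hFg.aemeasurable, lintegral_map hFg.lintegral_prod_right' hS] at h1
  refine h1.symm.trans (lintegral_congr fun e => ?_)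
  have hfp : Measurable (f ((randomChain f x₀ e k).1.toNNReal, (randomChain f x₀ e k).2)) :=
    hf.comp measurable_prodMk_left
  have h2 := lintegral_map (μ := (volume : Measure unitInterval))
    (hF.comp (measurable_prodMk_left (x := randomChain f x₀ e k))) hfp
  rw [hfK] at h2
  exact h2.symm

end

end

/-! ### The one-step law of the constructed process -/

section


variable {V : Type*} {G : SimpleGraph V} {T : InfPath G → ℝ≥0∞}
  {r : ℝ≥0 → V → V → InfPath G → ℝ≥0}

section

variable [Countable V] [MeasurableSpace V] [DiscreteMeasurableSpace V] [G.LocallyFinite]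
  {f : ℝ≥0 × InfPath G → unitInterval → ℝ × V} {x₀ : V}

/-- The weight `F` serves to compare the law started at the last jump with the law restarted at a
later time `g`. -/
theorem setLIntegral_survive (hr : IsTerminatedRates T r) (hf : Measurable (Function.uncurry f))
    (hfK : ∀ p, volume.map (f p) = nextKernel hr x₀ p) (k : ℕ) {g : ℝ≥0}
    {W : Set (ℝ≥0∞ × InfPath G)} (hW : MeasurableSet W)
    (hWg : ∀ S ∈ W, S.1 ≤ g ∧ (g : ℝ≥0∞) < T S.2) {F : ℝ≥0∞ × InfPath G → ℝ≥0∞} (hF : Measurable F) :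
    ∫⁻ e in {e | randomChain f x₀ e k ∈ W ∧ (g : ℝ≥0∞) < (randomChain f x₀ e (k + 1)).1},
        F (randomChain f x₀ e k) ∂uniformLaw =
      ∫⁻ e in {e | randomChain f x₀ e k ∈ W}, F (randomChain f x₀ e k) *
        expNeg (cumRate T r (randomChain f x₀ e k).2 (randomChain f x₀ e k).1.toNNReal g) ∂uniformLaw := by
  have hSk := measurable_randomChain hf x₀ k
  have hA : MeasurableSet {q : (ℝ≥0∞ × InfPath G) × (ℝ × V) | q.1 ∈ W ∧ (g : ℝ≥0∞) < (advance q.1 q.2).1} :=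
    (measurable_fst hW).inter (measurableSet_lt measurable_const (measurable_fst.comp measurable_advance))
  have h := lintegral_next_uniformLaw hr hf hfK k ((hF.comp measurable_fst).indicator hA)
  have hset : MeasurableSet {e | randomChain f x₀ e k ∈ W ∧
      (g : ℝ≥0∞) < (randomChain f x₀ e (k + 1)).1} := (hSk hW).inter
    (measurableSet_lt measurable_const (measurable_fst.comp (measurable_randomChain hf x₀ _)))
  have hset' : MeasurableSet {e | randomChain f x₀ e k ∈ W} := hSk hW
  rw [← lintegral_indicator hset, ← lintegral_indicator hset']
  refine Eq.trans ?_ (h.trans ?_)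
  · rfl
  · refine lintegral_congr fun e => ?_
    set S := randomChain f x₀ e k with hS
    by_cases hSW : S ∈ W
    · obtain ⟨h1, h2⟩ := hWg S hSW
      have ha := ENNReal.coe_toNNReal (ne_top_of_le_ne_top ENNReal.coe_ne_top h1)
      have hconst := (isJumpChain_randomChain e).const k ha.symm
      rw [← hS] at hconst
      have hag : S.1.toNNReal ≤ g := by
        rw [← ha] at h1
        exact_mod_cast h1
      have h3 := nextLaw_survive hr x₀ hconst hag h2
      rw [ha] at h3
      have hAS : MeasurableSet {z : ℝ × V | (g : ℝ≥0∞) < (advance S z).1} :=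
        measurableSet_lt measurable_const
          (measurable_fst.comp (measurable_advance.comp measurable_prodMk_left))
      rw [indicator_of_mem (show e ∈ {e | randomChain f x₀ e k ∈ W} from hSW), ← h3,
        ← setLIntegral_const, ← lintegral_indicator hAS]
      refine lintegral_congr fun z => ?_
      by_cases hz : (g : ℝ≥0∞) < (advance S z).1
      · rw [indicator_of_mem (show z ∈ {z | (g : ℝ≥0∞) < (advance S z).1} from hz)]
        exact indicator_of_mem (s := {q : (ℝ≥0∞ × InfPath G) × (ℝ × V) |
          q.1 ∈ W ∧ (g : ℝ≥0∞) < (advance q.1 q.2).1}) (a := (S, z)) ⟨hSW, hz⟩ _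
      · rw [indicator_of_notMem (show z ∉ {z | (g : ℝ≥0∞) < (advance S z).1} from hz)]
        exact indicator_of_notMem (s := {q : (ℝ≥0∞ × InfPath G) × (ℝ × V) |
          q.1 ∈ W ∧ (g : ℝ≥0∞) < (advance q.1 q.2).1}) (a := (S, z)) (fun h => hz h.2) _
    · rw [indicator_of_notMem (show e ∉ {e | randomChain f x₀ e k ∈ W} from hSW)]
      refine (lintegral_congr fun z => ?_).trans lintegral_zero
      exact indicator_of_notMem (s := {q : (ℝ≥0∞ × InfPath G) × (ℝ × V) |
          q.1 ∈ W ∧ (g : ℝ≥0∞) < (advance q.1 q.2).1}) (a := (S, z)) (fun h => hSW h.1) _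

theorem uniformLaw_jump (hr : IsTerminatedRates T r) (hf : Measurable (Function.uncurry f))
    (hfK : ∀ p, volume.map (f p) = nextKernel hr x₀ p) (k : ℕ) {g c : ℝ≥0}
    {W : Set (ℝ≥0∞ × InfPath G)} (hW : MeasurableSet W) (hWg : ∀ S ∈ W, S.1 ≤ g) (y : V) :
    uniformLaw {e | randomChain f x₀ e k ∈ W ∧ (g : ℝ≥0∞) < (randomChain f x₀ e (k + 1)).1 ∧
        (randomChain f x₀ e (k + 1)).1 ≤ c ∧ (randomChain f x₀ e (k + 1)).2
          (randomChain f x₀ e (k + 1)).1.toNNReal = y} =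
      ∫⁻ e in {e | randomChain f x₀ e k ∈ W}, (∫⁻ v in Ioc (g : ℝ) c, jumpDensity T r y
        (randomChain f x₀ e k).1.toNNReal (randomChain f x₀ e k).2 v.toNNReal) ∂uniformLaw := by
  have hSk := measurable_randomChain hf x₀ k
  have hev : Measurable fun S : ℝ≥0∞ × InfPath G => S.2 S.1.toNNReal :=
    InfPath.measurable_eval_prod.comp (measurable_fst.ennreal_toNNReal.prodMk measurable_snd)
  have hJ : MeasurableSet {S : ℝ≥0∞ × InfPath G | (g : ℝ≥0∞) < S.1 ∧ S.1 ≤ c ∧ S.2 S.1.toNNReal = y} :=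
    (measurableSet_lt measurable_const measurable_fst).inter
      ((measurableSet_le measurable_fst measurable_const).inter (hev (measurableSet_singleton y)))
  set A : Set ((ℝ≥0∞ × InfPath G) × (ℝ × V)) := {q | q.1 ∈ W ∧ advance q.1 q.2 ∈
    {S : ℝ≥0∞ × InfPath G | (g : ℝ≥0∞) < S.1 ∧ S.1 ≤ c ∧ S.2 S.1.toNNReal = y}} with hAdef
  have hA : MeasurableSet A := (measurable_fst hW).inter (measurable_advance hJ)
  have h := lintegral_next_uniformLaw hr hf hfK k (measurable_one.indicator hA)
  have hset : MeasurableSet {e | randomChain f x₀ e k ∈ W ∧ randomChain f x₀ e (k + 1) ∈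
      {S : ℝ≥0∞ × InfPath G | (g : ℝ≥0∞) < S.1 ∧ S.1 ≤ c ∧ S.2 S.1.toNNReal = y}} :=
    (hSk hW).inter (measurable_randomChain hf x₀ _ hJ)
  have hset' : MeasurableSet {e | randomChain f x₀ e k ∈ W} := hSk hW
  have hlhs := lintegral_indicator_one (μ := uniformLaw) hset
  rw [← lintegral_indicator hset']
  refine hlhs.symm.trans (Eq.trans ?_ (h.trans ?_))
  · rfl
  · refine lintegral_congr fun e => ?_
    set S := randomChain f x₀ e k with hS
    by_cases hSW : S ∈ W
    · have h1 := hWg S hSW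
      have ha := ENNReal.coe_toNNReal (ne_top_of_le_ne_top ENNReal.coe_ne_top h1)
      have hconst := (isJumpChain_randomChain e).const k ha.symm
      rw [← hS] at hconst
      have hag : S.1.toNNReal ≤ g := by
        rw [← ha] at h1
        exact_mod_cast h1
      have h3 := nextLaw_jump (c := c) hr x₀ hconst hag y
      rw [ha] at h3
      have hAS : MeasurableSet {z : ℝ × V | (g : ℝ≥0∞) < (advance S z).1 ∧ (advance S z).1 ≤ c ∧
          (advance S z).2 (advance S z).1.toNNReal = y} :=
        (measurable_advance.comp measurable_prodMk_left) hJ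
      rw [indicator_of_mem (show e ∈ {e | randomChain f x₀ e k ∈ W} from hSW), ← h3,
        ← lintegral_indicator_one hAS]
      refine lintegral_congr fun z => ?_
      by_cases hz : z ∈ {z : ℝ × V | (g : ℝ≥0∞) < (advance S z).1 ∧ (advance S z).1 ≤ c ∧
          (advance S z).2 (advance S z).1.toNNReal = y}
      · rw [indicator_of_mem hz, indicator_of_mem (show (S, z) ∈ A from ⟨hSW, hz⟩)]
        rfl
      · rw [indicator_of_notMem hz, indicator_of_notMem (show (S, z) ∉ A from fun h => hz h.2)]
    · rw [indicator_of_notMem (show e ∉ {e | randomChain f x₀ e k ∈ W} from hSW)]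
      refine (lintegral_congr fun z => ?_).trans lintegral_zero
      exact indicator_of_notMem (show (S, z) ∉ A from fun h => hSW h.1) _

/-- On the event that exactly `k` jumps have happened by time `g`. -/
def stage (f : ℝ≥0 × InfPath G → unitInterval → ℝ × V) (x₀ : V) (g : ℝ≥0) (k : ℕ) :
    Set (ℕ → unitInterval) :=
  {e | (randomChain f x₀ e k).1 ≤ g ∧ (g : ℝ≥0∞) < (randomChain f x₀ e (k + 1)).1}

omit [G.LocallyFinite] in
-- A path alive at `g` has made a definite finite number of jumps, so the identity may be checked
-- for each such number and summed.
theorem measure_eq_of_forall_stage (hf : Measurable (Function.uncurry f)) (g : ℝ≥0)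
    {C C' : Set (ℕ → unitInterval)} (hC : MeasurableSet C) (hC' : MeasurableSet C')
    (hsub : C ⊆ {e | randomPath f x₀ e g ≠ none}) (hsub' : C' ⊆ {e | randomPath f x₀ e g ≠ none})
    {F : (ℕ → unitInterval) → ℝ≥0∞}
    (h : ∀ k, uniformLaw (C' ∩ stage f x₀ g k) = ∫⁻ e in C ∩ stage f x₀ g k, F e ∂uniformLaw) :
    uniformLaw C' = ∫⁻ e in C, F e ∂uniformLaw := by
  have hm : ∀ k, MeasurableSet (stage f x₀ g k) := fun k =>
    (measurableSet_le (measurable_fst.comp (measurable_randomChain hf x₀ _)) measurable_const).inter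
      (measurableSet_lt measurable_const (measurable_fst.comp (measurable_randomChain hf x₀ _)))
  have hdisj : Pairwise (Function.onFun Disjoint (stage f x₀ g)) := by
    intro i j hij
    refine disjoint_left.mpr fun e hi hj => ?_
    have hmono := (isJumpChain_randomChain (f := f) (x₀ := x₀) e).mono
    rcases lt_or_gt_of_ne hij with h | h
    · exact absurd (hi.2.trans_le ((hmono h).trans hj.1)) (lt_irrefl _)
    · exact absurd (hj.2.trans_le ((hmono h).trans hi.1)) (lt_irrefl _)
  have hcov : ∀ {C : Set (ℕ → unitInterval)}, C ⊆ {e | randomPath f x₀ e g ≠ none} →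
      C = ⋃ k, C ∩ stage f x₀ g k := by
    intro C hC
    rw [← inter_iUnion]
    refine (inter_eq_left.mpr fun e he => ?_).symm
    obtain ⟨k, hk⟩ := exists_lt_of_chainPath_ne (isJumpChain_randomChain e) (hC he)
    exact mem_iUnion.mpr ⟨k, hk⟩
  have hdisj' : ∀ C : Set (ℕ → unitInterval),
      Pairwise (Function.onFun Disjoint fun k => C ∩ stage f x₀ g k) := fun C i j hij =>
    (hdisj hij).mono inter_subset_right inter_subset_right
  rw [hcov hsub', hcov hsub, measure_iUnion (hdisj' C') fun k => hC'.inter (hm k),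
    lintegral_iUnion (fun k => hC.inter (hm k)) (hdisj' C)]
  exact tsum_congr h

omit [Countable V] [MeasurableSpace V] [DiscreteMeasurableSpace V] [G.LocallyFinite] in
theorem randomPath_mem_iff_of_stage {g : ℝ≥0} {k : ℕ} {e : ℕ → unitInterval}
    (he : e ∈ stage f x₀ g k) {B : Set (Path G)} (hB : MeasurableSet[Path.filt G g] B) :
    randomPath f x₀ e ∈ B ↔ (randomChain f x₀ e k).2.toPath ∈ B := by
  refine Path.mem_iff_of_filt hB fun s hs => ?_
  have := isFrozen_chainPath (isJumpChain_randomChain e) he.1 he.2 s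
  rw [min_eq_left hs] at this
  exact this

omit [Countable V] [MeasurableSpace V] [DiscreteMeasurableSpace V] [G.LocallyFinite] in
theorem freeze_randomPath_of_stage {g : ℝ≥0} {k : ℕ} {e : ℕ → unitInterval}
    (he : e ∈ stage f x₀ g k) : (randomPath f x₀ e).freeze x₀ g = (randomChain f x₀ e k).2 :=
  ((isFrozen_chainPath (isJumpChain_randomChain e) he.1 he.2).eq_freeze x₀).symm

/-- Lack of memory: with the last jump at `a ≤ g`, the kernel gives the law of the next jump counted
from `a`. Its survival factor splits at `g`; the part up to `g` is the probability of still being in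
the present stage, and the rest is the law restarted at `g`. -/
theorem hasOneStepLaw_randomPath (hT : IsLSCStoppingTime T) (hr : IsTerminatedRates T r)
    (hf : Measurable (Function.uncurry f)) (hfK : ∀ p, volume.map (f p) = nextKernel hr x₀ p) :
    HasOneStepLaw T r x₀ (uniformLaw.map (randomPath f x₀)) := by
  have hΦ := measurable_randomPath hf x₀
  have hW : ∀ (g c : ℝ≥0) {B : Set (Path G)}, MeasurableSet B → MeasurableSet
      {S : ℝ≥0∞ × InfPath G | S.1 ≤ g ∧ S.2.toPath ∈ B ∧ (c : ℝ≥0∞) < T S.2} := fun g c B hB =>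
    (measurableSet_le measurable_fst measurable_const).inter
      (((InfPath.measurable_toPath.comp measurable_snd) hB).inter
        (measurableSet_lt measurable_const (hT.measurable.comp measurable_snd)))
  have hCset : ∀ (g c : ℝ≥0) {B : Set (Path G)}, MeasurableSet[Path.filt G g] B →
      (∀ ω ∈ B, ω g ≠ none ∧ (c : ℝ≥0∞) < T (ω.freeze x₀ g)) → ∀ k,
      randomPath f x₀ ⁻¹' B ∩ stage f x₀ g k = {e | randomChain f x₀ e k ∈
        {S : ℝ≥0∞ × InfPath G | S.1 ≤ g ∧ S.2.toPath ∈ B ∧ (c : ℝ≥0∞) < T S.2} ∧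
          (g : ℝ≥0∞) < (randomChain f x₀ e (k + 1)).1} := by
    intro g c B hB hBc k
    ext e
    constructor
    · rintro ⟨h1, h2⟩
      refine ⟨⟨h2.1, (randomPath_mem_iff_of_stage h2 hB).mp h1, ?_⟩, h2.2⟩
      rw [← freeze_randomPath_of_stage h2]
      exact (hBc _ h1).2
    · rintro ⟨⟨h1, h2, -⟩, h3⟩
      have h4 : e ∈ stage f x₀ g k := ⟨h1, h3⟩
      exact ⟨(randomPath_mem_iff_of_stage h4 hB).mpr h2, h4⟩
  constructor
  · intro g c hgc B hB hBc
    have hBm := Path.filt_le g _ hB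
    have hE := measurableSet_lt_nextJump (G := G) g c
    have hFm : Measurable fun ω : Path G => expNeg (cumRate T r (ω.freeze x₀ g) g c) := by
      have h1 : Measurable fun ω : Path G => ((g, ω.freeze x₀ g), c) :=
        (measurable_const.prodMk (Path.measurable_freeze x₀ g)).prodMk measurable_const
      exact measurable_expNeg.comp (hr.measurable_cumRate.comp h1)
    have hFm' : Measurable fun S : ℝ≥0∞ × InfPath G => expNeg (cumRate T r S.2 g c) := by
      have h1 : Measurable fun S : ℝ≥0∞ × InfPath G => ((g, S.2), c) :=
        (measurable_const.prodMk measurable_snd).prodMk measurable_const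
      exact measurable_expNeg.comp (hr.measurable_cumRate.comp h1)
    rw [Measure.map_apply hΦ (hBm.inter hE), setLIntegral_map hBm hFm hΦ]
    refine measure_eq_of_forall_stage (f := f) (x₀ := x₀) hf g (hΦ hBm) (hΦ (hBm.inter hE))
      (fun e he => (hBc _ he).1) (fun e he => (hBc _ he.1).1) fun k => ?_
    set W := {S : ℝ≥0∞ × InfPath G | S.1 ≤ g ∧ S.2.toPath ∈ B ∧ (c : ℝ≥0∞) < T S.2} with hWdef
    have hWm : MeasurableSet W := hW g c hBm
    have hgc' : (g : ℝ≥0∞) ≤ c := by exact_mod_cast hgc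
    have hleft : randomPath f x₀ ⁻¹' (B ∩ {ω | (c : ℝ≥0∞) < ω.nextJump g}) ∩ stage f x₀ g k =
        {e | randomChain f x₀ e k ∈ W ∧ (c : ℝ≥0∞) < (randomChain f x₀ e (k + 1)).1} := by
      ext e
      constructor
      · rintro ⟨⟨h1, h2⟩, h3⟩
        have h4 : e ∈ randomPath f x₀ ⁻¹' B ∩ stage f x₀ g k := ⟨h1, h3⟩
        rw [hCset g c hB hBc k] at h4
        refine ⟨h4.1, ?_⟩
        have := nextJump_chainPath (isJumpChain_randomChain e) h3.1 h3.2
        rw [← this]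
        exact h2
      · rintro ⟨h1, h2⟩
        have h4 : e ∈ {e | randomChain f x₀ e k ∈ W ∧ (g : ℝ≥0∞) < (randomChain f x₀ e (k + 1)).1} :=
          ⟨h1, hgc'.trans_lt h2⟩
        rw [← hCset g c hB hBc k] at h4
        refine ⟨⟨h4.1, ?_⟩, h4.2⟩
        have := nextJump_chainPath (isJumpChain_randomChain e) h4.2.1 h4.2.2
        rw [← this] at h2
        exact h2
    rw [hleft, ← setLIntegral_one, setLIntegral_survive (F := fun _ => 1) hr hf hfK k hWm
      (fun S hS => ⟨hS.1.trans hgc', hS.2.2⟩) measurable_const]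
    have hright : ∫⁻ e in randomPath f x₀ ⁻¹' B ∩ stage f x₀ g k,
        expNeg (cumRate T r ((randomPath f x₀ e).freeze x₀ g) g c) ∂uniformLaw =
        ∫⁻ e in randomPath f x₀ ⁻¹' B ∩ stage f x₀ g k,
          expNeg (cumRate T r (randomChain f x₀ e k).2 g c) ∂uniformLaw := by
      refine setLIntegral_congr_fun ?_ fun e he => by
        rw [← freeze_randomPath_of_stage he.2]
      exact (hΦ hBm).inter ((measurableSet_le (measurable_fst.comp (measurable_randomChain hf x₀ _))
        measurable_const).inter (measurableSet_lt measurable_const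
          (measurable_fst.comp (measurable_randomChain hf x₀ _))))
    -- The weight is now the survival probability from `g` to `c`; multiplied by that from the last
    -- jump to `g` it gives the other side.
    rw [hright, hCset g c hB hBc k, setLIntegral_survive hr hf hfK k hWm
      (fun S hS => ⟨hS.1, lt_of_le_of_lt hgc' hS.2.2⟩) hFm']
    refine setLIntegral_congr_fun (measurable_randomChain hf x₀ k hWm) fun e he => ?_
    have he' : (randomChain f x₀ e k).1 ≤ g := he.1
    have hag : (randomChain f x₀ e k).1.toNNReal ≤ g := by
      simpa using ENNReal.toNNReal_mono ENNReal.coe_ne_top he'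
    change 1 * expNeg (cumRate T r (randomChain f x₀ e k).2 (randomChain f x₀ e k).1.toNNReal c) = _
    rw [← cumRate_add _ hag hgc, expNeg_add, one_mul, mul_comm]
  · intro g c hgc B hB hBc y
    have hBm := Path.filt_le g _ hB
    have hE := measurableSet_nextJump_state (G := G) g c (some y)
    have hdm : ∀ {Ω : Type _} [MeasurableSpace Ω] {η : Ω → InfPath G}, Measurable η →
        Measurable fun ω => ∫⁻ v in Ioc (g : ℝ) c, jumpDensity T r y g (η ω) v.toNNReal := by
      intro Ω _ η hη
      have h1 : Measurable fun q : Ω × ℝ => ((g, η q.1), q.2.toNNReal) :=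
        (measurable_const.prodMk (hη.comp measurable_fst)).prodMk measurable_snd.real_toNNReal
      exact ((hr.measurable_jumpDensity y).comp h1).lintegral_prod_right'
    rw [Measure.map_apply hΦ (hBm.inter hE), setLIntegral_map hBm (hdm (Path.measurable_freeze x₀ g)) hΦ]
    refine measure_eq_of_forall_stage (f := f) (x₀ := x₀) hf g (hΦ hBm) (hΦ (hBm.inter hE))
      (fun e he => (hBc _ he).1) (fun e he => (hBc _ he.1).1) fun k => ?_
    set W := {S : ℝ≥0∞ × InfPath G | S.1 ≤ g ∧ S.2.toPath ∈ B ∧ (c : ℝ≥0∞) < T S.2} with hWdef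
    have hWm : MeasurableSet W := hW g c hBm
    have hgc' : (g : ℝ≥0∞) ≤ c := by exact_mod_cast hgc
    have hjump : ∀ e ∈ stage f x₀ g k, ((randomPath f x₀ e).nextJump g ≤ c ∧
        randomPath f x₀ e ((randomPath f x₀ e).nextJump g).toNNReal = some y ↔
        (randomChain f x₀ e (k + 1)).1 ≤ c ∧ (randomChain f x₀ e (k + 1)).2
          (randomChain f x₀ e (k + 1)).1.toNNReal = y) := by
      intro e he
      have h1 : (randomPath f x₀ e).nextJump g = (randomChain f x₀ e (k + 1)).1 :=
        nextJump_chainPath (isJumpChain_randomChain e) he.1 he.2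
      rw [h1]
      refine and_congr_right fun h2 => ?_
      have h3 : randomPath f x₀ e _ = _ := chainPath_jump (isJumpChain_randomChain e) (k := k)
        (ne_top_of_le_ne_top ENNReal.coe_ne_top h2)
      rw [h3, Option.some_inj]
    have hleft : randomPath f x₀ ⁻¹' (B ∩ {ω | ω.nextJump g ≤ c ∧
        ω (ω.nextJump g).toNNReal = some y}) ∩ stage f x₀ g k =
        {e | randomChain f x₀ e k ∈ W ∧ (g : ℝ≥0∞) < (randomChain f x₀ e (k + 1)).1 ∧
          (randomChain f x₀ e (k + 1)).1 ≤ c ∧ (randomChain f x₀ e (k + 1)).2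
            (randomChain f x₀ e (k + 1)).1.toNNReal = y} := by
      ext e
      constructor
      · rintro ⟨⟨h1, h2⟩, h3⟩
        have h4 : e ∈ randomPath f x₀ ⁻¹' B ∩ stage f x₀ g k := ⟨h1, h3⟩
        rw [hCset g c hB hBc k] at h4
        exact ⟨h4.1, h4.2, (hjump e h3).mp h2⟩
      · rintro ⟨h1, h2, h3⟩
        have h4 : e ∈ {e | randomChain f x₀ e k ∈ W ∧ (g : ℝ≥0∞) < (randomChain f x₀ e (k + 1)).1} :=
          ⟨h1, h2⟩
        rw [← hCset g c hB hBc k] at h4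
        exact ⟨⟨h4.1, (hjump e h4.2).mpr h3⟩, h4.2⟩
    rw [hleft, uniformLaw_jump hr hf hfK k hWm (fun S hS => hS.1) y]
    have hright : ∫⁻ e in randomPath f x₀ ⁻¹' B ∩ stage f x₀ g k, (∫⁻ v in Ioc (g : ℝ) c,
        jumpDensity T r y g ((randomPath f x₀ e).freeze x₀ g) v.toNNReal) ∂uniformLaw =
        ∫⁻ e in randomPath f x₀ ⁻¹' B ∩ stage f x₀ g k, (∫⁻ v in Ioc (g : ℝ) c,
          jumpDensity T r y g (randomChain f x₀ e k).2 v.toNNReal) ∂uniformLaw := by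
      refine setLIntegral_congr_fun ?_ fun e he => by
        rw [← freeze_randomPath_of_stage he.2]
      exact (hΦ hBm).inter ((measurableSet_le (measurable_fst.comp (measurable_randomChain hf x₀ _))
        measurable_const).inter (measurableSet_lt measurable_const
          (measurable_fst.comp (measurable_randomChain hf x₀ _))))
    rw [hright, hCset g c hB hBc k, setLIntegral_survive hr hf hfK k hWm
      (fun S hS => ⟨hS.1, lt_of_le_of_lt hgc' hS.2.2⟩) (hdm measurable_snd)]
    refine setLIntegral_congr_fun (measurable_randomChain hf x₀ k hWm) fun e he => ?_
    have he' : (randomChain f x₀ e k).1 ≤ g := he.1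
    have hag : (randomChain f x₀ e k).1.toNNReal ≤ g := by
      simpa using ENNReal.toNNReal_mono ENNReal.coe_ne_top he'
    change _ = (∫⁻ v in Ioc (g : ℝ) c, jumpDensity T r y g (randomChain f x₀ e k).2 v.toNNReal) * _
    have hJm : Measurable fun v : ℝ => jumpDensity T r y g (randomChain f x₀ e k).2 v.toNNReal :=
      (hr.measurable_jumpDensity y).comp ((measurable_const (a := (g, (randomChain f x₀ e k).2))).prodMk
        measurable_real_toNNReal)
    rw [mul_comm, ← lintegral_const_mul _ hJm]
    exact setLIntegral_congr_fun measurableSet_Ioc fun v hv =>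
      jumpDensity_mul hag (toNNReal_mem_Ioc hv).1 _

end

end

section


variable {V : Type*} {G : SimpleGraph V} {T : InfPath G → ℝ≥0∞}
  {r : ℝ≥0 → V → V → InfPath G → ℝ≥0}

/-! ### From the one-step law back to infinitesimal rates -/

/-- The random source in `E`, rather than the path, is conditioned on the past of the path; standard
Borel structure is then needed on `E` only. Pushing the result forward by `Φ` gives the conditional
law of the path. -/
theorem exists_isCondLaw {E : Type*} [MeasurableSpace E] [StandardBorelSpace E] {μ : Measure E}
    [IsProbabilityMeasure μ] {Φ : E → Path G} (hΦ : Measurable Φ) (g : ℝ≥0) :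
    ∃ κ, IsCondLaw g (μ.map Φ) κ := by
  have : Nonempty E := μ.nonempty_of_neZero
  have hX : @Measurable _ _ _ (Path.filt G g) Φ := hΦ.mono le_rfl (Path.filt_le g)
  let K := @ProbabilityTheory.condDistrib E (Path G) E _ _ _ _ (Path.filt G g) id Φ μ _
  have hK : ∀ A : Set (Path G), MeasurableSet A →
      Measurable[Path.filt G g] fun ω => K ω (Φ ⁻¹' A) := fun A hA =>
    @ProbabilityTheory.Kernel.measurable_coe _ _ (Path.filt G g) _ K _ (hΦ hA)
  refine ⟨fun ω => (K ω).map Φ, fun ω => ?_, fun A hA => ?_, fun A B hA hB => ?_⟩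
  · have : IsProbabilityMeasure (K ω) := inferInstance
    exact Measure.isProbabilityMeasure_map hΦ.aemeasurable
  · simp only [Measure.map_apply hΦ hA]
    exact hK A hA
  · have hB' := Path.filt_le g _ hB
    simp only [Measure.map_apply hΦ hA]
    rw [Measure.map_apply hΦ (hB'.inter hA),
      setLIntegral_map hB' ((hK A hA).mono (Path.filt_le g) le_rfl) hΦ]
    exact (@ProbabilityTheory.setLIntegral_preimage_condDistrib E (Path G) E _ _ _ _ μ _ Φ id
      (Path.filt G g) _ _ hX aemeasurable_id (hΦ hA) hB).symm

/-- The one-step law is tested only on events inside `A`, where the path is alive and not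
terminated. -/
theorem ae_eq_of_forall_setLIntegral_eq_of_subset {Ω : Type*} {m m0 : MeasurableSpace Ω} (hm : m ≤ m0)
    {μ : Measure Ω} [IsFiniteMeasure μ] {F H : Ω → ℝ≥0∞} (hF : Measurable[m] F)
    (hH : Measurable[m] H) {A : Set Ω} (hA : MeasurableSet[m] A)
    (h : ∀ B, MeasurableSet[m] B → B ⊆ A → ∫⁻ ω in B, F ω ∂μ = ∫⁻ ω in B, H ω ∂μ) :
    ∀ᵐ ω ∂μ, ω ∈ A → F ω = H ω := by
  have h1 : F =ᵐ[(μ.restrict A).trim hm] H := by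
    refine ae_eq_of_forall_setLIntegral_eq_of_sigmaFinite hF hH fun s hs _ => ?_
    rw [setLIntegral_trim hm hF hs, setLIntegral_trim hm hH hs,
      Measure.restrict_restrict (hm _ hs)]
    exact h _ (hs.inter hA) inter_subset_right
  exact (ae_restrict_iff' (hm _ hA)).mp (ae_eq_of_ae_eq_trim h1)

/-- The law of the first jump after `g`, for `c` in a right-dense set of times, determines it for
all `c`. -/
theorem law_of_tendsto [Countable V] [G.LocallyFinite] (hr : IsTerminatedRates T r)
    {μ : Measure (Path G)} [IsProbabilityMeasure μ] {η : InfPath G} {g c : ℝ≥0} (hgc : g ≤ c)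
    (hη : ∀ u, g ≤ u → η u = η g) (hc : (c : ℝ≥0∞) < T η) {d : ℕ → ℝ≥0}
    (hd : Tendsto d atTop (𝓝[>] c))
    (hlaw : ∀ n, (d n : ℝ≥0∞) < T η →
      μ {ω | (d n : ℝ≥0∞) < ω.nextJump g} = expNeg (cumRate T r η g (d n)) ∧
      ∀ y, μ {ω | ω.nextJump g ≤ d n ∧ ω (ω.nextJump g).toNNReal = some y} =
        ∫⁻ v in Ioc (g : ℝ) (d n), jumpDensity T r y g η v.toNNReal) :
    μ {ω | (c : ℝ≥0∞) < ω.nextJump g} = expNeg (cumRate T r η g c) ∧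
    ∀ y, μ {ω | ω.nextJump g ≤ c ∧ ω (ω.nextJump g).toNNReal = some y} =
      ∫⁻ v in Ioc (g : ℝ) c, jumpDensity T r y g η v.toNNReal := by
  obtain ⟨c', hcc', hc'⟩ := ENNReal.lt_iff_exists_nnreal_btwn.mp hc
  have hcc : c < c' := ENNReal.coe_lt_coe.mp hcc'
  have hev : ∀ᶠ n in atTop, c < d n ∧ d n < c' := by
    refine hd.eventually (p := fun w => c < w ∧ w < c') ?_
    filter_upwards [self_mem_nhdsWithin, nhdsWithin_le_nhds (Iio_mem_nhds hcc)] with w h1 h2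
    exact ⟨h1, h2⟩
  -- Approach from the right is essential: when `N = c` both sides are false, as they must be.
  have hiff : ∀ N : ℝ≥0∞, ∀ᶠ n in atTop, ((d n : ℝ≥0∞) < N ↔ (c : ℝ≥0∞) < N) := by
    intro N
    by_cases hN : (c : ℝ≥0∞) < N
    · have h1 : Tendsto (fun n => (d n : ℝ≥0∞)) atTop (𝓝 c) :=
        (ENNReal.continuous_coe.tendsto c).comp (hd.mono_right nhdsWithin_le_nhds)
      filter_upwards [h1.eventually_lt_const hN] with n hn
      exact iff_of_true hn hN
    · filter_upwards [hev] with n hn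
      exact iff_of_false (fun h => hN (lt_trans (ENNReal.coe_lt_coe.mpr hn.1) h)) hN
  have hdlim : Tendsto (fun n => (d n : ℝ)) atTop (𝓝[Icc (g : ℝ) c'] (c : ℝ)) := by
    refine tendsto_nhdsWithin_iff.mpr
      ⟨(NNReal.continuous_coe.tendsto c).comp (hd.mono_right nhdsWithin_le_nhds), ?_⟩
    filter_upwards [hev] with n hn
    exact ⟨by exact_mod_cast hgc.trans hn.1.le, by exact_mod_cast hn.2.le⟩
  have hcmem : (c : ℝ) ∈ Icc (g : ℝ) c' := ⟨by exact_mod_cast hgc, by exact_mod_cast hcc.le⟩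
  have hqc := hr.continuousOn_totalRateReal hη hc'
  have hdT : ∀ n, c < d n ∧ d n < c' → g ≤ d n ∧ (d n : ℝ≥0∞) < T η := fun n hn =>
    ⟨hgc.trans hn.1.le, (ENNReal.coe_lt_coe.mpr hn.2).trans hc'⟩
  constructor
  · have h1 : Tendsto (fun n => μ {ω : Path G | (d n : ℝ≥0∞) < ω.nextJump g}) atTop
        (𝓝 (μ {ω | (c : ℝ≥0∞) < ω.nextJump g})) :=
      tendsto_measure_of_tendsto_indicator atTop (fun n => measurableSet_lt_nextJump g (d n))
        MeasurableSet.univ (measure_ne_top μ _) (.of_forall fun _ => subset_univ _)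
        fun ω => hiff (ω.nextJump g)
    have h2 : Tendsto (fun n => ENNReal.ofReal (Real.exp (-∫ v in (g : ℝ)..(d n : ℝ),
        totalRateReal T r g η v))) atTop (𝓝 (ENNReal.ofReal (Real.exp (-∫ v in (g : ℝ)..c,
        totalRateReal T r g η v)))) :=
      ENNReal.tendsto_ofReal (((continuousOn_integral_Icc hqc).neg.rexp c hcmem).tendsto.comp hdlim)
    rw [hr.expNeg_cumRate_eq hη hgc hc]
    refine tendsto_nhds_unique h1 (h2.congr' ?_)
    filter_upwards [hev] with n hn
    rw [(hlaw n (hdT n hn).2).1, hr.expNeg_cumRate_eq hη (hdT n hn).1 (hdT n hn).2]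
  · intro y
    have h1 : Tendsto (fun n => μ {ω : Path G | ω.nextJump g ≤ d n ∧
        ω (ω.nextJump g).toNNReal = some y}) atTop
        (𝓝 (μ {ω | ω.nextJump g ≤ c ∧ ω (ω.nextJump g).toNNReal = some y})) :=
      tendsto_measure_of_tendsto_indicator atTop (fun n => measurableSet_nextJump_state g (d n) _)
        MeasurableSet.univ (measure_ne_top μ _) (.of_forall fun _ => subset_univ _)
        fun ω => by
          filter_upwards [hiff (ω.nextJump g)] with n hn
          exact and_congr_left fun _ => not_lt.symm.trans (hn.not.trans not_lt)
    have h2 : Tendsto (fun n => ENNReal.ofReal (∫ v in (g : ℝ)..(d n : ℝ), Real.exp (-∫ w in (g : ℝ)..v,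
        totalRateReal T r g η w) * rate T r y v.toNNReal η)) atTop (𝓝 (ENNReal.ofReal
        (∫ v in (g : ℝ)..c, Real.exp (-∫ w in (g : ℝ)..v, totalRateReal T r g η w) *
          rate T r y v.toNNReal η))) :=
      ENNReal.tendsto_ofReal ((continuousOn_integral_Icc ((continuousOn_integral_Icc hqc).neg.rexp.mul
        (hr.continuousOn_rate_real y hη hc')) c hcmem).tendsto.comp hdlim)
    rw [hr.setLIntegral_jumpDensity_eq y hη le_rfl hgc hc]
    refine tendsto_nhds_unique h1 (h2.congr' ?_)
    filter_upwards [hev] with n hn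
    rw [(hlaw n (hdT n hn).2).2 y,
      hr.setLIntegral_jumpDensity_eq y hη le_rfl (hdT n hn).1 (hdT n hn).2]

/-- The infinitesimal description of the first jump after `g`, from its law. -/
theorem increments_of_law [Countable V] [G.LocallyFinite] (hr : IsTerminatedRates T r)
    {μ : Measure (Path G)} [IsProbabilityMeasure μ] {η : InfPath G} {g : ℝ≥0}
    (hη : ∀ u, g ≤ u → η u = η g) (hx : ∀ᵐ ω ∂μ, ω g = some (η g))
    (hlaw : ∀ c, g ≤ c → (c : ℝ≥0∞) < T η →
      μ {ω | (c : ℝ≥0∞) < ω.nextJump g} = expNeg (cumRate T r η g c) ∧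
      ∀ y, μ {ω | ω.nextJump g ≤ c ∧ ω (ω.nextJump g).toNNReal = some y} =
        ∫⁻ v in Ioc (g : ℝ) c, jumpDensity T r y g η v.toNNReal)
    {y : V} (hy : G.Adj (η g) y) {b : ℝ≥0} (hb : (b : ℝ≥0∞) < T η) {ε : ℝ}
    (hε : 0 < ε) :
    ∃ δ : ℝ≥0, 0 < δ ∧ ∀ u h : ℝ≥0, g ≤ u → u ≤ b → 0 < h → h < δ →
      |μ.real (firstJump G (η g) y g u h)
        - μ.real (stays G (η g) g u) * (r u (η g) y η * h)|
          ≤ μ.real (stays G (η g) g u) * (ε * h) := by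
  -- Room beyond `b`, so that `u + h` stays in a compact interval on which the rates are continuous.
  obtain ⟨c, hbc', hc⟩ := ENNReal.lt_iff_exists_nnreal_btwn.mp hb
  have hbc : b < c := ENNReal.coe_lt_coe.mp hbc'
  have hqc := hr.continuousOn_totalRateReal hη hc
  have hρc := hr.continuousOn_rate_real y hη hc
  set q := totalRateReal T r g η with hq
  set ρ : ℝ → ℝ := fun v => rate T r y v.toNNReal η with hρ
  have hstays : ∀ u, g ≤ u → u ≤ c → μ.real (stays G (η g) g u) =
      Real.exp (-∫ v in (g : ℝ)..u, q v) := by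
    intro u hgu huc
    have huT : (u : ℝ≥0∞) < T η := lt_of_le_of_lt (ENNReal.coe_le_coe.mpr huc) hc
    have h1 : μ (stays G (η g) g u) = μ {ω | (u : ℝ≥0∞) < ω.nextJump g} := by
      rw [stays_eq hgu]
      refine measure_congr (eventuallyEq_set.mpr ?_)
      filter_upwards [hx] with ω hω
      exact ⟨fun h => h.2, fun h => ⟨hω, h⟩⟩
    rw [measureReal_def, h1, (hlaw u hgu huT).1, hr.expNeg_cumRate_eq hη hgu huT,
      ENNReal.toReal_ofReal (Real.exp_nonneg _)]
  have hJ : ∀ u, g ≤ u → u ≤ c → μ.real (jumpBy G (η g) y g u) =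
      ∫ v in (g : ℝ)..u, Real.exp (-∫ w in (g : ℝ)..v, q w) * ρ v := by
    intro u hgu huc
    have huT : (u : ℝ≥0∞) < T η := lt_of_le_of_lt (ENNReal.coe_le_coe.mpr huc) hc
    have h1 : μ (jumpBy G (η g) y g u) =
        μ {ω | ω.nextJump g ≤ u ∧ ω (ω.nextJump g).toNNReal = some y} := by
      refine measure_congr (eventuallyEq_set.mpr ?_)
      filter_upwards [hx] with ω hω
      exact ⟨fun h => h.2, fun h => ⟨hω, h⟩⟩
    rw [measureReal_def, h1, (hlaw u hgu huT).2 y, hr.setLIntegral_jumpDensity_eq y hη le_rfl hgu huT,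
      ENNReal.toReal_ofReal]
    exact intervalIntegral.integral_nonneg (by exact_mod_cast hgu) fun v _ => by positivity
  have hint : ContinuousOn (fun v => Real.exp (-∫ w in (g : ℝ)..v, q w) * ρ v) (Icc (g : ℝ) c) :=
    (continuousOn_integral_Icc hqc).neg.rexp.mul hρc
  obtain ⟨δ, hδ, hδc, hinc⟩ := uniform_increment_of_continuousOn (a := g) (b := b) (c := c)
    (by exact_mod_cast hbc) hqc hρc (fun u _ => totalRateReal_nonneg g η u) hε
  refine ⟨δ.toNNReal, Real.toNNReal_pos.mpr hδ, fun u h hgu hub hh hhδ => ?_⟩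
  have hhδ' : (h : ℝ) < δ := Real.lt_toNNReal_iff_coe_lt.mp hhδ
  have huh : u + h ≤ c := by
    have : (u : ℝ) ≤ b := by exact_mod_cast hub
    have : (u : ℝ) + h ≤ c := by linarith
    exact_mod_cast this
  have huc : u ≤ c := le_self_add.trans huh
  have e1 : (g : ℝ) ≤ u := by exact_mod_cast hgu
  have e2 : (u : ℝ) ≤ u + h := by linarith [h.coe_nonneg]
  have e3 : (u : ℝ) + h ≤ c := by exact_mod_cast huh
  have hrate : (r u (η g) y η : ℝ) = ρ u := by
    simp only [hρ, Real.toNNReal_coe]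
    rw [rate_of_lt (lt_of_le_of_lt (ENNReal.coe_le_coe.mpr huc) hc), hη _ hgu]
    rwa [hη _ hgu]
  rw [firstJump_eq hy hgu, measureReal_sdiff (jumpBy_mono _ _ _ le_self_add)
      (measurableSet_jumpBy _ _ _ _), hJ _ (hgu.trans le_self_add) huh, hJ u hgu huc,
    hstays u hgu huc, hrate, NNReal.coe_add]
  -- The survival probability up to `u` factors out of the increment, so the error is proportional
  -- to it even when it is small.
  have hsplit : (∫ v in (g : ℝ)..(u + h : ℝ), Real.exp (-∫ w in (g : ℝ)..v, q w) * ρ v) -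
      ∫ v in (g : ℝ)..u, Real.exp (-∫ w in (g : ℝ)..v, q w) * ρ v =
      Real.exp (-∫ v in (g : ℝ)..u, q v) *
        ∫ v in (u : ℝ)..(u + h : ℝ), Real.exp (-∫ w in (u : ℝ)..v, q w) * ρ v := by
    rw [intervalIntegral.integral_interval_sub_left
      ((hint.mono (Icc_subset_Icc_right e3)).intervalIntegrable_of_Icc (e1.trans e2))
      ((hint.mono (Icc_subset_Icc_right (e2.trans e3))).intervalIntegrable_of_Icc e1),
      ← intervalIntegral.integral_const_mul]
    refine intervalIntegral.integral_congr fun v hv => ?_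
    rw [uIcc_of_le e2] at hv
    have h1 := intervalIntegral.integral_add_adjacent_intervals (μ := volume)
      ((hqc.mono (Icc_subset_Icc_right (e2.trans e3))).intervalIntegrable_of_Icc e1)
      ((hqc.mono (Icc_subset_Icc e1 (hv.2.trans e3))).intervalIntegrable_of_Icc hv.1)
    rw [← h1, neg_add, Real.exp_add, mul_assoc]
  rw [hsplit, ← mul_sub, abs_mul, abs_of_nonneg (Real.exp_nonneg _)]
  exact mul_le_mul_of_nonneg_left (hinc u h e1 (by exact_mod_cast hub) (by exact_mod_cast hh) hhδ')
    (Real.exp_nonneg _)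

/-- For one fixed `c` the identity holds almost surely. A common null set is available for the
countably many grid times, and right continuity in `c` extends it to all times. -/
theorem HasOneStepLaw.ae_condLaw [Countable V] [G.LocallyFinite] (hT : IsLSCStoppingTime T)
    (hr : IsTerminatedRates T r) {x₀ : V} {Q : Measure (Path G)} [IsProbabilityMeasure Q]
    (h : HasOneStepLaw T r x₀ Q) {g : ℝ≥0} {κ : Path G → Measure (Path G)} (hκ : IsCondLaw g Q κ) :
    ∀ᵐ ω ∂Q, ω g ≠ none → ∀ c : ℝ≥0, g ≤ c → (c : ℝ≥0∞) < T (ω.freeze x₀ g) →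
      κ ω {ω | (c : ℝ≥0∞) < ω.nextJump g} = expNeg (cumRate T r (ω.freeze x₀ g) g c) ∧
      ∀ y, κ ω {ω | ω.nextJump g ≤ c ∧ ω (ω.nextJump g).toNNReal = some y} =
        ∫⁻ v in Ioc (g : ℝ) c, jumpDensity T r y g (ω.freeze x₀ g) v.toNNReal := by
  have hA : ∀ c : ℝ≥0, MeasurableSet[Path.filt G g]
      {ω : Path G | ω g ≠ none ∧ (c : ℝ≥0∞) < T (ω.freeze x₀ g)} := fun c =>
    MeasurableSet.inter (Path.measurableSet_filt_alive g)
      (Path.measurable_freeze_filt x₀ g (hT.measurable measurableSet_Ioi))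
  have key : ∀ c : ℝ≥0, g ≤ c → ∀ᵐ ω ∂Q, ω g ≠ none ∧ (c : ℝ≥0∞) < T (ω.freeze x₀ g) →
      κ ω {ω | (c : ℝ≥0∞) < ω.nextJump g} = expNeg (cumRate T r (ω.freeze x₀ g) g c) ∧
      ∀ y, κ ω {ω | ω.nextJump g ≤ c ∧ ω (ω.nextJump g).toNNReal = some y} =
        ∫⁻ v in Ioc (g : ℝ) c, jumpDensity T r y g (ω.freeze x₀ g) v.toNNReal := by
    intro c hgc
    have h1 : ∀ᵐ ω ∂Q, ω g ≠ none ∧ (c : ℝ≥0∞) < T (ω.freeze x₀ g) →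
        κ ω {ω | (c : ℝ≥0∞) < ω.nextJump g} = expNeg (cumRate T r (ω.freeze x₀ g) g c) := by
      have hm : Measurable fun η : InfPath G => expNeg (cumRate T r η g c) := by
        have h2 : Measurable fun η : InfPath G => ((g, η), c) :=
          (measurable_const.prodMk measurable_id).prodMk measurable_const
        exact measurable_expNeg.comp (hr.measurable_cumRate.comp h2)
      refine ae_eq_of_forall_setLIntegral_eq_of_subset (Path.filt_le g)
        (hκ.meas _ (measurableSet_lt_nextJump g c)) (hm.comp (Path.measurable_freeze_filt x₀ g))
        (hA c) fun B hB hBA => ?_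
      rw [← hκ.disint _ B (measurableSet_lt_nextJump g c) hB]
      exact h.survive g c hgc B hB fun ω hω => hBA hω
    have h2 : ∀ y, ∀ᵐ ω ∂Q, ω g ≠ none ∧ (c : ℝ≥0∞) < T (ω.freeze x₀ g) →
        κ ω {ω | ω.nextJump g ≤ c ∧ ω (ω.nextJump g).toNNReal = some y} =
          ∫⁻ v in Ioc (g : ℝ) c, jumpDensity T r y g (ω.freeze x₀ g) v.toNNReal := by
      intro y
      have hm : Measurable fun η : InfPath G =>
          ∫⁻ v in Ioc (g : ℝ) c, jumpDensity T r y g η v.toNNReal := by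
        have h2 : Measurable fun q : InfPath G × ℝ => ((g, q.1), q.2.toNNReal) :=
          (measurable_const.prodMk measurable_fst).prodMk measurable_snd.real_toNNReal
        exact ((hr.measurable_jumpDensity y).comp h2).lintegral_prod_right'
      refine ae_eq_of_forall_setLIntegral_eq_of_subset (Path.filt_le g)
        (hκ.meas _ (measurableSet_nextJump_state g c _)) (hm.comp (Path.measurable_freeze_filt x₀ g))
        (hA c) fun B hB hBA => ?_
      rw [← hκ.disint _ B (measurableSet_nextJump_state g c _) hB]
      exact h.jump g c hgc B hB (fun ω hω => hBA hω) y
    filter_upwards [h1, ae_all_iff.mpr h2] with ω hω1 hω2 hω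
    exact ⟨hω1 hω, fun y => hω2 y hω⟩
  have hgrid : ∀ᵐ ω ∂Q, ∀ n, ∀ c ∈ range (gridAbove n), g ≤ c →
      (ω g ≠ none ∧ (c : ℝ≥0∞) < T (ω.freeze x₀ g) →
      κ ω {ω | (c : ℝ≥0∞) < ω.nextJump g} = expNeg (cumRate T r (ω.freeze x₀ g) g c) ∧
      ∀ y, κ ω {ω | ω.nextJump g ≤ c ∧ ω (ω.nextJump g).toNNReal = some y} =
        ∫⁻ v in Ioc (g : ℝ) c, jumpDensity T r y g (ω.freeze x₀ g) v.toNNReal) := by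
    refine ae_all_iff.mpr fun n => (ae_ball_iff (countable_range_gridAbove n)).mpr fun c _ => ?_
    by_cases hgc : g ≤ c
    · filter_upwards [key c hgc] with ω hω _ using hω
    · exact .of_forall fun _ h => absurd h hgc
  filter_upwards [hgrid] with ω hω hg c hgc hc
  have := hκ.prob ω
  exact law_of_tendsto hr hgc (fun u hu => Path.freeze_const x₀ g ω hu) hc (tendsto_gridAbove c)
    fun n hn => hω n _ (mem_range_self c) (hgc.trans (lt_gridAbove n c).le) ⟨hg, hn⟩

theorem HasOneStepLaw.evolvesWithRates [Countable V] [G.LocallyFinite] (hT : IsLSCStoppingTime T)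
    (hr : IsTerminatedRates T r) {x₀ : V} {Q : Measure (Path G)} [IsProbabilityMeasure Q]
    (h : HasOneStepLaw T r x₀ Q) (hcond : ∀ g, ∃ κ, IsCondLaw g Q κ) : EvolvesWithRates T r Q := by
  intro g
  obtain ⟨κ, hκ⟩ := hcond g
  refine ⟨κ, hκ, ?_⟩
  have h1 : ∀ᵐ ω ∂Q, ∀ x : V, ω g = some x → κ ω {ω' | ω' g = some x}ᶜ = 0 :=
    ae_all_iff.mpr fun x =>
      hκ.ae_compl_eq_zero (Path.measurableSet_filt_eval le_rfl ({some x} : Set (Option V)))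
  filter_upwards [h1, h.ae_condLaw hT hr hκ] with ω h1ω hω η hη _ y hy b _ hb ε hε
  have := hκ.prob ω
  have hg : ω g ≠ none := hη.alive
  rw [hη.eq_freeze x₀] at hy hb ⊢
  exact increments_of_law hr (fun u hu => Path.freeze_const x₀ g ω hu)
    (h1ω _ (Path.freeze_of_le hg le_rfl).symm) (hω hg) hy hb hε

/-! ### Existence -/

theorem measurable_kill_deathTime (hT : IsLSCStoppingTime T) (x₀ : V) :
    Measurable fun ω : Path G => ω.kill (deathTime T ω) := by
  refine measurable_to_path fun t A => ?_
  have hB : MeasurableSet {ω : Path G | (t : ℝ≥0∞) < T (ω.freeze x₀ t)} :=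
    Path.measurable_freeze x₀ t (hT.measurable measurableSet_Ioi)
  have : {ω : Path G | ω.kill (deathTime T ω) t ∈ A} =
      ({ω | ω t ∈ A} ∩ {ω | (t : ℝ≥0∞) < T (ω.freeze x₀ t)}) ∪
      ({ω | ω t ∈ A} ∩ {ω | ω t ∈ ({none} : Set (Option V))}) ∪
      ({ω : Path G | none ∈ A} ∩ ({ω | (t : ℝ≥0∞) < T (ω.freeze x₀ t)}ᶜ)) := by
    ext ω
    simp only [mem_ofPred_eq, mem_union, mem_inter_iff, mem_compl_iff, mem_singleton_iff]
    by_cases hω : ω t = none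
    · have hk : ω.kill (deathTime T ω) t = none := by
        simp only [Path.kill, hω, ite_self]
      rw [hk, hω]
      tauto
    · by_cases h : (t : ℝ≥0∞) < deathTime T ω
      · rw [Path.kill_of_lt h]
        have h' := (lt_deathTime_iff hT hω x₀).mp h
        tauto
      · rw [Path.kill_of_not_lt h]
        have h' := fun hc => h ((lt_deathTime_iff hT hω x₀).mpr hc)
        tauto
  rw [this]
  have he := fun B : Set (Option V) => Path.measurable_eval (G := G) t (MeasurableSpace.measurableSet_top (s := B))
  exact (((he A).inter hB).union ((he A).inter (he {none}))).union
    ((MeasurableSet.const _).inter hB.compl)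

/-- No jump of the path leads to the cemetery. -/
def JumpsInside (ω : Path G) : Prop :=
  ω 0 ≠ none ∧ ∀ k, ω.jumpTime (k + 1) ≠ ⊤ → ω (ω.jumpTime (k + 1)).toNNReal ≠ none

theorem measurableSet_jumpsInside [Countable V] : MeasurableSet {ω : Path G | JumpsInside ω} := by
  have : {ω : Path G | JumpsInside ω} = {ω | ω 0 ∈ ({none}ᶜ : Set (Option V))} ∩
      ⋂ k, {ω | ω.jumpTime (k + 1) ≠ ⊤ → ω (ω.jumpTime (k + 1)).toNNReal ∈ ({none}ᶜ : Set (Option V))} := by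
    ext ω
    simp [JumpsInside]
  rw [this]
  refine (Path.measurable_eval 0 (.of_discrete)).inter (.iInter fun k => .imp ?_ ?_)
  · exact (Path.measurable_jumpTime (k + 1) (measurableSet_singleton ⊤)).compl
  · exact Path.measurable_jumpState (k + 1) (.of_discrete)

/-- Replaces a condition at all times by one at the countably many jump times. That form is
measurable, so it passes to the image law; the converse below restores the original one. -/
theorem DiesOnlyByExplosion.jumpsInside {ω : Path G} (h : DiesOnlyByExplosion ω) (h0 : ω 0 ≠ none) :
    JumpsInside ω := by
  refine ⟨h0, fun k => ?_⟩
  have main : ∀ k, ω.jumpTime k ≠ ⊤ → ω (ω.jumpTime k).toNNReal ≠ none := by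
    intro k
    induction k with
    | zero => simpa using h0
    | succ k ih =>
      intro hk
      have hk' : ω.jumpTime k ≠ ⊤ := ne_top_of_le_ne_top hk (ω.jumpTime_mono k.le_succ)
      have h1 := Path.jumpTime_succ (ENNReal.coe_toNNReal hk').symm
      exact h.state_ne_none (ih hk') (h1.symm.trans (ENNReal.coe_toNNReal hk).symm)
  exact main (k + 1)

/-- A death at `t` with a left limit in `V` would be the next jump after a time `w` shortly before,
hence one of the numbered jumps. -/
theorem JumpsInside.diesOnlyByExplosion {ω : Path G} (h : JumpsInside ω) : DiesOnlyByExplosion ω := by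
  intro t ht x hx
  have ht0 : 0 < t := pos_iff_ne_zero.mpr fun h0 => h.1 (h0 ▸ ht)
  obtain ⟨u, hu, hu'⟩ := (mem_nhdsLT_iff_exists_Ioo_subset' ht0).mp hx
  obtain ⟨w, hw1, hw2⟩ := exists_between (show u < t from hu)
  have hxw : ω w = some x := hu' ⟨hw1, hw2⟩
  have hn : ω.nextJump w = t := Path.nextJump_eq_coe_iff.mpr ⟨hw2, fun v hv hvt => by
    rw [hxw]
    exact hu' ⟨hw1.trans_le hv, hvt⟩, by simp [ht, hxw]⟩
  obtain ⟨k, hk1, hk2⟩ := Path.exists_jumpTime_le_lt (by simp [hxw] : ω w ≠ none)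
  have hk : ω.jumpTime k ≠ ⊤ := ne_top_of_le_ne_top ENNReal.coe_ne_top hk1
  have h1 := Path.jumpTime_succ (ENNReal.coe_toNNReal hk).symm
  have hle : (ω.jumpTime k).toNNReal ≤ w := by
    simpa using ENNReal.toNNReal_mono ENNReal.coe_ne_top hk1
  rw [h1] at hk2
  have h2 : ω.nextJump (ω.jumpTime k).toNNReal = t := by
    rw [← Path.nextJump_eq_of_lt hle hk2, hn]
  have h3 := h.2 k (by rw [h1, h2]; exact ENNReal.coe_ne_top)
  rw [h1, h2, ENNReal.toNNReal_coe] at h3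
  exact h3 ht

theorem exists_hasJumpRates [Countable V] [G.LocallyFinite] (hT : IsLSCStoppingTime T)
    (hr : IsTerminatedRates T r) (x₀ : V) :
    ∃ P : Measure (Path G), HasJumpRates T r x₀ P := by
  let _ : MeasurableSpace V := ⊤
  have : DiscreteMeasurableSpace V := ⟨fun _ => trivial⟩
  have : Nonempty (ℝ × V) := ⟨(0, x₀)⟩
  -- Every jump is sampled as a measurable function of the history and a uniform variable.
  obtain ⟨f, hf, hfK⟩ := (nextKernel hr x₀).exists_measurable_map_eq_unitInterval
  have hΦ := measurable_randomPath hf x₀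
  have hQ : IsProbabilityMeasure (uniformLaw.map (randomPath (G := G) f x₀)) :=
    Measure.isProbabilityMeasure_map hΦ.aemeasurable
  have hstep := hasOneStepLaw_randomPath hT hr hf hfK
  refine ⟨_, uniformLaw.map (randomPath f x₀), hQ, ?_, ?_, ?_,
    (measurable_kill_deathTime hT x₀).aemeasurable, rfl⟩
  · refine (ae_map_iff hΦ.aemeasurable
      (Path.measurable_eval 0 (MeasurableSet.of_discrete (s := {some x₀})))).mpr (.of_forall fun e => ?_)
    exact chainPath_zero (isJumpChain_randomChain e)
  · have h1 := (ae_map_iff (μ := uniformLaw) hΦ.aemeasurable measurableSet_jumpsInside).mpr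
      (.of_forall fun e => (diesOnlyByExplosion_chainPath (isJumpChain_randomChain e)).jumpsInside
        (by simp [chainPath_zero (isJumpChain_randomChain e)]))
    filter_upwards [h1] with ω hω using hω.diesOnlyByExplosion
  · exact hstep.evolvesWithRates hT hr (exists_isCondLaw hΦ)

end

end JumpRates

end

theorem theoremA1 {V : Type*} [Countable V] (G : SimpleGraph V) [G.LocallyFinite]
    (T : JumpRates.InfPath G → ℝ≥0∞) (hT : JumpRates.IsLSCStoppingTime T)
    (r : ℝ≥0 → V → V → JumpRates.InfPath G → ℝ≥0) (hr : JumpRates.IsTerminatedRates T r)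
    (x₀ : V) :
    (∃ P : Measure (JumpRates.Path G), IsProbabilityMeasure P ∧
      JumpRates.HasJumpRates T r x₀ P) ∧
    (JumpRates.IsRegular T →
      (∀ P P' : Measure (JumpRates.Path G), JumpRates.HasJumpRates T r x₀ P →
        JumpRates.HasJumpRates T r x₀ P' → P = P') ∧
      (∀ P : Measure (JumpRates.Path G), JumpRates.HasJumpRates T r x₀ P →
        ∀ (l : ℕ) (x : Fin (l + 1) → V) (hx : ∀ i : Fin l, G.Adj (x i.castSucc) (x i.succ))
          (D : Fin l → Set ℝ≥0) (t : ℝ≥0), x 0 = x₀ → (∀ i, MeasurableSet (D i)) → 0 < t →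
          P (JumpRates.pathEvent x hx D t) =
            ∫⁻ s in {s : Fin l → ℝ | ∀ i, 0 ≤ s i ∧ (s i).toNNReal ∈ D i},
              ENNReal.ofReal (JumpRates.pathDensity T r x hx t (fun i => (s i).toNNReal)))) := by
  refine ⟨?_, fun _ => ⟨fun P P' hP hP' => hP.unique hT hr hP',
    fun P hP l x hx D t hx0 hD _ => hP.measure_pathEvent hT hr hx t hx0 hD⟩⟩
  obtain ⟨P, hP⟩ := JumpRates.exists_hasJumpRates hT hr x₀
  exact ⟨P, hP.isProbabilityMeasure, hP⟩
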